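/- **Setting.** A coin is a $2\times 2$ unitary matrix. Given coins $U_x=\begin{bmatrix} a_x & b_x\\ c_x & d_x\end{bmatrix}$ ($x\in\mathbb Z$) and an initial state $\Psi_0:\mathbb Z\to\mathbb C^2$ with $\sum_x\|\Psi_0(x)\|^2=1$, the quantum walk on $\mathbb Z$ is $$\Psi_{n+1}(x)=\begin{bmatrix} a_{x+1}\Psi_n^{(L)}(x+1)+b_{x+1}\Psi_n^{(R)}(x+1)\\ c_{x-1}\Psi_n^{(L)}(x-1)+d_{x-1}\Psi_n^{(R)}(x-1)\end{bmatrix},$$ and $X_n$ denotes its position at time $n$: $P(X_n=x)=\mu_n(x)=\|\Psi_n(x)\|^2$. The time-averaged limit measure is $\overline\mu_\infty(x)=\lim_{T\to\infty}\frac1T\sum_{n=0}^{T-1}\mu_n(x)$. For $0<r<1$ let $$f_K(x;r)=\frac{\sqrt{1-r^2}}{\pi(1-x^2)\sqrt{r^2-x^2}}\,I_{(-r,r)}(x)$$ be the Konno density. For given coins $(U_x)_{x\in\mathbb Z}$, the class $\mathcal M_K$ consists of the probability measures $\nu$ on $\mathbb R$ that are the weak limit of the laws of $X_n/n$ for some normalized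 initial state and that have the form $\nu(dx)=C\delta_0(dx)+(1-C)\,\widetilde w(x)f_K(x;r)\,dx$, where $C\in[0,1)$, $r\in(0,1)$ and the function $\widetilde w$ is nonnegative on $(-r,r)$ and is a rational function on each of the half-lines $x\ge 0$ and $x<0$. **Theorem.** Let $U=\begin{bmatrix} a & b\\ c& d\end{bmatrix}$ and $U_0=\begin{bmatrix} a_0 & b_0\\ c_0& d_0\end{bmatrix}$ be unitary with $\det U=\det U_0$, $a\neq0$, $c\ne0$ and $a_0\ne0$. Consider the one-defect walk, whose coin is $U_0$ at $x=0$ and $U$ at every $x\neq0$, started at the origin with coin state ${}^T[\alpha,\beta]$ (that is, $\Psi_0(0)={}^T[\alpha,\beta]$ and $\Psi_0(x)=0$ for $x\ne0$), where $|\alpha|^2+|\beta|^2=1$. Put $m=\mathrm{Re}(\bar c c_0)$, $$\gamma(x)=\begin{cases}|\alpha|^2(1-2m+|c_0|^2)+|\beta|^2|a_0|^2+2\mathrm{Re}\big(a_0\alpha\overline{(b-b_0)\beta}\big), & x\ge 0,\\ |\beta|^2(1-2m+|c_0|^2)+|\alpha|^2|a_0|^2-2\mathrm{Re}\big(a_0\alpha\overline{(b-b_0)\beta}\big),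 & x<0,\end{cases}$$ $$w(x)=\frac{|c|^2x^2}{(|c|^2-m)^2+(|c|^2-m^2)x^2}\left[\gamma(x)-|a_0|^2\left\{(|\alpha|^2-|\beta|^2)+\frac{2\mathrm{Re}(a_0\alpha\overline{b_0\beta})}{|a_0|^2}\right\}x\right].$$ Then the limit $\overline\mu_\infty(x)$ exists for every $x\in\mathbb Z$; its total mass $C=\sum_{x\in\mathbb Z}\overline\mu_\infty(x)$ satisfies $0\le C<1$; $w\ge0$ on $(-|a|,|a|)$; and, as $n\to\infty$, $X_n/n$ converges weakly to the probability measure $$\nu(dx)=C\,\delta_0(dx)+w(x)f_K(x;|a|)\,dx .$$ Moreover $\nu$ belongs to the class $\mathcal M_K$ of this walk. (The value $w(0)$ is immaterial when $m=|c|^2$, where the formula reads $0/0$ at $x=0$; it is taken to be $0$.) -/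

import Mathlib

open MeasureTheory Filter Topology

noncomputable section

namespace QuantumWalk

/-- A `2 × 2` unitary quantum coin `[[a, b], [c, d]]`. -/
abbrev Coin : Type := Matrix.unitaryGroup (Fin 2) ℂ

/-- The entries of the coin `[[a, b], [c, d]]`. -/
def Coin.a (U : Coin) : ℂ := (U : Matrix (Fin 2) (Fin 2) ℂ) 0 0
def Coin.b (U : Coin) : ℂ := (U : Matrix (Fin 2) (Fin 2) ℂ) 0 1
def Coin.c (U : Coin) : ℂ := (U : Matrix (Fin 2) (Fin 2) ℂ) 1 0
def Coin.d (U : Coin) : ℂ := (U : Matrix (Fin 2) (Fin 2) ℂ) 1 1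

/-- The determinant of a coin. -/
def Coin.Δ (U : Coin) : ℂ := (U : Matrix (Fin 2) (Fin 2) ℂ).det

/-- A state assigns to each site the amplitudes of left (component `0`) and right (component `1`)
chirality. -/
abbrev State : Type := ℤ → Fin 2 → ℂ

/-- The weight of the state `Ψ` at the site `x`, that is `|Ψ^L(x)|² + |Ψ^R(x)|²`. -/
def siteWeight (Ψ : State) (x : ℤ) : ℝ := ‖Ψ x 0‖ ^ 2 + ‖Ψ x 1‖ ^ 2

/-- One step of the walk: the coin `U x` acts at each site `x`, then left chirality moves one
step to the left and right chirality one step to the right. -/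
def step (U : ℤ → Coin) (Ψ : State) : State := fun x =>
  ![(U (x + 1)).a * Ψ (x + 1) 0 + (U (x + 1)).b * Ψ (x + 1) 1,
    (U (x - 1)).c * Ψ (x - 1) 0 + (U (x - 1)).d * Ψ (x - 1) 1]

/-- The state at time `n` of the walk started in `Ψ₀`. -/
def evolve (U : ℤ → Coin) (Ψ₀ : State) (n : ℕ) : State := (step U)^[n] Ψ₀

/-- A state is normalized if its total weight is `1`. -/
def IsNormalized (Ψ : State) : Prop := HasSum (siteWeight Ψ) 1

/-- Normalized states. -/
abbrev UnitState : Type := {Ψ : State // IsNormalized Ψ}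

/-- The coin preserves the norm on `ℂ²`. -/
theorem coin_norm (U : Coin) (u v : ℂ) :
    ‖U.a * u + U.b * v‖ ^ 2 + ‖U.c * u + U.d * v‖ ^ 2 = ‖u‖ ^ 2 + ‖v‖ ^ 2 := by
  have h : star (U : Matrix (Fin 2) (Fin 2) ℂ) * (U : Matrix (Fin 2) (Fin 2) ℂ) = 1 :=
    Matrix.UnitaryGroup.star_mul_self U
  have h00 := congrFun (congrFun h 0) 0
  have h01 := congrFun (congrFun h 0) 1
  have h10 := congrFun (congrFun h 1) 0
  have h11 := congrFun (congrFun h 1) 1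
  simp only [Matrix.mul_apply, Fin.sum_univ_two, Matrix.star_apply, Matrix.one_apply,
    RCLike.star_def] at h00 h01 h10 h11
  norm_num at h00 h01 h10 h11
  have key : ∀ z : ℂ, ((‖z‖ ^ 2 : ℝ) : ℂ) = (starRingEnd ℂ) z * z := by
    intro z
    rw [mul_comm, Complex.mul_conj, Complex.normSq_eq_norm_sq]
  apply Complex.ofReal_injective
  rw [Complex.ofReal_add, Complex.ofReal_add, key, key, key, key]
  simp only [map_add, map_mul, Coin.a, Coin.b, Coin.c, Coin.d]
  linear_combination (starRingEnd ℂ u * u) * h00 + (starRingEnd ℂ u * v) * h01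
    + (starRingEnd ℂ v * u) * h10 + (starRingEnd ℂ v * v) * h11

/-- One step of the walk preserves normalization. -/
theorem step_isNormalized {U : ℤ → Coin} {Ψ : State} (h : IsNormalized Ψ) :
    IsNormalized (step U Ψ) := by
  obtain ⟨A, hA⟩ : ∃ A : ℤ → ℝ, ∀ x, A x = ‖(U x).a * Ψ x 0 + (U x).b * Ψ x 1‖ ^ 2 :=
    ⟨_, fun _ => rfl⟩
  obtain ⟨B, hB⟩ : ∃ B : ℤ → ℝ, ∀ x, B x = ‖(U x).c * Ψ x 0 + (U x).d * Ψ x 1‖ ^ 2 :=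
    ⟨_, fun _ => rfl⟩
  have hAB : ∀ x, A x + B x = siteWeight Ψ x := fun x => by
    rw [hA, hB]
    exact coin_norm (U x) _ _
  have hA0 : ∀ x, 0 ≤ A x := fun x => by rw [hA]; positivity
  have hB0 : ∀ x, 0 ≤ B x := fun x => by rw [hB]; positivity
  have hs : Summable (siteWeight Ψ) := HasSum.summable h
  have sA : Summable A := Summable.of_nonneg_of_le hA0
    (fun x => by linarith [hAB x, hB0 x]) hs
  have sB : Summable B := Summable.of_nonneg_of_le hB0
    (fun x => by linarith [hAB x, hA0 x]) hs
  have e : (∑' x, A x) + (∑' x, B x) = 1 := by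
    rw [← sA.tsum_add sB, ← HasSum.tsum_eq h]
    exact tsum_congr hAB
  have h1 : HasSum (A ∘ Equiv.addRight (1 : ℤ)) (∑' x, A x) :=
    (Equiv.addRight (1 : ℤ)).hasSum_iff.mpr sA.hasSum
  have h2 : HasSum (B ∘ Equiv.subRight (1 : ℤ)) (∑' x, B x) :=
    (Equiv.subRight (1 : ℤ)).hasSum_iff.mpr sB.hasSum
  have h3 := h1.add h2
  rw [e] at h3
  have h4 : siteWeight (step U Ψ) =
      fun x => (A ∘ Equiv.addRight (1 : ℤ)) x + (B ∘ Equiv.subRight (1 : ℤ)) x := by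
    funext x
    simp [siteWeight, step, hA, hB]
  rw [IsNormalized, h4]
  exact h3

/-- The walk preserves normalization. -/
theorem evolve_isNormalized {U : ℤ → Coin} {Ψ : State} (h : IsNormalized Ψ) (n : ℕ) :
    IsNormalized (evolve U Ψ n) := by
  induction n with
  | zero => exact h
  | succ n ih =>
    unfold evolve at ih ⊢
    rw [Function.iterate_succ_apply']
    exact step_isNormalized ih

/-- The probability `μ_n(x)` of finding the walker at the site `x` at time `n`. -/
def prob (U : ℤ → Coin) (Ψ₀ : State) (n : ℕ) (x : ℤ) : ℝ := siteWeight (evolve U Ψ₀ n) x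

/-- The time average `T⁻¹ ∑_{n < T} μ_n(x)`. -/
def timeAverage (U : ℤ → Coin) (Ψ₀ : State) (T : ℕ) (x : ℤ) : ℝ :=
  (1 / (T : ℝ)) * ∑ n ∈ Finset.range T, prob U Ψ₀ n x

/-- `μ` is the time-averaged limit measure: `μ(x) = lim_T T⁻¹ ∑_{n < T} μ_n(x)` for all `x`. -/
def IsTimeAveragedLimit (U : ℤ → Coin) (Ψ₀ : State) (μ : ℤ → ℝ) : Prop :=
  ∀ x, Tendsto (fun T => timeAverage U Ψ₀ T x) atTop (𝓝 (μ x))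

/-- The law of the position `X_n`, given by `P(X_n = x) = μ_n(x)`. -/
def positionLaw (U : ℤ → Coin) (Ψ₀ : UnitState) (n : ℕ) : ProbabilityMeasure ℤ :=
  ⟨Measure.sum fun x : ℤ => ENNReal.ofReal (prob U Ψ₀.1 n x) • Measure.dirac x, ⟨by
    have h : HasSum (prob U Ψ₀.1 n) 1 := evolve_isNormalized Ψ₀.2 n
    have h0 : ∀ x, 0 ≤ prob U Ψ₀.1 n x := fun x => by
      unfold prob siteWeight
      positivity
    rw [Measure.sum_apply _ MeasurableSet.univ]
    simp only [Measure.smul_apply, measure_univ, smul_eq_mul, mul_one]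
    rw [← ENNReal.ofReal_tsum_of_nonneg h0 h.summable, h.tsum_eq, ENNReal.ofReal_one]⟩⟩

/-- The law of `X_n / n`. -/
def rescaledLaw (U : ℤ → Coin) (Ψ₀ : UnitState) (n : ℕ) : ProbabilityMeasure ℝ :=
  (positionLaw U Ψ₀ n).map (f := fun x : ℤ => (x : ℝ) / (n : ℝ))
    (measurable_of_countable _).aemeasurable

/-- `X_n / n` converges weakly to `ν`. (The topology of `ProbabilityMeasure ℝ` is that of weak
convergence.) -/
def HasWeakLimit (U : ℤ → Coin) (Ψ₀ : UnitState) (ν : ProbabilityMeasure ℝ) : Prop :=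
  Tendsto (fun n : ℕ => rescaledLaw U Ψ₀ n) atTop (𝓝 ν)

/-- The coins of the walk with one defect: `U₀` at the origin and `U` elsewhere. -/
def oneDefect (U U₀ : Coin) : ℤ → Coin := fun x => if x = 0 then U₀ else U

/-- The state concentrated at the origin with coin state `(α, β)`. -/
def originState (α β : ℂ) : State := fun x => if x = 0 then ![α, β] else 0

theorem originState_isNormalized {α β : ℂ} (h : ‖α‖ ^ 2 + ‖β‖ ^ 2 = 1) :
    IsNormalized (originState α β) := by
  have h1 := hasSum_single (f := siteWeight (originState α β)) 0 (fun x hx => by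
    simp [siteWeight, originState, hx])
  have h2 : siteWeight (originState α β) 0 = 1 := by
    simpa [siteWeight, originState] using h
  rw [h2] at h1
  exact h1

/-- The Konno density
`f_K(x; r) = √(1 - r²) / (π (1 - x²) √(r² - x²))` for `|x| < r`, and `0` otherwise. -/
def konnoDensity (x r : ℝ) : ℝ :=
  Set.indicator (Set.Ioo (-r) r)
    (fun y => √(1 - r ^ 2) / (Real.pi * (1 - y ^ 2) * √(r ^ 2 - y ^ 2))) x

/-- The measure `C δ₀(dx) + w(x) f_K(x; r) dx` (for `C ≥ 0` and `w ≥ 0` on `(-r, r)`). -/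
def konnoMeasure (C r : ℝ) (w : ℝ → ℝ) : Measure ℝ :=
  ENNReal.ofReal C • Measure.dirac 0 +
    (volume : Measure ℝ).withDensity fun x => ENNReal.ofReal (w x * konnoDensity x r)

/-- `w` is given by a rational function on each of the half-lines `x ≥ 0` and `x < 0`. -/
def IsPiecewiseRational (w : ℝ → ℝ) : Prop :=
  ∃ p q p' q' : Polynomial ℝ, q ≠ 0 ∧ q' ≠ 0 ∧
    (∀ x : ℝ, 0 ≤ x → w x = p.eval x / q.eval x) ∧
    (∀ x : ℝ, x < 0 → w x = p'.eval x / q'.eval x)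

/-- The weak limit measures of the walk with coins `U`, over all normalized initial states. -/
def weakLimitMeasures (U : ℤ → Coin) : Set (ProbabilityMeasure ℝ) :=
  {ν | ∃ Ψ₀ : UnitState, HasWeakLimit U Ψ₀ ν}

/-- The universality class `M_K` of the walk with coins `U`: the weak limit measures of the form
`C δ₀(dx) + (1 - C) w(x) f_K(x; r) dx`. -/
def konnoClass (U : ℤ → Coin) : Set (ProbabilityMeasure ℝ) :=
  {ν | ν ∈ weakLimitMeasures U ∧ ∃ (C r : ℝ) (w : ℝ → ℝ),
    0 ≤ C ∧ C < 1 ∧ 0 < r ∧ r < 1 ∧ IsPiecewiseRational w ∧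
    (∀ x ∈ Set.Ioo (-r) r, 0 ≤ w x) ∧
    (ν : Measure ℝ) = konnoMeasure C r fun x => (1 - C) * w x}

/-- `m = Re(c̄ c₀)`. -/
def defectParam (U U₀ : Coin) : ℝ := ((starRingEnd ℂ) U.c * U₀.c).re

/-- The function `γ` in the weight of the limit density. -/
def gammaFun (U U₀ : Coin) (α β : ℂ) (x : ℝ) : ℝ :=
  if 0 ≤ x then
    ‖α‖ ^ 2 * (1 - 2 * defectParam U U₀ + ‖U₀.c‖ ^ 2) + ‖β‖ ^ 2 * ‖U₀.a‖ ^ 2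
      + 2 * (U₀.a * α * (starRingEnd ℂ) ((U.b - U₀.b) * β)).re
  else
    ‖β‖ ^ 2 * (1 - 2 * defectParam U U₀ + ‖U₀.c‖ ^ 2) + ‖α‖ ^ 2 * ‖U₀.a‖ ^ 2
      - 2 * (U₀.a * α * (starRingEnd ℂ) ((U.b - U₀.b) * β)).re

/-- The weight `w` of the limit density with respect to the Konno density. -/
def weight (U U₀ : Coin) (α β : ℂ) (x : ℝ) : ℝ :=
  ‖U.c‖ ^ 2 * x ^ 2 /
      ((‖U.c‖ ^ 2 - defectParam U U₀) ^ 2 + (‖U.c‖ ^ 2 - defectParam U U₀ ^ 2) * x ^ 2) *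
    (gammaFun U U₀ α β x
      - ‖U₀.a‖ ^ 2 * ((‖α‖ ^ 2 - ‖β‖ ^ 2)
          + 2 * (U₀.a * α * (starRingEnd ℂ) (U₀.b * β)).re / ‖U₀.a‖ ^ 2) * x)

end QuantumWalk

end

open MeasureTheory Filter Topology

noncomputable section

namespace QuantumWalk

/-! A gauge transformation (`IsGauge`) turns the coins into `[[r, s], [-s, r]]` with `r = |a|`, `s =
|c|`, and the defect into `[[a₀, b₀], [-b̄₀, ā₀]]`; equality of the determinants is what lets one
gauge serve both coins. The generating functions `∑ zⁿ Ψₙ(x)` are then explicit. Let `y` be the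
return amplitude from a half-line, that is `schur` at `w = z²`. Moving one site outwards multiplies
by `z q` with `q = r / (1 + s y)`, and the defect contributes the denominator `1 + 2 p y + y²` with
`p = Re b₀` (`genFun_step`).

The amplitudes are Taylor coefficients, hence integrals over `z = exp(iθ)`, and these split in
three. On the bands `sin² θ > s²` one has `|q| = 1`, and the substitution `cos θ = r cos k` produces
a wave packet with group velocity `v(k)`. In the gaps the modes decay, and their contribution is
bounded, uniformly in time, by a square-summable function of the position. Zeros of the denominator
inside the gaps, which occur only for `p < s`, are bound states: they contribute finitely many
characters in `n`, with amplitude decaying in `x`. This is `bandSplit_amp`. The exponents are a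
compromise: the error `(i + 1)^(-3/4)` is square-summable, while its price `|s² - sin² θ|^(-7/8)` at
the band edges is still integrable.

Consequently the law at time `n` differs from ballistic weights by an error controlled by a summable
function independent of `n` (`BallisticSplit`). Under the scaling `x / n` the localized part
collapses to the point mass at `0`. Almost quasi-periodicity gives the Cesàro limits, whose total
mass is one minus the ballistic mass.

Parseval and Lévy show that a packet with profile `F` is asymptotically distributed as `v(k)` under
`|F|² dk` (`packet_charFun`). A uniform momentum has a velocity with the Konno density
(`konnoDensity_velocity`). Symmetrized in `k`, the profile depends on `v` alone, through a quadratic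
form divided by `(s - p)² + (1 - p²) v²` (`packetAmp_density`); this is the weight. Positivity of
that form (`mul_emission_le`) gives `w ≥ 0` and `C < 1`. -/

/-! ### The Schur function of a half-line. -/

/-- The square root of `(1 - w)² + 4 s² w` that is holomorphic in the unit disc. -/
def discRoot (r s : ℝ) (w : ℂ) : ℂ :=
  (1 - (r + s * Complex.I) ^ 2 * w) ^ (1 / 2 : ℂ) * (1 - (r - s * Complex.I) ^ 2 * w) ^ (1 / 2 : ℂ)

/-- The generating function of the returns to the origin from a half-line. -/
def schur (r s : ℝ) (w : ℂ) : ℂ := (w - 1 + discRoot r s w) / (2 * s)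

theorem cpow_half_sq (z : ℂ) : (z ^ (1 / 2 : ℂ)) ^ 2 = z := by
  rw [one_div]
  exact_mod_cast Complex.cpow_nat_inv_pow z two_ne_zero

section
variable {r s : ℝ}

theorem rotor_norm (h : r ^ 2 + s ^ 2 = 1) : ‖((r : ℂ) + s * Complex.I) ^ 2‖ = 1 := by
  rw [norm_pow, ← Complex.normSq_eq_norm_sq, Complex.normSq_add_mul_I, h]

theorem rotor_norm' (h : r ^ 2 + s ^ 2 = 1) : ‖((r : ℂ) - s * Complex.I) ^ 2‖ = 1 := by
  have := rotor_norm (r := r) (s := -s) (by simpa using h)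
  simpa [sub_eq_add_neg] using this

theorem discRoot_sq (h : r ^ 2 + s ^ 2 = 1) (w : ℂ) :
    discRoot r s w ^ 2 = (1 - w) ^ 2 + 4 * s ^ 2 * w := by
  have h' : (r : ℂ) ^ 2 + s ^ 2 = 1 := by exact_mod_cast h
  have hI := Complex.I_sq
  rw [discRoot, mul_pow, cpow_half_sq, cpow_half_sq]
  have : ((r + s * Complex.I) ^ 2 : ℂ) = 1 - 2 * s ^ 2 + 2 * r * s * Complex.I := by
    linear_combination h' + s ^ 2 * hI
  rw [this]
  have : ((r - s * Complex.I) ^ 2 : ℂ) = 1 - 2 * s ^ 2 - 2 * r * s * Complex.I := by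
    linear_combination h' + s ^ 2 * hI
  rw [this]
  linear_combination 4 * s ^ 2 * w ^ 2 * h' - 4 * r ^ 2 * s ^ 2 * w ^ 2 * hI

/-- On the closed disc `1 - u w` has nonnegative real part and meets the branch cut only at `0`,
where a power with exponent of positive real part is still continuous. -/
theorem continuousAt_sqrt_one_sub {u w : ℂ} (hu : ‖u‖ = 1) (hw : ‖w‖ ≤ 1) :
    ContinuousAt (fun w : ℂ => (1 - u * w) ^ (1 / 2 : ℂ)) w := by
  have h1 : ContinuousAt (fun p : ℂ × ℂ => p.1 ^ p.2) (1 - u * w, 1 / 2) := by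
    by_cases h0 : 1 - u * w = 0
    · rw [h0]
      exact Complex.continuousAt_cpow_zero_of_re_pos (by norm_num)
    · apply continuousAt_cpow
      have hle : ‖u * w‖ ≤ 1 := by rw [norm_mul, hu, one_mul]; exact hw
      by_cases hre : (u * w).re < 1
      · left; simp only [Complex.sub_re, Complex.one_re]; linarith
      · exfalso
        push Not at hre
        apply h0
        have h2 : Complex.normSq (u * w) ≤ 1 := by
          rw [Complex.normSq_eq_norm_sq]; nlinarith [norm_nonneg (u * w)]
        rw [Complex.normSq_apply] at h2
        apply Complex.ext
        · simp only [Complex.sub_re, Complex.one_re, Complex.zero_re]; nlinarith [mul_self_nonneg (u * w).im]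
        · simp only [Complex.sub_im, Complex.one_im, Complex.zero_im]; nlinarith [mul_self_nonneg (u * w).im]
  exact ContinuousAt.comp_of_eq (f := fun w : ℂ => ((1 - u * w, 1 / 2) : ℂ × ℂ)) h1
    (by fun_prop) rfl

theorem continuousAt_discRoot (h : r ^ 2 + s ^ 2 = 1) {w : ℂ} (hw : ‖w‖ ≤ 1) :
    ContinuousAt (discRoot r s) w :=
  (continuousAt_sqrt_one_sub (rotor_norm h) hw).mul (continuousAt_sqrt_one_sub (rotor_norm' h) hw)

theorem differentiableAt_sqrt_one_sub {u w : ℂ} (hu : ‖u‖ = 1) (hw : ‖w‖ < 1) :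
    DifferentiableAt ℂ (fun w : ℂ => (1 - u * w) ^ (1 / 2 : ℂ)) w := by
  refine DifferentiableAt.cpow (by fun_prop) (by fun_prop) ?_
  left
  have : (u * w).re < 1 := (Complex.re_le_norm _).trans_lt (by rw [norm_mul, hu, one_mul]; exact hw)
  simp only [Complex.sub_re, Complex.one_re]; linarith

theorem differentiableAt_discRoot (h : r ^ 2 + s ^ 2 = 1) {w : ℂ} (hw : ‖w‖ < 1) :
    DifferentiableAt ℂ (discRoot r s) w :=
  (differentiableAt_sqrt_one_sub (rotor_norm h) hw).mul
    (differentiableAt_sqrt_one_sub (rotor_norm' h) hw)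

theorem continuousAt_schur (h : r ^ 2 + s ^ 2 = 1) {w : ℂ} (hw : ‖w‖ ≤ 1) :
    ContinuousAt (schur r s) w := by
  have := continuousAt_discRoot h hw
  unfold schur
  fun_prop

theorem differentiableAt_schur (h : r ^ 2 + s ^ 2 = 1) {w : ℂ} (hw : ‖w‖ < 1) :
    DifferentiableAt ℂ (schur r s) w := by
  have := differentiableAt_discRoot h hw
  unfold schur
  fun_prop

theorem schur_zero : schur r s 0 = 0 := by
  simp [schur, discRoot]

theorem discRoot_eq (hs : 0 < s) (w : ℂ) : discRoot r s w = 2 * s * schur r s w + 1 - w := by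
  have : (s : ℂ) ≠ 0 := by exact_mod_cast hs.ne'
  rw [schur]; field_simp; ring

theorem schur_quad (hs : 0 < s) (h : r ^ 2 + s ^ 2 = 1) (w : ℂ) :
    s * schur r s w ^ 2 + (1 - w) * schur r s w = s * w := by
  have hs' : (s : ℂ) ≠ 0 := by exact_mod_cast hs.ne'
  have h1 := discRoot_sq h w
  rw [discRoot_eq hs] at h1
  have : (4 * s : ℂ) ≠ 0 := by simpa using hs'
  apply mul_left_cancel₀ this
  linear_combination h1

/-- The quadratic equation solved for `w`: `w = y (1 + s y) / (y + s)`. All modulus estimates on `y`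
come from this form. -/
theorem schur_mul (hs : 0 < s) (h : r ^ 2 + s ^ 2 = 1) (w : ℂ) :
    w * (schur r s w + s) = schur r s w * (1 + s * schur r s w) := by
  linear_combination -schur_quad hs h w

theorem schur_add_ne (hr : 0 < r) (hs : 0 < s) (h : r ^ 2 + s ^ 2 = 1) (w : ℂ) : schur r s w + s ≠ 0 := by
  intro h0
  have h1 := schur_mul hs h w
  have h2 : schur r s w = -s := by linear_combination h0
  rw [h2] at h1
  have h3 : (s : ℂ) * (1 - s ^ 2) = 0 := by linear_combination h1
  have h4 : s * (1 - s ^ 2) = 0 := by exact_mod_cast h3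
  have : 0 < s * (1 - s ^ 2) := by
    apply mul_pos hs; nlinarith
  linarith

/-- Turns `|w| < 1`, with `w` written in terms of `y` as in `schur_mul`, into a sign condition on
the product of `1 - |y|²` and `|1 + s y|² - r²`. -/
theorem norm_add_sq_identity (h : r ^ 2 + s ^ 2 = 1) (y : ℂ) :
    ‖y + s‖ ^ 2 - ‖y‖ ^ 2 * ‖1 + s * y‖ ^ 2 = (1 - ‖y‖ ^ 2) * (‖1 + s * y‖ ^ 2 - r ^ 2) := by
  simp only [← Complex.normSq_eq_norm_sq, Complex.normSq_apply, Complex.add_re, Complex.add_im,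
    Complex.ofReal_re, Complex.ofReal_im, Complex.mul_re, Complex.mul_im, Complex.one_re,
    Complex.one_im]
  have : r ^ 2 = 1 - s ^ 2 := by linarith
  rw [this]; ring

theorem schur_identity (hs : 0 < s) (h : r ^ 2 + s ^ 2 = 1) (w : ℂ) :
    ‖schur r s w + s‖ ^ 2 * (1 - ‖w‖ ^ 2) =
      (1 - ‖schur r s w‖ ^ 2) * (‖1 + s * schur r s w‖ ^ 2 - r ^ 2) := by
  rw [← norm_add_sq_identity h]
  have := congrArg (fun z => ‖z‖ ^ 2) (schur_mul hs h w)
  simp only [norm_mul, mul_pow] at this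
  linarith

/-- By `schur_identity` the modulus one is never attained in the open disc, so continuity along the
ray from `0`, where `y = 0`, keeps `|y|` below one. -/
theorem norm_schur_lt_one (hr : 0 < r) (hs : 0 < s) (h : r ^ 2 + s ^ 2 = 1) {w : ℂ} (hw : ‖w‖ < 1) :
    ‖schur r s w‖ < 1 := by
  by_contra! hge
  have hc : ContinuousOn (fun t : ℝ => ‖schur r s (t * w)‖) (Set.Icc 0 1) := by
    intro t ht
    have h1 : ‖(t : ℂ) * w‖ ≤ 1 := by
      rw [norm_mul, Complex.norm_real, Real.norm_of_nonneg ht.1]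
      nlinarith [ht.1, ht.2, norm_nonneg w]
    exact (ContinuousAt.comp (g := fun z => ‖schur r s z‖) (f := fun t : ℝ => (t : ℂ) * w)
      (continuousAt_schur h h1).norm (by fun_prop)).continuousWithinAt
  obtain ⟨t, ht, ht1⟩ : (1 : ℝ) ∈ (fun t : ℝ => ‖schur r s (t * w)‖) '' Set.Icc 0 1 := by
    apply intermediate_value_Icc zero_le_one hc
    simp [schur_zero, hge]
  have h2 := schur_identity hs h (t * w)
  simp only at ht1
  rw [ht1] at h2
  have h1 : ‖(t : ℂ) * w‖ < 1 := by
    rw [norm_mul, Complex.norm_real, Real.norm_of_nonneg ht.1]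
    nlinarith [ht.1, ht.2, norm_nonneg w]
  have h3 : 0 < ‖schur r s (t * w) + s‖ := norm_pos_iff.2 (schur_add_ne hr hs h _)
  have : 0 < ‖schur r s (t * w) + s‖ ^ 2 * (1 - ‖(t : ℂ) * w‖ ^ 2) := by
    apply mul_pos (by positivity); nlinarith [norm_nonneg ((t : ℂ) * w)]
  rw [h2] at this
  norm_num at this

/-- Once `1 - |y|² > 0`, the other factor in `schur_identity` must be positive too. The point is
that `r / (1 + s y)` has modulus less than one. -/
theorem lt_norm_one_add_schur (hr : 0 < r) (hs : 0 < s) (h : r ^ 2 + s ^ 2 = 1) {w : ℂ} (hw : ‖w‖ < 1) :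
    r < ‖1 + s * schur r s w‖ := by
  have h1 := norm_schur_lt_one hr hs h hw
  have h2 := schur_identity hs h w
  have h3 : 0 < ‖schur r s w + s‖ := norm_pos_iff.2 (schur_add_ne hr hs h _)
  have h4 : 0 < ‖schur r s w + s‖ ^ 2 * (1 - ‖w‖ ^ 2) := by
    apply mul_pos (by positivity); nlinarith [norm_nonneg w]
  rw [h2] at h4
  have h5 : 0 < 1 - ‖schur r s w‖ ^ 2 := by nlinarith [norm_nonneg (schur r s w)]
  have h6 := (pos_iff_pos_of_mul_pos h4).1 h5
  exact lt_of_pow_lt_pow_left₀ 2 (norm_nonneg _) (by linarith)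

theorem tendsto_radial {f : ℂ → ℂ} {w : ℂ} (hf : ContinuousAt f w) :
    Tendsto (fun t : ℝ => f (t * w)) (𝓝[<] 1) (𝓝 (f w)) := by
  have h1 : Tendsto (fun t : ℝ => (t : ℂ) * w) (𝓝[<] 1) (𝓝 w) := by
    have : Tendsto (fun t : ℝ => (t : ℂ) * w) (𝓝 1) (𝓝 ((1 : ℝ) * w)) :=
      Continuous.tendsto (by fun_prop) 1
    simp only [Complex.ofReal_one, one_mul] at this
    exact this.mono_left nhdsWithin_le_nhds
  exact hf.tendsto.comp h1

theorem eventually_radial {w : ℂ} (hw : ‖w‖ ≤ 1) : ∀ᶠ t : ℝ in 𝓝[<] 1, ‖(t : ℂ) * w‖ < 1 := by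
  filter_upwards [Ioo_mem_nhdsLT (show (0 : ℝ) < 1 by norm_num)] with t ht
  rw [norm_mul, Complex.norm_real, Real.norm_of_nonneg ht.1.le]
  nlinarith [ht.1, ht.2, norm_nonneg w]

theorem norm_schur_le_one (hr : 0 < r) (hs : 0 < s) (h : r ^ 2 + s ^ 2 = 1) {w : ℂ} (hw : ‖w‖ ≤ 1) :
    ‖schur r s w‖ ≤ 1 :=
  le_of_tendsto (tendsto_radial (continuousAt_schur h hw)).norm
    ((eventually_radial hw).mono fun _ ht => (norm_schur_lt_one hr hs h ht).le)

theorem le_norm_one_add_schur (hr : 0 < r) (hs : 0 < s) (h : r ^ 2 + s ^ 2 = 1) {w : ℂ} (hw : ‖w‖ ≤ 1) :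
    r ≤ ‖1 + s * schur r s w‖ :=
  ge_of_tendsto (tendsto_radial (f := fun w => 1 + s * schur r s w)
    (((continuousAt_schur h hw).const_mul _).const_add _)).norm
    ((eventually_radial hw).mono fun _ ht => (lt_norm_one_add_schur hr hs h ht).le)

theorem one_add_schur_ne (hr : 0 < r) (hs : 0 < s) (h : r ^ 2 + s ^ 2 = 1) {w : ℂ} (hw : ‖w‖ ≤ 1) :
    1 + s * schur r s w ≠ 0 := by
  have := le_norm_one_add_schur hr hs h hw
  intro h0
  rw [h0, norm_zero] at this
  linarith

/-- A root of modulus less than one of the quadratic equation is the Schur function. -/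
theorem eq_schur_of_quad (hr : 0 < r) (hs : 0 < s) (h : r ^ 2 + s ^ 2 = 1) {w y : ℂ} (hw : ‖w‖ = 1)
    (hy : s * y ^ 2 + (1 - w) * y = s * w) (hy1 : ‖y‖ < 1) : schur r s w = y := by
  by_contra hne
  have hs' : (s : ℂ) ≠ 0 := by exact_mod_cast hs.ne'
  have h1 := schur_quad hs h w
  have h2 : (schur r s w - y) * (s * (schur r s w + y) + (1 - w)) = 0 := by
    linear_combination h1 - hy
  have h3 : s * (schur r s w + y) + (1 - w) = 0 :=
    (mul_eq_zero.1 h2).resolve_left (sub_ne_zero.2 hne)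
  -- If the two roots differ, their product is `-w`, of modulus one; but one root has modulus below
  -- one and the other at most one.
  have h4 : schur r s w * y = -w := by
    apply mul_left_cancel₀ hs'
    linear_combination schur r s w * h3 - h1
  have h5 := congrArg norm h4
  rw [norm_mul, norm_neg, hw] at h5
  have := norm_schur_le_one hr hs h hw.le
  nlinarith [norm_nonneg y, norm_nonneg (schur r s w)]

/-- For `p = s` the resolvent denominator is therefore `discRoot` up to the nonvanishing factor `(y
+ s) / s`, so it vanishes only at the band edges. -/
theorem discRoot_mul (hs : 0 < s) (h : r ^ 2 + s ^ 2 = 1) (w : ℂ) :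
    discRoot r s w * (schur r s w + s) = s * (1 + 2 * s * schur r s w + schur r s w ^ 2) := by
  rw [discRoot_eq hs]
  linear_combination -schur_mul hs h w

/-- Dividing by `y` on the unit circle leaves the real number `2 p + y + ȳ`. -/
theorem norm_quad_of_norm_one (p : ℝ) {y : ℂ} (hy : ‖y‖ = 1) :
    ‖1 + 2 * p * y + y ^ 2‖ = 2 * |p + y.re| := by
  have h1 : y * (starRingEnd ℂ) y = 1 := by
    rw [Complex.mul_conj, Complex.normSq_eq_norm_sq, hy]; simp
  have h2 : 1 + 2 * p * y + y ^ 2 = y * ((2 * (p + y.re) : ℝ) : ℂ) := by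
    have : ((2 * y.re : ℝ) : ℂ) = y + (starRingEnd ℂ) y := by
      rw [Complex.add_conj]
    push_cast at this ⊢
    linear_combination -h1 - y * this
  rw [h2, norm_mul, hy, one_mul, Complex.norm_real, Real.norm_eq_abs, abs_mul]
  norm_num

theorem norm_one_add_sq_of_norm_one {y : ℂ} (hy : ‖y‖ = 1) :
    ‖1 + s * y‖ ^ 2 = 1 + s ^ 2 + 2 * s * y.re := by
  have h1 : y.re ^ 2 + y.im ^ 2 = 1 := by
    have : Complex.normSq y = 1 := by rw [Complex.normSq_eq_norm_sq, hy]; norm_num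
    rw [Complex.normSq_apply] at this; linarith
  simp only [← Complex.normSq_eq_norm_sq, Complex.normSq_apply, Complex.add_re, Complex.add_im,
    Complex.ofReal_re, Complex.ofReal_im, Complex.mul_re, Complex.mul_im, Complex.one_re,
    Complex.one_im]
  linear_combination s ^ 2 * h1

/-- In a spectral gap the modes decay. -/
theorem norm_one_add_schur_gap (hr : 0 < r) (hs : 0 < s) (h : r ^ 2 + s ^ 2 = 1) {w : ℂ} (hw : ‖w‖ = 1)
    (hy : ‖schur r s w‖ = 1) :
    r ^ 2 + (1 - s) * ‖discRoot r s w‖ ≤ ‖1 + s * schur r s w‖ ^ 2 := by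
  have h1 := norm_one_add_sq_of_norm_one (s := s) hy
  have h2 := le_norm_one_add_schur hr hs h hw.le
  have h3 := congrArg norm (discRoot_mul hs h w)
  rw [norm_mul, norm_mul, norm_quad_of_norm_one s hy, Complex.norm_real, Real.norm_of_nonneg hs.le] at h3
  have h4 : 0 ≤ s + (schur r s w).re := by
    have : r ^ 2 ≤ ‖1 + s * schur r s w‖ ^ 2 := by gcongr
    nlinarith
  rw [abs_of_nonneg h4] at h3
  -- Here `|1 + s y|² - r² = 2 s (s + Re y) = |discRoot| |y + s|`, so a lower bound for `|y + s|` is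
  -- all that is missing.
  have h5 : 1 - s ≤ ‖schur r s w + s‖ := by
    have := norm_sub_norm_le (schur r s w) (-(s : ℂ))
    rw [hy, norm_neg, Complex.norm_real, Real.norm_of_nonneg hs.le, sub_neg_eq_add] at this
    exact this
  nlinarith [norm_nonneg (discRoot r s w)]

/-- Off the band `sin² θ ≥ s²` the Schur function has modulus one. -/
theorem norm_schur_gap (hs : 0 < s) (h : r ^ 2 + s ^ 2 = 1) {z : ℂ} (hz : ‖z‖ = 1)
    (hgap : z.im ^ 2 < s ^ 2) : ‖schur r s (z ^ 2)‖ = 1 := by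
  set y := schur r s (z ^ 2) with hy
  have hq := schur_quad hs h (z ^ 2)
  rw [← hy] at hq
  have hzz : z * (starRingEnd ℂ) z = 1 := by
    rw [Complex.mul_conj, Complex.normSq_eq_norm_sq, hz]; simp
  -- Removing the phase `z` symmetrizes the quadratic equation to `s Y² - 2 i (Im z) Y = s`, which
  -- separates into real and imaginary parts.
  set Y := y * (starRingEnd ℂ) z with hY
  have hnY : ‖Y‖ = ‖y‖ := by rw [hY, norm_mul, RCLike.norm_conj, hz, mul_one]
  have hzim : z - (starRingEnd ℂ) z = ((2 * z.im : ℝ) : ℂ) * Complex.I := by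
    rw [Complex.sub_conj]
  have h1 : (s : ℂ) * Y ^ 2 - ((2 * z.im : ℝ) : ℂ) * Complex.I * Y = s := by
    rw [← hzim, hY]
    have e : (1 : ℂ) = (z * (starRingEnd ℂ) z) ^ 2 := by rw [hzz]; ring
    linear_combination (starRingEnd ℂ z) ^ 2 * hq + (s * (z * (starRingEnd ℂ) z + 1)
      + y * starRingEnd ℂ z * z * 1) * hzz
  have hre := congrArg Complex.re h1
  have him := congrArg Complex.im h1
  simp only [pow_two, Complex.sub_re, Complex.sub_im, Complex.mul_re, Complex.mul_im, Complex.ofReal_re,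
    Complex.ofReal_im, Complex.I_re, Complex.I_im] at hre him
  have hN : ‖Y‖ ^ 2 = Y.re ^ 2 + Y.im ^ 2 := by
    rw [← Complex.normSq_eq_norm_sq, Complex.normSq_apply]; ring
  -- A purely imaginary `Y = i t` would satisfy `s (1 + t²) = 2 t Im z`, which by the
  -- arithmetic-geometric mean inequality needs `|Im z| ≥ s`. Otherwise the imaginary part gives `s
  -- Im Y = Im z`, and the real part becomes `s |Y|² = s`.
  by_cases hR : Y.re = 0
  · exfalso
    rw [hR] at hre
    have e : s * (1 + Y.im ^ 2) = 2 * z.im * Y.im := by linarith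
    have e2 : s ^ 2 * (1 + Y.im ^ 2) ^ 2 = 4 * z.im ^ 2 * Y.im ^ 2 := by
      calc s ^ 2 * (1 + Y.im ^ 2) ^ 2 = (s * (1 + Y.im ^ 2)) ^ 2 := by ring
        _ = _ := by rw [e]; ring
    have hpos : 0 < Y.im ^ 2 := by
      by_contra hc
      have : Y.im ^ 2 = 0 := le_antisymm (not_lt.1 hc) (sq_nonneg _)
      rw [this] at e2; nlinarith [mul_pos hs hs]
    nlinarith [sq_nonneg (1 - Y.im ^ 2), mul_pos hs hs]
  · have e : s * Y.im = z.im := by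
      apply mul_left_cancel₀ hR; nlinarith
    have : s * (Y.re ^ 2 + Y.im ^ 2) = s := by
      rw [← e] at hre; linarith
    have h2 : ‖Y‖ ^ 2 = 1 := by
      rw [hN]; apply mul_left_cancel₀ hs.ne'; linarith
    rw [← hnY]
    exact (pow_eq_one_iff_of_nonneg (norm_nonneg Y) two_ne_zero).1 h2

/-- Pulling out `z²` leaves `(z - z̄)² + 4 s²`, and `(z - z̄)² = -4 (Im z)²` on the circle. -/
theorem norm_discRoot_sq (h : r ^ 2 + s ^ 2 = 1) {z : ℂ} (hz : ‖z‖ = 1) :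
    ‖discRoot r s (z ^ 2)‖ ^ 2 = 4 * |s ^ 2 - z.im ^ 2| := by
  have hzz : z * (starRingEnd ℂ) z = 1 := by
    rw [Complex.mul_conj, Complex.normSq_eq_norm_sq, hz]; simp
  have hzim : z - (starRingEnd ℂ) z = ((2 * z.im : ℝ) : ℂ) * Complex.I := by
    rw [Complex.sub_conj]
  have h1 : discRoot r s (z ^ 2) ^ 2 = z ^ 2 * ((4 * (s ^ 2 - z.im ^ 2) : ℝ) : ℂ) := by
    rw [discRoot_sq h]
    have e : (((2 * z.im : ℝ) : ℂ)) ^ 2 = - (z - (starRingEnd ℂ) z) ^ 2 := by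
      rw [hzim]; ring_nf; rw [Complex.I_sq]; ring
    push_cast at e ⊢
    linear_combination z ^ 2 * e + (-(z * (starRingEnd ℂ) z + 1) + 2 * z ^ 2) * hzz
  have h2 := congrArg norm h1
  rw [norm_pow, norm_mul, norm_pow, hz, Complex.norm_real, Real.norm_eq_abs, abs_mul] at h2
  rw [h2]; norm_num

end

/-! ### Taylor coefficients as circle averages. -/

/-- The `n`-th Taylor coefficient at `0` of `F`, as an average over the circle of radius `ρ`. -/
def coef (ρ : ℝ) (n : ℕ) (F : ℂ → ℂ) : ℂ := Real.circleAverage (fun z => (z ^ n)⁻¹ • F z) 0 ρ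

section coef
variable {ρ : ℝ} {F G : ℂ → ℂ} {n : ℕ}

theorem sphere_subset_ball (h0 : 0 < ρ) (h1 : ρ < 1) :
    Metric.sphere (0 : ℂ) |ρ| ⊆ Metric.ball 0 1 := by
  intro z hz
  rw [abs_of_pos h0] at hz
  simp only [mem_sphere_iff_norm, sub_zero] at hz
  simpa [hz] using h1

theorem circleIntegrable_coef (h0 : 0 < ρ) (h1 : ρ < 1) (hF : DifferentiableOn ℂ F (Metric.ball 0 1)) :
    CircleIntegrable (fun z => (z ^ n)⁻¹ • F z) 0 ρ := by
  apply ContinuousOn.circleIntegrable'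
  apply ContinuousOn.fun_smul
  · apply ContinuousOn.inv₀ (by fun_prop)
    intro z hz
    rw [abs_of_pos h0] at hz
    simp only [mem_sphere_iff_norm, sub_zero] at hz
    apply pow_ne_zero
    rw [← norm_pos_iff, hz]; exact h0
  · exact hF.continuousOn.mono (sphere_subset_ball h0 h1)

theorem coef_add (h0 : 0 < ρ) (h1 : ρ < 1) (hF : DifferentiableOn ℂ F (Metric.ball 0 1))
    (hG : DifferentiableOn ℂ G (Metric.ball 0 1)) :
    coef ρ n (fun z => F z + G z) = coef ρ n F + coef ρ n G := by
  unfold coef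
  rw [← Real.circleAverage_add (circleIntegrable_coef h0 h1 hF) (circleIntegrable_coef h0 h1 hG)]
  congr 1
  funext z
  simp [mul_add]

theorem coef_const_mul (c : ℂ) : coef ρ n (fun z => c * F z) = c * coef ρ n F := by
  unfold coef
  rw [← smul_eq_mul, ← Real.circleAverage_smul]
  congr 1
  funext z
  simp only [Pi.smul_apply, smul_eq_mul]
  ring

theorem coef_congr (h0 : 0 < ρ) (h1 : ρ < 1) (h : ∀ z, ‖z‖ < 1 → F z = G z) :
    coef ρ n F = coef ρ n G := by
  unfold coef
  apply Real.circleAverage_congr_sphere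
  intro z hz
  have := sphere_subset_ball h0 h1 hz
  simp only [Metric.mem_ball, dist_zero_right] at this
  simp only [h z this]

theorem coef_zero (h0 : 0 < ρ) (h1 : ρ < 1) (hF : DifferentiableOn ℂ F (Metric.ball 0 1)) :
    coef ρ 0 F = F 0 := by
  unfold coef
  simp only [pow_zero, inv_one, one_smul]
  apply DiffContOnCl.circleAverage
  apply DifferentiableOn.diffContOnCl
  apply hF.mono
  intro z hz
  have := Metric.closure_ball_subset_closedBall hz
  rw [abs_of_pos h0] at this
  simp only [Metric.mem_closedBall, dist_zero_right] at this
  simpa using this.trans_lt h1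

theorem coef_add_mul (h0 : 0 < ρ) (m : ℕ) : coef ρ (n + m) (fun z => z ^ m * F z) = coef ρ n F := by
  unfold coef
  apply Real.circleAverage_congr_sphere
  intro z hz
  rw [abs_of_pos h0] at hz
  simp only [mem_sphere_iff_norm, sub_zero] at hz
  have : z ≠ 0 := by rw [← norm_pos_iff, hz]; exact h0
  simp only [smul_eq_mul]
  field_simp
  ring

theorem coef_mul_of_lt (h0 : 0 < ρ) (h1 : ρ < 1) (hF : DifferentiableOn ℂ F (Metric.ball 0 1))
    {m : ℕ} (h : n < m) : coef ρ n (fun z => z ^ m * F z) = 0 := by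
  obtain ⟨k, rfl⟩ := Nat.exists_eq_add_of_lt h
  have e : (fun z => z ^ (n + k + 1) * F z) = fun z => z ^ n * (z ^ (k + 1) * F z) := by
    funext z; ring
  have := coef_add_mul (n := 0) (F := fun z => z ^ (k + 1) * F z) h0 n
  rw [zero_add] at this
  rw [e, this, coef_zero h0 h1 (by fun_prop)]
  simp

theorem coef_const (h0 : 0 < ρ) (c : ℂ) : coef ρ (n + 1) (fun _ => c) = 0 := by
  unfold coef
  have h2 : (fun z : ℂ => (z ^ (n + 1))⁻¹ • c) = fun z => c • (z ^ (n + 1))⁻¹ := by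
    funext z; simp [mul_comm]
  rw [h2, Real.circleAverage_fun_smul]
  rw [Real.circleAverage_eq_circleIntegral h0.ne']
  have : (fun z : ℂ => (z - 0)⁻¹ • (z ^ (n + 1))⁻¹) = fun z => (z - 0) ^ (-(n + 2 : ℤ)) := by
    funext z
    simp only [sub_zero, smul_eq_mul, zpow_neg, ← mul_inv]
    congr 1
    rw [show (n + 2 : ℤ) = ((n + 2 : ℕ) : ℤ) by push_cast; ring, zpow_natCast]
    ring
  rw [this, circleIntegral.integral_sub_zpow_of_ne (by omega)]
  simp

end coef

/-! ### Explicit generating functions of the walk. -/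

/-- `1 + 2 p y + y²`. -/
def resDen (p : ℝ) (y : ℂ) : ℂ := 1 + 2 * p * y + y ^ 2

/-- The basic generating functions. -/
def amp (r s p : ℝ) (Q : Polynomial ℂ) (m i : ℕ) (z : ℂ) : ℂ :=
  z ^ m * ((r / (1 + s * schur r s (z ^ 2))) ^ i *
    (Q.eval (schur r s (z ^ 2)) / resDen p (schur r s (z ^ 2))))

/-- For `|p| < 1` the roots are `-p ± i √(1 - p²)`, both on the unit circle. -/
theorem resDen_ne_zero {p : ℝ} (hp : |p| < 1) {y : ℂ} (hy : ‖y‖ < 1) : resDen p y ≠ 0 := by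
  intro h0
  obtain ⟨c, hc⟩ : ∃ c : ℝ, c ^ 2 = 1 - p ^ 2 :=
    ⟨√(1 - p ^ 2), Real.sq_sqrt (by nlinarith [abs_lt.1 hp])⟩
  have hc' : (c : ℂ) ^ 2 = 1 - p ^ 2 := by exact_mod_cast hc
  have h1 : (y + (p + c * Complex.I)) * (y + (p - c * Complex.I)) = 0 := by
    rw [resDen] at h0
    linear_combination h0 + hc' - c ^ 2 * Complex.I_sq
  rcases mul_eq_zero.1 h1 with h2 | h2
  · have : y = -(p + c * Complex.I) := by linear_combination h2
    have h3 : ‖y‖ ^ 2 = 1 := by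
      rw [this, norm_neg, ← Complex.normSq_eq_norm_sq, Complex.normSq_add_mul_I, hc]; ring
    nlinarith [norm_nonneg y]
  · have : y = -(p + (-c : ℝ) * Complex.I) := by push_cast; linear_combination h2
    have h3 : ‖y‖ ^ 2 = 1 := by
      rw [this, norm_neg, ← Complex.normSq_eq_norm_sq, Complex.normSq_add_mul_I, neg_sq, hc]; ring
    nlinarith [norm_nonneg y]

theorem norm_sq_lt_one {z : ℂ} (hz : ‖z‖ < 1) : ‖z ^ 2‖ < 1 := by
  rw [norm_pow]; nlinarith [norm_nonneg z]

section
variable {r s p : ℝ}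

theorem differentiableAt_schur_sq (h : r ^ 2 + s ^ 2 = 1) {z : ℂ} (hz : ‖z‖ < 1) :
    DifferentiableAt ℂ (fun z => schur r s (z ^ 2)) z :=
  DifferentiableAt.comp (g := schur r s) (f := fun z => z ^ 2) z
    (differentiableAt_schur h (norm_sq_lt_one hz)) (by fun_prop)

theorem differentiableOn_amp (hr : 0 < r) (hs : 0 < s) (h : r ^ 2 + s ^ 2 = 1) (hp : |p| < 1)
    (Q : Polynomial ℂ) (m i : ℕ) : DifferentiableOn ℂ (amp r s p Q m i) (Metric.ball 0 1) := by
  intro z hz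
  simp only [Metric.mem_ball, dist_zero_right] at hz
  apply DifferentiableAt.differentiableWithinAt
  have h1 := differentiableAt_schur_sq h hz
  have hw := norm_sq_lt_one hz
  have h2 := one_add_schur_ne hr hs h hw.le
  have h3 := resDen_ne_zero hp (norm_schur_lt_one hr hs h hw)
  have h4 : DifferentiableAt ℂ (fun z => Q.eval (schur r s (z ^ 2))) z :=
    DifferentiableAt.comp (g := fun y => Q.eval y) z Q.differentiable.differentiableAt h1
  have h5 : DifferentiableAt ℂ (fun z => resDen p (schur r s (z ^ 2))) z := by
    unfold resDen; fun_prop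
  have h6 : DifferentiableAt ℂ (fun z => r / (1 + s * schur r s (z ^ 2))) z :=
    DifferentiableAt.div (by fun_prop) (by fun_prop) h2
  unfold amp
  exact (by fun_prop : DifferentiableAt ℂ (fun z : ℂ => z ^ m) z).mul
    ((h6.pow i).mul (h4.div h5 h3))

end

/-- One step of the walk with coin `[[r, s], [-s, r]]` off the origin and
`[[a₀, b₀], [-b̄₀, ā₀]]` at the origin. -/
def coreStep (r s : ℝ) (a₀ b₀ : ℂ) (Ψ : State) : State := fun x =>
  ![(if x + 1 = 0 then a₀ else r) * Ψ (x + 1) 0 + (if x + 1 = 0 then b₀ else s) * Ψ (x + 1) 1,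
    (if x - 1 = 0 then -(starRingEnd ℂ) b₀ else -s) * Ψ (x - 1) 0
      + (if x - 1 = 0 then (starRingEnd ℂ) a₀ else r) * Ψ (x - 1) 1]

open Polynomial in
/-- The numerator of the generating function of the amplitude emitted to the right. -/
def rightNum (a₀ b₀ α β : ℂ) : Polynomial ℂ :=
  C (-(starRingEnd ℂ) b₀ * α + (starRingEnd ℂ) a₀ * β) - C α * X

open Polynomial in
/-- The numerator of the generating function of the amplitude emitted to the left. -/
def leftNum (a₀ b₀ α β : ℂ) : Polynomial ℂ := C (a₀ * α + b₀ * β) + C β * X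

open Polynomial in
/-- The generating functions of the amplitudes of the walk started at the origin. -/
def genFun (r s : ℝ) (a₀ b₀ α β : ℂ) : ℤ → Fin 2 → ℂ → ℂ
  | Int.ofNat 0 =>
    ![amp r s b₀.re (C α + C (b₀ * α + (starRingEnd ℂ) a₀ * β) * X) 0 0,
      amp r s b₀.re (C β + C ((starRingEnd ℂ) b₀ * β - a₀ * α) * X) 0 0]
  | Int.ofNat (k + 1) =>
    ![amp r s b₀.re (X * rightNum a₀ b₀ α β) (k + 1) (k + 1),
      amp r s b₀.re (rightNum a₀ b₀ α β) (k + 1) k]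
  | Int.negSucc k =>
    ![amp r s b₀.re (leftNum a₀ b₀ α β) (k + 1) k,
      amp r s b₀.re (-X * leftNum a₀ b₀ α β) (k + 1) (k + 1)]

section
variable {r s : ℝ} {a₀ b₀ : ℂ} (α β : ℂ)

theorem differentiableOn_genFun (hr : 0 < r) (hs : 0 < s) (h : r ^ 2 + s ^ 2 = 1) (hp : |b₀.re| < 1)
    (x : ℤ) (j : Fin 2) :
    DifferentiableOn ℂ (genFun r s a₀ b₀ α β x j) (Metric.ball 0 1) := by
  rcases x with (_ | k) | k <;> fin_cases j <;> exact differentiableOn_amp hr hs h hp _ _ _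

theorem genFun_at_zero (x : ℤ) (j : Fin 2) :
    genFun r s a₀ b₀ α β x j 0 = originState α β x j := by
  rcases x with (_ | k) | k <;> fin_cases j <;>
    simp [genFun, amp, schur_zero, resDen, originState, Int.negSucc_ne_zero]
  all_goals
    rw [if_neg (by omega)]
    simp

/-- The renewal equation `Φ = Ψ₀ + z S Φ`, which determines the Taylor coefficients recursively. Off
the defect it reduces to the two relations for `q` below; next to the defect it also needs the
unitarity of the defect coin. The power `z ^ 1` matches the shift in `coef_add_mul`. -/
theorem genFun_step (hr : 0 < r) (hs : 0 < s) (h : r ^ 2 + s ^ 2 = 1) (hp : |b₀.re| < 1)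
    (h₀ : ‖a₀‖ ^ 2 + ‖b₀‖ ^ 2 = 1) (x : ℤ) (j : Fin 2) {z : ℂ} (hz : ‖z‖ < 1) :
    genFun r s a₀ b₀ α β x j z = originState α β x j
      + z ^ 1 * coreStep r s a₀ b₀ (fun x j => genFun r s a₀ b₀ α β x j z) x j := by
  have hw := norm_sq_lt_one hz
  have h2 := one_add_schur_ne hr hs h hw.le
  have h3 := resDen_ne_zero hp (norm_schur_lt_one hr hs h hw)
  have h4 := schur_mul hs h (z ^ 2)
  have hrs : (r : ℂ) ^ 2 + s ^ 2 = 1 := by exact_mod_cast h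
  obtain ⟨y, hy⟩ : ∃ y, schur r s (z ^ 2) = y := ⟨_, rfl⟩
  obtain ⟨D, hD⟩ : ∃ D, resDen b₀.re y = D := ⟨_, rfl⟩
  obtain ⟨q, hq⟩ : ∃ q, (r : ℂ) / (1 + s * y) = q := ⟨_, rfl⟩
  rw [hy] at h2 h3 h4
  have hq1 : q * (1 + s * y) = r := by rw [← hq]; field_simp
  -- The reflection law of a half-line: the walker is reflected at the first site, or it is
  -- transmitted, returns from beyond and is transmitted back.
  have hq2 : z ^ 2 * (r * y * q + s) = y := by
    apply mul_right_cancel₀ h2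
    linear_combination z ^ 2 * r * y * hq1 + z ^ 2 * y * hrs + h4
  have hre : 2 * (b₀.re : ℂ) = b₀ + (starRingEnd ℂ) b₀ := by
    rw [Complex.add_conj]; push_cast; ring
  have ha : a₀ * (starRingEnd ℂ) a₀ + b₀ * (starRingEnd ℂ) b₀ = 1 := by
    rw [Complex.mul_conj, Complex.mul_conj, Complex.normSq_eq_norm_sq, Complex.normSq_eq_norm_sq]
    exact_mod_cast h₀
  have hD' : D = 1 + (b₀ + (starRingEnd ℂ) b₀) * y + y ^ 2 := by rw [← hD, resDen, hre]
  rw [hD] at h3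
  have e1 : ∀ k : ℕ, Int.ofNat k + 1 = Int.ofNat (k + 1) := fun _ => rfl
  have e2 : ∀ k : ℕ, Int.negSucc (k + 1) + 1 = Int.negSucc k := fun _ => rfl
  have e3 : Int.negSucc 0 + 1 = Int.ofNat 0 := rfl
  have e4 : ∀ k : ℕ, Int.ofNat (k + 1) - 1 = Int.ofNat k := fun k => by simp
  have e5 : ∀ k : ℕ, Int.negSucc k - 1 = Int.negSucc (k + 1) := fun _ => rfl
  have e6 : Int.ofNat 0 - 1 = Int.negSucc 0 := rfl
  have n1 : ∀ k : ℕ, Int.ofNat (k + 1) ≠ 0 := fun k => by simp; omega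
  have n2 : ∀ k : ℕ, Int.negSucc k ≠ 0 := fun k => Int.negSucc_ne_zero k
  have n3 : (Int.ofNat 0 = 0) = True := eq_true rfl
  -- The sites are `0`, `1`, `k + 2`, `-1`, `-k - 2`: one step receives amplitude from the defect
  -- coin only at `±1`, and only `0` carries the initial state.
  rcases x with (_ | _ | k) | (_ | k) <;> fin_cases j <;>
    simp only [coreStep, originState, e1, e2, e3, e4, e5, e6, n1, n2, n3, if_true, if_false,
      Fin.zero_eta, Fin.mk_one, Matrix.cons_val_zero, Matrix.cons_val_one, Pi.zero_apply,
      Fin.isValue]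
  all_goals
    simp only [genFun, Matrix.cons_val_zero, Matrix.cons_val_one, amp, hy, hD, hq,
      Polynomial.eval_add, Polynomial.eval_mul, Polynomial.eval_C, Polynomial.eval_X, rightNum,
      leftNum, Polynomial.eval_sub, Polynomial.eval_neg, Nat.zero_add, div_eq_mul_inv]
    obtain ⟨I, hI⟩ : ∃ I, D⁻¹ = I := ⟨_, rfl⟩
    have hDI : D * I = 1 := by rw [← hI]; exact mul_inv_cancel₀ h3
    rw [hI]
    set N := -(starRingEnd ℂ) b₀ * α + (starRingEnd ℂ) a₀ * β - α * y with hN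
    set N' := a₀ * α + b₀ * β + β * y with hN'
  · linear_combination (-N * I) * hq2 + α * hDI - α * I * hD'
  · linear_combination N' * I * hq2 + β * hDI - β * I * hD'
  · linear_combination (-z * q * N * I) * hq2
  · linear_combination z * I * α * y * ha
  · linear_combination (-z ^ (k + 2) * q ^ (k + 2) * N * I) * hq2
  · linear_combination z ^ (k + 2) * q ^ k * N * I * hq1
  · linear_combination (-z * I * β * y) * ha
  · linear_combination z * q * N' * I * hq2
  · linear_combination z ^ (k + 2) * q ^ k * N' * I * hq1
  · linear_combination z ^ (k + 2) * q ^ (k + 2) * N' * I * hq2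

/-- Taking the coefficient of order `n + 1` in the renewal equation kills the constant `Ψ₀` and, the
step being linear, leaves the step applied to the coefficients of order `n`. -/
theorem coreStep_iterate_eq_coef (hr : 0 < r) (hs : 0 < s) (h : r ^ 2 + s ^ 2 = 1)
    (hp : |b₀.re| < 1) (h₀ : ‖a₀‖ ^ 2 + ‖b₀‖ ^ 2 = 1) {ρ : ℝ} (hρ0 : 0 < ρ) (hρ1 : ρ < 1) (n : ℕ) :
    (coreStep r s a₀ b₀)^[n] (originState α β) =
      fun x j => coef ρ n (genFun r s a₀ b₀ α β x j) := by
  have hd := differentiableOn_genFun (a₀ := a₀) α β hr hs h hp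
  induction n with
  | zero =>
    funext x j
    rw [coef_zero hρ0 hρ1 (hd x j), genFun_at_zero]; rfl
  | succ n ih =>
    rw [Function.iterate_succ_apply', ih]
    funext x j
    have hd2 : DifferentiableOn ℂ
        (fun z => coreStep r s a₀ b₀ (fun x j => genFun r s a₀ b₀ α β x j z) x j)
        (Metric.ball 0 1) := by
      fin_cases j
      · exact ((hd _ 0).const_mul _).add ((hd _ 1).const_mul _)
      · exact ((hd _ 0).const_mul _).add ((hd _ 1).const_mul _)
    rw [coef_congr hρ0 hρ1 fun z hz => genFun_step α β hr hs h hp h₀ x j hz,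
      coef_add hρ0 hρ1 (by fun_prop) (by fun_prop), coef_const hρ0, zero_add, coef_add_mul hρ0 1]
    fin_cases j
    · simp only [coreStep, Fin.zero_eta, Matrix.cons_val_zero]
      rw [coef_add hρ0 hρ1 ((hd _ _).const_mul _) ((hd _ _).const_mul _), coef_const_mul,
        coef_const_mul]
    · simp only [coreStep, Fin.mk_one, Matrix.cons_val_one, Matrix.cons_val_fin_one]
      rw [coef_add hρ0 hρ1 ((hd _ _).const_mul _) ((hd _ _).const_mul _), coef_const_mul,
        coef_const_mul]

end

/-! ### Boundary integrals and the integrable weight at the band edges. -/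

/-- Jordan's inequality compares with a power of `u` on a quarter period; reflection and periodicity
do the rest. -/
theorem intervalIntegrable_abs_sin_rpow {a : ℝ} (ha : -1 < a) (ha0 : a ≤ 0) (x y : ℝ) :
    IntervalIntegrable (fun u => |Real.sin u| ^ a) volume x y := by
  have hpi := Real.pi_pos
  have h1 : IntervalIntegrable (fun u => |Real.sin u| ^ a) volume 0 (Real.pi / 2) := by
    have h2 : IntervalIntegrable (fun u : ℝ => (2 / Real.pi) ^ a * u ^ a) volume 0 (Real.pi / 2) :=
      (intervalIntegral.intervalIntegrable_rpow' ha).const_mul _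
    refine h2.mono_fun' ?_ ?_
    · exact ((Real.continuous_sin.measurable.abs).pow_const a).aestronglyMeasurable
    · rw [Filter.EventuallyLE, ae_restrict_iff' measurableSet_uIoc]
      refine Eventually.of_forall fun u hu => ?_
      rw [Set.uIoc_of_le (by positivity)] at hu
      rw [Real.norm_of_nonneg (by positivity), ← Real.mul_rpow (by positivity) hu.1.le]
      apply Real.rpow_le_rpow_of_nonpos (mul_pos (by positivity) hu.1) _ ha0
      exact (Real.mul_le_sin hu.1.le hu.2).trans (le_abs_self _)
  have h2 : IntervalIntegrable (fun u => |Real.sin u| ^ a) volume (Real.pi / 2) Real.pi := by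
    have := (h1.comp_sub_left Real.pi).symm
    simpa [Real.sin_pi_sub, sub_half] using this
  refine Function.Periodic.intervalIntegrable (T := Real.pi) (t := 0) ?_ hpi.ne' ?_ x y
  · intro u; simp [Real.sin_add_pi]
  · rw [zero_add]; exact h1.trans h2

/-- The integrable weight that dominates the generating functions on the unit circle. -/
def gapWeight (s θ : ℝ) : ℝ := |s ^ 2 - Real.sin θ ^ 2| ^ (-(7 / 8) : ℝ)

section
variable {r s : ℝ}

theorem sin_mul_sin_arcsin (hs0 : 0 < s) (hs1 : s ≤ 1) (θ : ℝ) :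
    Real.sin (Real.arcsin s - θ) * Real.sin (Real.arcsin s + θ) = s ^ 2 - Real.sin θ ^ 2 := by
  rw [Real.sin_sub, Real.sin_add]
  have h1 := Real.sin_arcsin (by linarith) hs1
  have h2 := Real.sin_sq_add_cos_sq (Real.arcsin s)
  have h3 := Real.sin_sq_add_cos_sq θ
  rw [h1] at h2 ⊢
  linear_combination s ^ 2 * h3 - Real.sin θ ^ 2 * h2

/-- The factorization `sin_mul_sin_arcsin` separates the two singularities. They never coincide, so
the product of the two singular powers is bounded by a multiple of their sum. -/
theorem intervalIntegrable_gapWeight (hr : 0 < r) (hs : 0 < s) (h : r ^ 2 + s ^ 2 = 1) (x y : ℝ) :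
    IntervalIntegrable (gapWeight s) volume x y := by
  have hs1 : s ≤ 1 := by nlinarith
  have hi := intervalIntegrable_abs_sin_rpow (a := -(7 / 8)) (by norm_num) (by norm_num)
  have hA : IntervalIntegrable (fun θ => |Real.sin (Real.arcsin s - θ)| ^ (-(7 / 8) : ℝ)) volume x y := by
    have := (hi (Real.arcsin s - x) (Real.arcsin s - y)).comp_sub_left (Real.arcsin s)
    simpa using this
  have hB : IntervalIntegrable (fun θ => |Real.sin (Real.arcsin s + θ)| ^ (-(7 / 8) : ℝ)) volume x y := by
    have := (hi (Real.arcsin s + x) (Real.arcsin s + y)).comp_add_left (Real.arcsin s)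
    simpa using this
  refine ((hA.add hB).const_mul ((r * s) ^ (-(7 / 8) : ℝ))).mono_fun' ?_ ?_
  · have : Measurable (gapWeight s) := by unfold gapWeight; fun_prop
    exact this.aestronglyMeasurable
  · refine Eventually.of_forall fun θ => ?_
    unfold gapWeight
    simp only
    rw [Real.norm_of_nonneg (by positivity), ← sin_mul_sin_arcsin hs hs1, abs_mul,
      Real.mul_rpow (abs_nonneg _) (abs_nonneg _)]
    set A := Real.sin (Real.arcsin s - θ) with hAd
    set B := Real.sin (Real.arcsin s + θ) with hBd
    -- The two angles add up to `2 arcsin s`, whose sine is `2 s r`; hence one of `|A|`, `|B|` is at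
    -- least `r s`.
    have h2 : 2 * (r * s) ≤ |A| + |B| := by
      have e : 2 * (s * r) = A * Real.cos (Real.arcsin s + θ) + Real.cos (Real.arcsin s - θ) * B := by
        rw [hAd, hBd, ← Real.sin_add]
        rw [show Real.arcsin s - θ + (Real.arcsin s + θ) = 2 * Real.arcsin s by ring,
          Real.sin_two_mul, Real.sin_arcsin (by linarith) hs1, Real.cos_arcsin]
        rw [show 1 - s ^ 2 = r ^ 2 by linarith, Real.sqrt_sq hr.le]; ring
      have e1 : A * Real.cos (Real.arcsin s + θ) ≤ |A| := by
        refine (le_abs_self _).trans ?_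
        rw [abs_mul]; exact mul_le_of_le_one_right (abs_nonneg _) (Real.abs_cos_le_one _)
      have e2 : Real.cos (Real.arcsin s - θ) * B ≤ |B| := by
        refine (le_abs_self _).trans ?_
        rw [abs_mul]; exact mul_le_of_le_one_left (abs_nonneg _) (Real.abs_cos_le_one _)
      linarith
    have hrs : 0 < r * s := mul_pos hr hs
    have key : ∀ x y : ℝ, 0 ≤ x → 0 ≤ y → r * s ≤ x →
        x ^ (-(7 / 8) : ℝ) * y ^ (-(7 / 8) : ℝ) ≤
          (r * s) ^ (-(7 / 8) : ℝ) * (x ^ (-(7 / 8) : ℝ) + y ^ (-(7 / 8) : ℝ)) := by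
      intro x y hx hy hxy
      have h3 := Real.rpow_le_rpow_of_nonpos hrs hxy (by norm_num : (-(7 / 8) : ℝ) ≤ 0)
      have h4 : 0 ≤ x ^ (-(7 / 8) : ℝ) := by positivity
      have h5 : 0 ≤ y ^ (-(7 / 8) : ℝ) := by positivity
      have h6 : 0 ≤ (r * s) ^ (-(7 / 8) : ℝ) := by positivity
      nlinarith [mul_nonneg h6 h4, mul_le_mul_of_nonneg_right h3 h5]
    rcases le_total (r * s) |A| with h3 | h3
    · exact key _ _ (abs_nonneg _) (abs_nonneg _) h3
    · have := key |B| |A| (abs_nonneg _) (abs_nonneg _) (by linarith)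
      rwa [mul_comm, add_comm]

theorem ae_sin_sq_ne (hs0 : 0 < s) (hs1 : s ≤ 1) :
    ∀ᵐ θ : ℝ, s ^ 2 - Real.sin θ ^ 2 ≠ 0 := by
  have hc : (Set.range (fun k : ℤ => Real.arcsin s - k * Real.pi) ∪
      Set.range (fun k : ℤ => k * Real.pi - Real.arcsin s)).Countable :=
    (Set.countable_range _).union (Set.countable_range _)
  have := hc.ae_notMem volume
  filter_upwards [this] with θ hθ h0
  apply hθ
  rw [← sin_mul_sin_arcsin hs0 hs1] at h0
  rcases mul_eq_zero.1 h0 with h1 | h1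
  · obtain ⟨k, hk⟩ := Real.sin_eq_zero_iff.1 h1
    exact Or.inl ⟨k, by simp only [hk]; ring⟩
  · obtain ⟨k, hk⟩ := Real.sin_eq_zero_iff.1 h1
    exact Or.inr ⟨k, by simp only [hk]; ring⟩

theorem norm_discRoot_sq_eq_mul (w : ℂ) : ‖discRoot r s w‖ ^ 2 =
    ‖1 - (r + s * Complex.I) ^ 2 * w‖ * ‖1 - (r - s * Complex.I) ^ 2 * w‖ := by
  rw [← norm_pow, discRoot, mul_pow, cpow_half_sq, cpow_half_sq, norm_mul]

theorem norm_one_sub_le {u : ℂ} (hu : ‖u‖ = 1) {t : ℝ} (h0 : 0 ≤ t) (h1 : t ≤ 1) :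
    ‖1 - u‖ ≤ 2 * ‖1 - t * u‖ := by
  have e1 : ‖1 - u‖ ≤ ‖1 - t * u‖ + (1 - t) := by
    have : 1 - u = (1 - t * u) - ((1 - t : ℝ) : ℂ) * u := by push_cast; ring
    rw [this]
    refine (norm_sub_le _ _).trans ?_
    rw [norm_mul, hu, Complex.norm_real, Real.norm_of_nonneg (by linarith), mul_one]
  have e2 : 1 - t ≤ ‖1 - t * u‖ := by
    have := norm_sub_norm_le (1 : ℂ) (t * u)
    rw [norm_mul, hu, Complex.norm_real, Real.norm_of_nonneg h0, mul_one, norm_one] at this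
    exact this
  linarith

/-- Allows functions on circles of radius below one to be dominated by a weight on the unit circle,
independently of the radius. -/
theorem norm_discRoot_radial (h : r ^ 2 + s ^ 2 = 1) {w : ℂ} (hw : ‖w‖ = 1) {t : ℝ} (h0 : 0 ≤ t)
    (h1 : t ≤ 1) : ‖discRoot r s w‖ ≤ 2 * ‖discRoot r s (t * w)‖ := by
  refine (pow_le_pow_iff_left₀ (norm_nonneg _) (by positivity) two_ne_zero).1 ?_
  rw [mul_pow, norm_discRoot_sq_eq_mul, norm_discRoot_sq_eq_mul]
  have e1 := norm_one_sub_le (u := (r + s * Complex.I) ^ 2 * w)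
    (by rw [norm_mul, rotor_norm h, hw, one_mul]) h0 h1
  have e2 := norm_one_sub_le (u := (r - s * Complex.I) ^ 2 * w)
    (by rw [norm_mul, rotor_norm' h, hw, one_mul]) h0 h1
  calc _ ≤ _ := mul_le_mul e1 e2 (norm_nonneg _) (by positivity)
    _ = _ := by
      rw [mul_left_comm (t : ℂ), mul_left_comm (t : ℂ)]; ring

theorem circleMap_one_im (θ : ℝ) : (circleMap 0 1 θ).im = Real.sin θ := by
  simp [circleMap, Complex.exp_ofReal_mul_I_im]

theorem circleMap_one_re (θ : ℝ) : (circleMap 0 1 θ).re = Real.cos θ := by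
  simp [circleMap, Complex.exp_ofReal_mul_I_re]

theorem norm_circleMap_one (θ : ℝ) : ‖circleMap 0 1 θ‖ = 1 := by simp

theorem circleMap_eq_mul (ρ θ : ℝ) : circleMap 0 ρ θ = ρ * circleMap 0 1 θ := by
  simp [circleMap]

/-- The true singularity has exponent `-1/2`; it is absorbed into the exponent `-7/8` because `|s² -
sin² θ| ≤ 1`. -/
theorem inv_norm_discRoot_le (h : r ^ 2 + s ^ 2 = 1) {θ : ℝ}
    (hθ : s ^ 2 - Real.sin θ ^ 2 ≠ 0) :
    ‖discRoot r s (circleMap 0 1 θ ^ 2)‖⁻¹ ≤ gapWeight s θ := by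
  have h1 := norm_discRoot_sq h (norm_circleMap_one θ)
  rw [circleMap_one_im] at h1
  have hδ : 0 < |s ^ 2 - Real.sin θ ^ 2| := abs_pos.2 hθ
  have hδ1 : |s ^ 2 - Real.sin θ ^ 2| ≤ 1 := by
    rw [abs_le]; constructor <;> nlinarith [sq_nonneg r, sq_nonneg (Real.sin θ), Real.sin_sq_le_one θ, sq_nonneg s]
  have h2 : ‖discRoot r s (circleMap 0 1 θ ^ 2)‖ = 2 * √|s ^ 2 - Real.sin θ ^ 2| := by
    rw [← Real.sqrt_sq (norm_nonneg _), h1, Real.sqrt_mul (by norm_num)]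
    congr 1
    rw [show (4 : ℝ) = 2 ^ 2 by norm_num, Real.sqrt_sq (by norm_num)]
  rw [h2, gapWeight, Real.sqrt_eq_rpow, mul_inv, ← Real.rpow_neg hδ.le]
  have h3 : |s ^ 2 - Real.sin θ ^ 2| ^ (-(1 / 2) : ℝ) ≤ |s ^ 2 - Real.sin θ ^ 2| ^ (-(7 / 8) : ℝ) :=
    Real.rpow_le_rpow_of_exponent_ge hδ hδ1 (by norm_num)
  have h4 : 0 ≤ |s ^ 2 - Real.sin θ ^ 2| ^ (-(1 / 2) : ℝ) := by positivity
  linarith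

theorem discRoot_ne_zero (h : r ^ 2 + s ^ 2 = 1) {θ : ℝ}
    (hθ : s ^ 2 - Real.sin θ ^ 2 ≠ 0) : discRoot r s (circleMap 0 1 θ ^ 2) ≠ 0 := by
  intro h0
  have h1 := norm_discRoot_sq h (norm_circleMap_one θ)
  rw [circleMap_one_im, h0] at h1
  simp at h1
  exact hθ h1

/-- Taylor coefficients as integrals over the unit circle. -/
theorem coef_eq_boundary_integral (hr : 0 < r) (hs : 0 < s) (h : r ^ 2 + s ^ 2 = 1) {H : ℂ → ℂ} {K : ℝ} {c : ℂ} {n : ℕ}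
    (hd : DifferentiableOn ℂ H (Metric.ball 0 1))
    (hc : ∀ z, ‖z‖ = 1 → discRoot r s (z ^ 2) ≠ 0 → ContinuousAt H z)
    (hb : ∀ z, ‖z‖ < 1 → ‖H z‖ * ‖discRoot r s (z ^ 2)‖ ≤ K)
    (hcoef : ∀ ρ, 0 < ρ → ρ < 1 → coef ρ n H = c) :
    IntervalIntegrable (fun θ => H (circleMap 0 1 θ)) volume (-Real.pi) Real.pi ∧
    (2 * Real.pi : ℂ)⁻¹ * ∫ θ in -Real.pi..Real.pi, (circleMap 0 1 θ ^ n)⁻¹ * H (circleMap 0 1 θ)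
      = c := by
  have hs1 : s ≤ 1 := by nlinarith
  -- Radii increasing to one that start at `1/2`, so that `|z⁻ⁿ| ≤ 2ⁿ` throughout; this is the
  -- factor in the dominating function for fixed `n`.
  set ρ : ℕ → ℝ := fun k => 1 - 1 / (k + 2) with hρ
  have hρ0 : ∀ k, 1 / 2 ≤ ρ k := fun k => by
    have : (1 : ℝ) / (k + 2) ≤ 1 / 2 := by
      apply one_div_le_one_div_of_le (by norm_num); linarith [(Nat.cast_nonneg k : (0 : ℝ) ≤ k)]
    simp only [hρ]; linarith
  have hρ1 : ∀ k, ρ k < 1 := fun k => by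
    have : (0 : ℝ) < 1 / (k + 2) := by positivity
    simp only [hρ]; linarith
  have hρt : Tendsto ρ atTop (𝓝[<] 1) := by
    apply tendsto_nhdsWithin_of_tendsto_nhds_of_eventually_within
    · have : Tendsto (fun k : ℕ => 1 - 1 / ((k + 1 : ℕ) + 1 : ℝ)) atTop (𝓝 (1 - 0)) :=
        ((tendsto_one_div_add_atTop_nhds_zero_nat (𝕜 := ℝ)).comp (tendsto_add_atTop_nat 1)).const_sub 1
      rw [sub_zero] at this
      convert this using 2 with k
      simp only [hρ]; push_cast; ring
    · exact Eventually.of_forall hρ1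
  have hin : ∀ k θ, ‖(ρ k : ℂ) * circleMap 0 1 θ‖ = ρ k := fun k θ => by
    rw [norm_mul, norm_circleMap_one, mul_one, Complex.norm_real, Real.norm_of_nonneg (by linarith [hρ0 k])]
  have hcont : ∀ k, Continuous fun θ => H (ρ k * circleMap 0 1 θ) := fun k => by
    apply hd.continuousOn.comp_continuous (by fun_prop)
    intro θ
    simp only [Metric.mem_ball, dist_zero_right, hin, hρ1]
  have hlim : ∀ᵐ θ : ℝ, Tendsto (fun k => H (ρ k * circleMap 0 1 θ)) atTop (𝓝 (H (circleMap 0 1 θ))) := by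
    filter_upwards [ae_sin_sq_ne hs hs1] with θ hθ
    exact (tendsto_radial (hc _ (norm_circleMap_one θ) (discRoot_ne_zero h hθ))).comp hρt
  have hK : 0 ≤ K := (mul_nonneg (norm_nonneg _) (norm_nonneg _)).trans (hb 0 (by simp))
  have hbd : ∀ k, ∀ᵐ θ : ℝ, ‖H (ρ k * circleMap 0 1 θ)‖ ≤ 2 * K * gapWeight s θ := fun k => by
    filter_upwards [ae_sin_sq_ne hs hs1] with θ hθ
    have h1 := hb (ρ k * circleMap 0 1 θ) (by rw [hin]; exact hρ1 k)
    have h2 := norm_discRoot_radial h (w := circleMap 0 1 θ ^ 2) (by simp) (t := ρ k ^ 2) (by positivity)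
      (by nlinarith [hρ0 k, hρ1 k])
    have h3 := inv_norm_discRoot_le h hθ
    rw [mul_pow] at h1
    push_cast at h2
    have h4 : 0 < ‖discRoot r s (circleMap 0 1 θ ^ 2)‖ := norm_pos_iff.2 (discRoot_ne_zero h hθ)
    have h5 : ‖H (ρ k * circleMap 0 1 θ)‖ ≤ 2 * K * ‖discRoot r s (circleMap 0 1 θ ^ 2)‖⁻¹ := by
      rw [← div_eq_mul_inv, le_div_iff₀ h4]
      nlinarith [norm_nonneg (H (ρ k * circleMap 0 1 θ))]
    exact h5.trans (mul_le_mul_of_nonneg_left h3 (by positivity))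
  have hgw := intervalIntegrable_gapWeight hr hs h (-Real.pi) Real.pi
  constructor
  · refine (hgw.const_mul (2 * K)).mono_fun' ?_ ?_
    · exact aestronglyMeasurable_of_tendsto_ae atTop (fun k => (hcont k).aestronglyMeasurable)
        (ae_restrict_of_ae hlim)
    · apply ae_restrict_of_ae
      filter_upwards [hlim, ae_all_iff.2 hbd] with θ h1 h2
      exact le_of_tendsto' h1.norm h2
  · have hT : Tendsto (fun k => ∫ θ in -Real.pi..Real.pi,
        ((ρ k * circleMap 0 1 θ) ^ n)⁻¹ * H (ρ k * circleMap 0 1 θ)) atTop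
        (𝓝 (∫ θ in -Real.pi..Real.pi, (circleMap 0 1 θ ^ n)⁻¹ * H (circleMap 0 1 θ))) := by
      apply intervalIntegral.tendsto_integral_filter_of_dominated_convergence
        (fun θ => 2 ^ n * (2 * K * gapWeight s θ))
      · refine Eventually.of_forall fun k => Continuous.aestronglyMeasurable ?_
        refine Continuous.mul (Continuous.inv₀ (by fun_prop) fun θ => ?_) (hcont k)
        apply pow_ne_zero
        rw [← norm_pos_iff, hin]; linarith [hρ0 k]
      · refine Eventually.of_forall fun k => ?_
        filter_upwards [hbd k] with θ h1 _
        rw [norm_mul, norm_inv, norm_pow, hin]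
        apply mul_le_mul _ h1 (norm_nonneg _) (by positivity)
        rw [← inv_pow]
        apply pow_le_pow_left₀ (by have := hρ0 k; positivity)
        rw [inv_le_comm₀ (by linarith [hρ0 k]) (by norm_num)]
        linarith [hρ0 k]
      · exact (hgw.const_mul _).const_mul _
      · filter_upwards [hlim] with θ h1 _
        refine Tendsto.mul ?_ h1
        have : ContinuousAt (fun z : ℂ => (z ^ n)⁻¹) (circleMap 0 1 θ) :=
          ContinuousAt.inv₀ (by fun_prop) (pow_ne_zero _ (by rw [← norm_pos_iff]; simp))
        exact (tendsto_radial this).comp hρt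
    have hconst : ∀ k, (2 * Real.pi : ℂ)⁻¹ * ∫ θ in -Real.pi..Real.pi,
        ((ρ k * circleMap 0 1 θ) ^ n)⁻¹ * H (ρ k * circleMap 0 1 θ) = c := fun k => by
      rw [← hcoef (ρ k) (by linarith [hρ0 k]) (hρ1 k), coef, Real.circleAverage]
      have hper : Function.Periodic (fun θ => (circleMap 0 (ρ k) θ ^ n)⁻¹ • H (circleMap 0 (ρ k) θ))
          (2 * Real.pi) := fun θ => by simp only [periodic_circleMap 0 (ρ k) θ]
      have := hper.intervalIntegral_add_eq 0 (-Real.pi)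
      rw [zero_add, show -Real.pi + 2 * Real.pi = Real.pi by ring] at this
      rw [this, Complex.real_smul]
      push_cast
      congr 1
      apply intervalIntegral.integral_congr
      intro θ _
      simp only [circleMap_eq_mul (ρ k) θ, smul_eq_mul]
    have h1 := hT.const_mul (2 * Real.pi : ℂ)⁻¹
    simp only [hconst] at h1
    exact tendsto_nhds_unique h1 tendsto_const_nhds

end

/-! ### Null sequences, characters and Cesàro means. -/

/-- The Riemann–Lebesgue lemma on the unit circle. -/
theorem tendsto_circle_integral_zero (f : ℝ → ℂ) :
    Tendsto (fun n : ℕ => ∫ θ in -Real.pi..Real.pi, (circleMap 0 1 θ ^ n)⁻¹ * f θ) atTop (𝓝 0) := by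
  have hpi := Real.pi_pos
  have h1 := Real.tendsto_integral_exp_smul_cocompact
    (Set.indicator (Set.Ioc (-Real.pi) Real.pi) f)
  -- The Fourier character carries a factor `2 π`, so the `n`-th coefficient on the circle is the
  -- transform at `n / (2 π)`.
  have h2 : Tendsto (fun n : ℕ => (n : ℝ) / (2 * Real.pi)) atTop (cocompact ℝ) := by
    rw [cocompact_eq_atBot_atTop]
    exact Tendsto.mono_right
      (tendsto_natCast_atTop_atTop.atTop_div_const (by positivity)) le_sup_right
  refine (h1.comp h2).congr fun n => ?_
  simp only [Function.comp]
  rw [intervalIntegral.integral_of_le (by linarith), ← integral_indicator measurableSet_Ioc]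
  congr 1
  funext θ
  by_cases hθ : θ ∈ Set.Ioc (-Real.pi) Real.pi
  · rw [Set.indicator_of_mem hθ, Set.indicator_of_mem hθ, Circle.smul_def, smul_eq_mul]
    congr 1
    rw [Real.fourierChar_apply, circleMap]
    simp only [Complex.ofReal_one, one_mul, zero_add]
    rw [← Complex.exp_nat_mul, ← Complex.exp_neg]
    congr 1
    push_cast
    field_simp
  · rw [Set.indicator_of_notMem hθ, Set.indicator_of_notMem hθ, smul_zero]

/-- A sequence that is a finite sum of characters up to a null sequence. -/
def AlmostQuasiPeriodic (c : ℕ → ℂ) : Prop :=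
  ∃ (ι : Type) (_ : Fintype ι) (A ζ : ι → ℂ), (∀ j, ‖ζ j‖ = 1) ∧
    Tendsto (fun n => c n - ∑ j, A j * ζ j ^ n) atTop (𝓝 0)

theorem AlmostQuasiPeriodic.of_tendsto_zero {c : ℕ → ℂ} (h : Tendsto c atTop (𝓝 0)) :
    AlmostQuasiPeriodic c :=
  ⟨Empty, inferInstance, fun _ => 0, fun _ => 1, by simp, by simpa using h⟩

theorem AlmostQuasiPeriodic.add {c d : ℕ → ℂ} (hc : AlmostQuasiPeriodic c)
    (hd : AlmostQuasiPeriodic d) : AlmostQuasiPeriodic (fun n => c n + d n) := by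
  obtain ⟨ι, _, A, ζ, h1, h2⟩ := hc
  obtain ⟨κ, _, A', ζ', h1', h2'⟩ := hd
  refine ⟨ι ⊕ κ, inferInstance, Sum.elim A A', Sum.elim ζ ζ', ?_, ?_⟩
  · rintro (j | j)
    · exact h1 j
    · exact h1' j
  · have := h2.add h2'
    rw [add_zero] at this
    refine this.congr fun n => ?_
    simp only [Fintype.sum_sum_type, Sum.elim_inl, Sum.elim_inr]
    ring

theorem AlmostQuasiPeriodic.const_mul {c : ℕ → ℂ} (hc : AlmostQuasiPeriodic c) (a : ℂ) :
    AlmostQuasiPeriodic (fun n => a * c n) := by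
  obtain ⟨ι, _, A, ζ, h1, h2⟩ := hc
  refine ⟨ι, inferInstance, fun j => a * A j, ζ, h1, ?_⟩
  have := h2.const_mul a
  rw [mul_zero] at this
  refine this.congr fun n => ?_
  rw [mul_sub, Finset.mul_sum]
  simp only [mul_assoc]

theorem AlmostQuasiPeriodic.character (a : ℂ) {ζ : ℂ} (hζ : ‖ζ‖ = 1) :
    AlmostQuasiPeriodic (fun n => a * ζ ^ n) :=
  ⟨Unit, inferInstance, fun _ => a, fun _ => ζ, fun _ => hζ, by simp⟩

theorem AlmostQuasiPeriodic.congr' {c d : ℕ → ℂ} (hc : AlmostQuasiPeriodic c)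
    (h : ∀ᶠ n in atTop, c n = d n) : AlmostQuasiPeriodic d := by
  obtain ⟨ι, i, A, ζ, h1, h2⟩ := hc
  exact ⟨ι, i, A, ζ, h1, h2.congr' (h.mono fun n hn => by rw [hn])⟩

/-- The Cesàro means of a bounded geometric sequence converge. -/
theorem exists_tendsto_cesaro_character {u : ℂ} (hu : ‖u‖ = 1) :
    ∃ L : ℂ, Tendsto (fun T : ℕ => (T : ℂ)⁻¹ * ∑ n ∈ Finset.range T, u ^ n) atTop (𝓝 L) := by
  by_cases h : u = 1
  · refine ⟨1, tendsto_const_nhds.congr' ?_⟩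
    filter_upwards [eventually_gt_atTop 0] with T hT
    have : (T : ℂ) ≠ 0 := by exact_mod_cast hT.ne'
    simp [h, this]
  · refine ⟨0, ?_⟩
    rw [tendsto_zero_iff_norm_tendsto_zero]
    have h1 : Tendsto (fun T : ℕ => (2 / ‖u - 1‖) * (T : ℝ)⁻¹) atTop (𝓝 0) := by
      have := (tendsto_inv_atTop_nhds_zero_nat (𝕜 := ℝ)).const_mul (2 / ‖u - 1‖)
      rwa [mul_zero] at this
    refine squeeze_zero (fun _ => norm_nonneg _) (fun T => ?_) h1
    rw [geom_sum_eq h, norm_mul, norm_inv, norm_div, mul_comm, Complex.norm_natCast]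
    gcongr
    refine (norm_sub_le _ _).trans ?_
    rw [norm_pow, hu, one_pow, norm_one]; norm_num

/-- The square modulus of a finite sum of characters is a finite sum of the characters `ζ_j ζ̄_k`,
each with convergent Cesàro means. The sum being bounded, a null perturbation of it changes the
square modulus by a null sequence. -/
theorem AlmostQuasiPeriodic.exists_tendsto_cesaro {c : ℕ → ℂ} (hc : AlmostQuasiPeriodic c) :
    ∃ L : ℝ, Tendsto (fun T : ℕ => (T : ℝ)⁻¹ * ∑ n ∈ Finset.range T, ‖c n‖ ^ 2) atTop (𝓝 L) := by
  obtain ⟨ι, _, A, ζ, h1, h2⟩ := hc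
  set P : ℕ → ℂ := fun n => ∑ j, A j * ζ j ^ n with hP
  have hPb : ∀ n, ‖P n‖ ≤ ∑ j, ‖A j‖ := fun n => by
    refine (norm_sum_le _ _).trans (Finset.sum_le_sum fun j _ => ?_)
    rw [norm_mul, norm_pow, h1, one_pow, mul_one]
  have h3 : Tendsto (fun n => ‖c n‖ ^ 2 - ‖P n‖ ^ 2) atTop (𝓝 0) := by
    rw [tendsto_zero_iff_norm_tendsto_zero] at h2
    have h4 : Tendsto (fun n => ‖c n - P n‖ * (‖c n - P n‖ + 2 * ∑ j, ‖A j‖)) atTop (𝓝 0) := by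
      have := h2.mul (h2.add_const (2 * ∑ j, ‖A j‖))
      rwa [zero_mul] at this
    refine squeeze_zero_norm (fun n => ?_) h4
    have e1 : |‖c n‖ - ‖P n‖| ≤ ‖c n - P n‖ := abs_norm_sub_norm_le _ _
    rw [Real.norm_eq_abs, sq_sub_sq, mul_comm, abs_mul]
    refine mul_le_mul e1 ?_ (abs_nonneg _) (norm_nonneg _)
    rw [abs_of_nonneg (by positivity)]
    have := norm_sub_norm_le (c n) (P n)
    linarith [hPb n]
  have h5 : ∃ L : ℂ, Tendsto (fun T : ℕ => (T : ℂ)⁻¹ * ∑ n ∈ Finset.range T, ((‖P n‖ ^ 2 : ℝ) : ℂ))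
      atTop (𝓝 L) := by
    have h6 : ∀ j k, ‖ζ j * (starRingEnd ℂ) (ζ k)‖ = 1 := fun j k => by
      rw [norm_mul, RCLike.norm_conj, h1, h1, one_mul]
    choose L hL using fun j k => exists_tendsto_cesaro_character (h6 j k)
    refine ⟨∑ j, ∑ k, A j * (starRingEnd ℂ) (A k) * L j k, ?_⟩
    have h7 : Tendsto (fun T : ℕ => ∑ j, ∑ k, A j * (starRingEnd ℂ) (A k) *
        ((T : ℂ)⁻¹ * ∑ n ∈ Finset.range T, (ζ j * (starRingEnd ℂ) (ζ k)) ^ n)) atTop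
        (𝓝 (∑ j, ∑ k, A j * (starRingEnd ℂ) (A k) * L j k)) :=
      tendsto_finsetSum _ fun j _ => tendsto_finsetSum _ fun k _ => (hL j k).const_mul _
    refine h7.congr fun T => ?_
    have e : ∀ n, ((‖P n‖ ^ 2 : ℝ) : ℂ) =
        ∑ j, ∑ k, A j * (starRingEnd ℂ) (A k) * (ζ j * (starRingEnd ℂ) (ζ k)) ^ n := fun n => by
      rw [← Complex.normSq_eq_norm_sq, ← Complex.mul_conj, hP]
      simp only [map_sum, Finset.sum_mul_sum, map_mul, map_pow]
      refine Finset.sum_congr rfl fun j _ => Finset.sum_congr rfl fun k _ => ?_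
      rw [mul_pow]; ring
    simp only [e]
    symm
    rw [Finset.sum_comm, Finset.mul_sum]
    refine Finset.sum_congr rfl fun j _ => ?_
    rw [Finset.sum_comm, Finset.mul_sum]
    refine Finset.sum_congr rfl fun k _ => ?_
    rw [← Finset.mul_sum]; ring
  obtain ⟨L, hL⟩ := h5
  refine ⟨L.re, ?_⟩
  have h8 := ((Complex.continuous_re.tendsto _).comp hL).add h3.cesaro
  rw [add_zero] at h8
  refine h8.congr fun T => ?_
  simp only [Function.comp]
  have : (T : ℂ)⁻¹ * ∑ n ∈ Finset.range T, ((‖P n‖ ^ 2 : ℝ) : ℂ) =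
      (((T : ℝ)⁻¹ * ∑ n ∈ Finset.range T, ‖P n‖ ^ 2 : ℝ) : ℂ) := by push_cast; rfl
  rw [this, Complex.ofReal_re, ← mul_add, ← Finset.sum_add_distrib]
  simp

/-! ### Decay of the modes near a band edge. -/

/-- Lets the single estimate `(1 + X)⁻²` be spent with two exponents, `7/4` when a factor `i + 1`
has to be absorbed and `3/4` when a factor `σ⁻¹` has. -/
theorem inv_one_add_sq_le {X a : ℝ} (hX : 0 < X) (ha0 : 0 ≤ a) (ha2 : a ≤ 2) :
    ((1 + X) ^ 2)⁻¹ ≤ X ^ (-a) := by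
  rw [Real.rpow_neg hX.le]
  apply inv_anti₀ (by positivity)
  calc X ^ a ≤ (1 + X) ^ a := Real.rpow_le_rpow hX.le (by linarith) ha0
    _ ≤ (1 + X) ^ (2 : ℝ) := Real.rpow_le_rpow_of_exponent_le (by linarith) ha2
    _ = _ := by norm_cast

/-- Decay of powers of the mode `t` in terms of the distance `σ` from the band edge. -/
theorem exists_pow_decay {κ : ℝ} (hκ : 0 < κ) : ∃ K : ℝ, 0 ≤ K ∧ ∀ (σ t : ℝ) (i : ℕ), 0 < σ → σ ≤ 2 → 0 ≤ t →
    t ^ 2 * (1 + κ * σ) ≤ 1 →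
    (i + 1) * t ^ i ≤ K * (((i : ℝ) + 1) ^ (-(3 / 4) : ℝ) * σ ^ (-(7 / 4) : ℝ)) ∧
    σ⁻¹ * t ^ i ≤ K * (((i : ℝ) + 1) ^ (-(3 / 4) : ℝ) * σ ^ (-(7 / 4) : ℝ)) := by
  -- The bound `k ≤ 1/2` ensures `k σ ≤ 1`, and then `(1 + k σ)⁴ ≤ 1 + 15 k σ ≤ 1 + κ σ`, where `15
  -- = 4 + 6 + 4 + 1`.
  obtain ⟨k, hk0, hk1, hk2⟩ : ∃ k : ℝ, 0 < k ∧ 15 * k ≤ κ ∧ k ≤ 1 / 2 :=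
    ⟨min (κ / 15) (1 / 2), by positivity, by linarith [min_le_left (κ / 15) (1 / 2)], min_le_right _ _⟩
  refine ⟨4 * k ^ (-(7 / 4) : ℝ) + 4 * k ^ (-(3 / 4) : ℝ), by positivity, fun σ t i hσ hσ2 ht ht2 => ?_⟩
  have hkσ : k * σ ≤ 1 := by nlinarith
  have hkσ0 : 0 < k * σ := by positivity
  have h1 : (1 + k * σ) ^ 4 ≤ 1 + κ * σ := by
    have e : (1 + k * σ) ^ 4 ≤ 1 + 15 * (k * σ) := by
      have a2 : (k * σ) ^ 2 ≤ k * σ := by nlinarith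
      have a3 : (k * σ) ^ 3 ≤ k * σ := by nlinarith
      have a4 : (k * σ) ^ 4 ≤ k * σ := by nlinarith
      nlinarith
    nlinarith
  have h2 : t * (1 + k * σ) ^ 2 ≤ 1 := by
    have : (t * (1 + k * σ) ^ 2) ^ 2 ≤ 1 := by
      calc _ = t ^ 2 * (1 + k * σ) ^ 4 := by ring
        _ ≤ t ^ 2 * (1 + κ * σ) := by gcongr
        _ ≤ 1 := ht2
    exact (sq_le_one_iff₀ (by positivity)).1 this
  set X : ℝ := (i + 1) * (k * σ) with hX
  have hX0 : 0 < X := by positivity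
  -- From `t (1 + k σ)² ≤ 1` and Bernoulli's inequality; the factor `4` pays for `i + 1` in place of
  -- `i` in `X`.
  have h3 : t ^ i ≤ 4 * ((1 + X) ^ 2)⁻¹ := by
    have e1 : 1 + X ≤ 2 * (1 + k * σ) ^ i := by
      have := one_add_mul_le_pow (a := k * σ) (by linarith) i
      rw [hX]; nlinarith [(Nat.cast_nonneg i : (0 : ℝ) ≤ i)]
    have e2 : t ^ i * ((1 + k * σ) ^ i) ^ 2 ≤ 1 := by
      rw [← pow_mul, mul_comm i 2, pow_mul, ← mul_pow]
      exact pow_le_one₀ (by positivity) h2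
    rw [← div_eq_mul_inv, le_div_iff₀ (by positivity)]
    have e3 : (1 + X) ^ 2 ≤ 4 * ((1 + k * σ) ^ i) ^ 2 := by
      calc (1 + X) ^ 2 ≤ (2 * (1 + k * σ) ^ i) ^ 2 := by gcongr
        _ = _ := by ring
    calc t ^ i * (1 + X) ^ 2 ≤ t ^ i * (4 * ((1 + k * σ) ^ i) ^ 2) := by gcongr
      _ ≤ 4 := by linarith
  have hi : (0 : ℝ) < i + 1 := by positivity
  constructor
  · have h4 := inv_one_add_sq_le (a := 7 / 4) hX0 (by norm_num) (by norm_num)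
    have h5 : X ^ (-(7 / 4) : ℝ) = ((i : ℝ) + 1) ^ (-(7 / 4) : ℝ) * (k ^ (-(7 / 4) : ℝ) * σ ^ (-(7 / 4) : ℝ)) := by
      rw [hX, Real.mul_rpow hi.le hkσ0.le, Real.mul_rpow hk0.le hσ.le]
    have h6 : ((i : ℝ) + 1) * ((i : ℝ) + 1) ^ (-(7 / 4) : ℝ) = ((i : ℝ) + 1) ^ (-(3 / 4) : ℝ) := by
      rw [← Real.rpow_one_add' hi.le (by norm_num)]; norm_num
    calc (i + 1) * t ^ i ≤ (i + 1) * (4 * X ^ (-(7 / 4) : ℝ)) := by gcongr; linarith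
      _ = 4 * k ^ (-(7 / 4) : ℝ) * (((i : ℝ) + 1) ^ (-(3 / 4) : ℝ) * σ ^ (-(7 / 4) : ℝ)) := by
        rw [h5, ← h6]; ring
      _ ≤ _ := by
        apply mul_le_mul_of_nonneg_right _ (by positivity)
        linarith [show 0 ≤ k ^ (-(3 / 4) : ℝ) by positivity]
  · have h4 := inv_one_add_sq_le (a := 3 / 4) hX0 (by norm_num) (by norm_num)
    have h5 : X ^ (-(3 / 4) : ℝ) = ((i : ℝ) + 1) ^ (-(3 / 4) : ℝ) * (k ^ (-(3 / 4) : ℝ) * σ ^ (-(3 / 4) : ℝ)) := by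
      rw [hX, Real.mul_rpow hi.le hkσ0.le, Real.mul_rpow hk0.le hσ.le]
    have h6 : σ⁻¹ * σ ^ (-(3 / 4) : ℝ) = σ ^ (-(7 / 4) : ℝ) := by
      rw [← Real.rpow_neg_one, ← Real.rpow_add hσ]; norm_num
    calc σ⁻¹ * t ^ i ≤ σ⁻¹ * (4 * X ^ (-(3 / 4) : ℝ)) := by gcongr; linarith
      _ = 4 * k ^ (-(3 / 4) : ℝ) * (((i : ℝ) + 1) ^ (-(3 / 4) : ℝ) * σ ^ (-(7 / 4) : ℝ)) := by
        rw [h5, ← h6]; ring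
      _ ≤ _ := by
        apply mul_le_mul_of_nonneg_right _ (by positivity)
        linarith [show 0 ≤ k ^ (-(7 / 4) : ℝ) by positivity]

/-! ### Spectral bands and the splitting of Taylor coefficients. -/

section
variable {r s : ℝ}

/-- In the spectral band the modes have constant modulus. -/
theorem schur_band (hr : 0 < r) (hs : 0 < s) (h : r ^ 2 + s ^ 2 = 1) {z : ℂ} (hz : ‖z‖ = 1)
    (hband : s ^ 2 < z.im ^ 2) :
    ‖schur r s (z ^ 2)‖ < 1 ∧ ‖1 + s * schur r s (z ^ 2)‖ = r := by
  have hw : ‖z ^ 2‖ = 1 := by rw [norm_pow, hz, one_pow]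
  have h1 := norm_discRoot_sq h hz
  have hle := norm_schur_le_one hr hs h hw.le
  -- With `|y| = 1` and `Y = y z̄` the quadratic equation gives `s Im Y = Im z`, hence `|Im z| ≤ s`,
  -- which fails inside a band.
  have hne : ‖schur r s (z ^ 2)‖ ≠ 1 := by
    intro h1
    set y := schur r s (z ^ 2) with hy
    have hq := schur_quad hs h (z ^ 2)
    rw [← hy] at hq
    have hzz : z * (starRingEnd ℂ) z = 1 := by
      rw [Complex.mul_conj, Complex.normSq_eq_norm_sq, hz]; simp
    have hyy : y * (starRingEnd ℂ) y = 1 := by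
      rw [Complex.mul_conj, Complex.normSq_eq_norm_sq, h1]; simp
    set Y := y * (starRingEnd ℂ) z with hY
    have hnY : ‖Y‖ = 1 := by rw [hY, norm_mul, RCLike.norm_conj, hz, mul_one, h1]
    have h2 : (s : ℂ) * (Y - (starRingEnd ℂ) Y) = z - (starRingEnd ℂ) z := by
      rw [hY]
      simp only [map_mul, Complex.conj_conj]
      linear_combination (starRingEnd ℂ z * starRingEnd ℂ y) * hq
        + (-(s * y * starRingEnd ℂ z) - starRingEnd ℂ z + z * (z * starRingEnd ℂ z)) * hyy
        + (s * z * starRingEnd ℂ y + z * (1 - y * starRingEnd ℂ y) + z * y * starRingEnd ℂ y) * hzz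
    rw [Complex.sub_conj, Complex.sub_conj] at h2
    have h3 := congrArg Complex.im h2
    simp at h3
    have h4 : s * Y.im = z.im := by linarith
    have h5 : |Y.im| ≤ 1 := (Complex.abs_im_le_norm Y).trans hnY.le
    have h6 : Y.im ^ 2 ≤ 1 := (sq_le_one_iff_abs_le_one _).2 h5
    rw [← h4] at hband
    nlinarith [mul_pos hs hs]
  have hlt := lt_of_le_of_ne hle hne
  refine ⟨hlt, ?_⟩
  -- For `|w| = 1` the left side vanishes, so `|y| ≠ 1` forces `|1 + s y| = r`.
  have h2 := schur_identity hs h (z ^ 2)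
  rw [hw] at h2
  have h3 : (1 - ‖schur r s (z ^ 2)‖ ^ 2) ≠ 0 := by nlinarith [norm_nonneg (schur r s (z ^ 2))]
  have h4 : ‖1 + s * schur r s (z ^ 2)‖ ^ 2 - r ^ 2 = 0 := by
    apply (mul_eq_zero.1 _).resolve_left h3
    rw [← h2]; ring
  exact (pow_left_inj₀ (norm_nonneg _) hr.le two_ne_zero).1 (by linarith)

end

/-- The quasi-energies in the spectral bands. -/
def bandSet (s : ℝ) : Set ℝ := {θ | s ^ 2 < Real.sin θ ^ 2}

theorem measurableSet_bandSet (s : ℝ) : MeasurableSet (bandSet s) :=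
  measurableSet_lt measurable_const (by fun_prop)

/-- The contribution of the bands to the `n`-th coefficient of `F`. -/
def bandPart (s : ℝ) (F : ℂ → ℂ) (n : ℕ) : ℂ :=
  (2 * Real.pi : ℂ)⁻¹ * ∫ θ in -Real.pi..Real.pi,
    (circleMap 0 1 θ ^ n)⁻¹ * (bandSet s).indicator (fun θ => F (circleMap 0 1 θ)) θ

/-- The sequence `c` is almost quasi-periodic, and the contribution of the bands approximates it
uniformly up to `ε`. -/
structure BandSplit (s : ℝ) (c : ℕ → ℂ) (F : ℂ → ℂ) (ε : ℝ) : Prop where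
  quasi : AlmostQuasiPeriodic c
  integrable : IntervalIntegrable ((bandSet s).indicator fun θ => F (circleMap 0 1 θ)) volume
    (-Real.pi) Real.pi
  bound : ∀ n, ‖c n - bandPart s F n‖ ≤ ε

theorem intervalIntegrable_inv_pow_mul {f : ℝ → ℂ} {a b : ℝ} (hf : IntervalIntegrable f volume a b)
    (n : ℕ) : IntervalIntegrable (fun θ => (circleMap 0 1 θ ^ n)⁻¹ * f θ) volume a b := by
  apply hf.continuousOn_mul
  apply Continuous.continuousOn
  exact Continuous.inv₀ (by fun_prop) fun θ => pow_ne_zero _ (by rw [← norm_pos_iff]; simp)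

theorem norm_inv_circleMap_pow (θ : ℝ) (n : ℕ) : ‖(circleMap 0 1 θ ^ n)⁻¹‖ = 1 := by simp

section
variable {r s : ℝ} {c d : ℕ → ℂ} {F G : ℂ → ℂ} {ε δ : ℝ}

theorem bandPart_add
    (hF : IntervalIntegrable ((bandSet s).indicator fun θ => F (circleMap 0 1 θ)) volume
      (-Real.pi) Real.pi)
    (hG : IntervalIntegrable ((bandSet s).indicator fun θ => G (circleMap 0 1 θ)) volume
      (-Real.pi) Real.pi) (n : ℕ) :
    bandPart s (fun z => F z + G z) n = bandPart s F n + bandPart s G n := by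
  unfold bandPart
  rw [← mul_add, ← intervalIntegral.integral_add (intervalIntegrable_inv_pow_mul hF n)
    (intervalIntegrable_inv_pow_mul hG n)]
  congr 2
  funext θ
  rw [← mul_add, Set.indicator_add]

theorem bandPart_const_mul (a : ℂ) (n : ℕ) :
    bandPart s (fun z => a * F z) n = a * bandPart s F n := by
  unfold bandPart
  rw [mul_left_comm]
  congr 1
  rw [← intervalIntegral.integral_const_mul]
  congr 1
  funext θ
  rw [Set.indicator_const_mul]; ring

theorem BandSplit.add (h : BandSplit s c F ε) (h' : BandSplit s d G δ) :
    BandSplit s (fun n => c n + d n) (fun z => F z + G z) (ε + δ) where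
  quasi := h.quasi.add h'.quasi
  integrable := by
    have := h.integrable.add h'.integrable
    refine this.congr fun θ _ => ?_
    simp only [Set.indicator_add]
  bound n := by
    rw [bandPart_add h.integrable h'.integrable, add_sub_add_comm]
    exact (norm_add_le _ _).trans (add_le_add (h.bound n) (h'.bound n))

theorem BandSplit.const_mul (h : BandSplit s c F ε) (a : ℂ) :
    BandSplit s (fun n => a * c n) (fun z => a * F z) (‖a‖ * ε) where
  quasi := h.quasi.const_mul a
  integrable := by
    have := h.integrable.const_mul a
    refine this.congr fun θ _ => ?_
    simp only [Set.indicator_const_mul]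
  bound n := by
    rw [bandPart_const_mul, ← mul_sub, norm_mul]
    exact mul_le_mul_of_nonneg_left (h.bound n) (norm_nonneg _)

theorem BandSplit.mono (h : BandSplit s c F ε) (hε : ε ≤ δ) : BandSplit s c F δ :=
  ⟨h.quasi, h.integrable, fun n => (h.bound n).trans hε⟩

theorem BandSplit.congr (h : BandSplit s c F ε) (hc : ∀ n, c n = d n)
    (hF : ∀ θ ∈ bandSet s, F (circleMap 0 1 θ) = G (circleMap 0 1 θ)) : BandSplit s d G ε := by
  have e : (bandSet s).indicator (fun θ => F (circleMap 0 1 θ)) =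
      (bandSet s).indicator fun θ => G (circleMap 0 1 θ) := Set.indicator_congr hF
  have e2 : c = d := funext hc
  subst e2
  refine ⟨h.quasi, e ▸ h.integrable, fun n => ?_⟩
  have := h.bound n
  rwa [bandPart, e] at this

/-- Taylor coefficients do not depend on the radius of the circle. -/
theorem coef_radius {ρ ρ' : ℝ} (h0 : 0 < ρ) (h1 : ρ < 1) (h0' : 0 < ρ') (h1' : ρ' < 1)
    (hF : DifferentiableOn ℂ F (Metric.ball 0 1)) (n : ℕ) : coef ρ n F = coef ρ' n F := by
  induction n generalizing F with
  | zero => rw [coef_zero h0 h1 hF, coef_zero h0' h1' hF]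
  | succ n ih =>
    have hd : DifferentiableOn ℂ (dslope F 0) (Metric.ball 0 1) :=
      (Complex.differentiableOn_dslope (Metric.ball_mem_nhds _ one_pos)).2 hF
    have key : ∀ t : ℝ, 0 < t → t < 1 → coef t (n + 1) F = coef t n (dslope F 0) := by
      intro t ht0 ht1
      have e : F = fun z => F 0 + z ^ 1 * dslope F 0 z := by
        funext z
        have := sub_smul_dslope F 0 z
        rw [sub_zero, smul_eq_mul] at this
        rw [pow_one, this]; ring
      conv_lhs => rw [e]
      rw [coef_add ht0 ht1 (by fun_prop) (by fun_prop), coef_const ht0, zero_add,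
        coef_add_mul ht0 1]
    rw [key ρ h0 h1, key ρ' h0' h1', ih hd]

theorem norm_discRoot_le_two (h : r ^ 2 + s ^ 2 = 1) {w : ℂ} (hw : ‖w‖ ≤ 1) :
    ‖discRoot r s w‖ ≤ 2 := by
  have h1 := norm_discRoot_sq_eq_mul (r := r) (s := s) w
  have e1 : ‖1 - (r + s * Complex.I) ^ 2 * w‖ ≤ 2 := by
    refine (norm_sub_le _ _).trans ?_
    rw [norm_mul, rotor_norm h, norm_one]; linarith
  have e2 : ‖1 - (r - s * Complex.I) ^ 2 * w‖ ≤ 2 := by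
    refine (norm_sub_le _ _).trans ?_
    rw [norm_mul, rotor_norm' h, norm_one]; linarith
  nlinarith [norm_nonneg (1 - (r + s * Complex.I) ^ 2 * w), norm_nonneg (discRoot r s w),
    norm_nonneg (1 - (r - s * Complex.I) ^ 2 * w)]

/-- The integral of the gap weight over the circle. -/
def gapMass (s : ℝ) : ℝ := ∫ θ in -Real.pi..Real.pi, gapWeight s θ

theorem gapWeight_nonneg (s θ : ℝ) : 0 ≤ gapWeight s θ := by unfold gapWeight; positivity

theorem norm_two_pi_inv_mul_le {z : ℂ} {b : ℝ} (hz : ‖z‖ ≤ b) :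
    ‖(2 * Real.pi : ℂ)⁻¹ * z‖ ≤ b := by
  have hpi : 1 ≤ 2 * Real.pi := by linarith [Real.pi_gt_three]
  have : ‖(2 * Real.pi : ℂ)‖ = 2 * Real.pi := by
    rw [norm_mul, Complex.norm_real, Real.norm_of_nonneg Real.pi_pos.le]; norm_num
  rw [norm_mul, norm_inv, this]
  exact (mul_le_of_le_one_left (norm_nonneg _) (inv_le_one_of_one_le₀ hpi)).trans hz

/-- A generating function without poles on the circle that is small in the gap. -/
theorem BandSplit.of_gap_bound (hr : 0 < r) (hs : 0 < s) (h : r ^ 2 + s ^ 2 = 1) {H : ℂ → ℂ} {K : ℝ}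
    (hd : DifferentiableOn ℂ H (Metric.ball 0 1))
    (hc : ∀ z, ‖z‖ = 1 → discRoot r s (z ^ 2) ≠ 0 → ContinuousAt H z)
    (hb : ∀ z, ‖z‖ < 1 → ‖H z‖ * ‖discRoot r s (z ^ 2)‖ ≤ K)
    (hgap : ∀ θ, Real.sin θ ^ 2 < s ^ 2 → ‖H (circleMap 0 1 θ)‖ ≤ ε * gapWeight s θ) (hε : 0 ≤ ε) :
    BandSplit s (fun n => coef (1 / 2) n H) H (ε * gapMass s) := by
  have hs1 : s ≤ 1 := by nlinarith
  have hB := fun n => coef_eq_boundary_integral hr hs h (n := n) hd hc hb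
    (c := coef (1 / 2) n H) fun ρ h0 h1 => coef_radius h0 h1 (by norm_num) (by norm_num) hd n
  have hI : IntervalIntegrable (fun θ => H (circleMap 0 1 θ)) volume (-Real.pi) Real.pi := (hB 0).1
  have hI2 : IntervalIntegrable ((bandSet s).indicator fun θ => H (circleMap 0 1 θ)) volume
      (-Real.pi) Real.pi := by
    rw [intervalIntegrable_iff] at hI ⊢
    exact hI.indicator (measurableSet_bandSet s)
  refine ⟨?_, hI2, fun n => ?_⟩
  · apply AlmostQuasiPeriodic.of_tendsto_zero
    have := (tendsto_circle_integral_zero fun θ => H (circleMap 0 1 θ)).const_mul (2 * Real.pi : ℂ)⁻¹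
    rw [mul_zero] at this
    exact this.congr fun n => (hB n).2
  -- Only the gaps survive in the difference, the band edges being a null set.
  · rw [← (hB n).2, bandPart, ← mul_sub, ← intervalIntegral.integral_sub
      (intervalIntegrable_inv_pow_mul hI n) (intervalIntegrable_inv_pow_mul hI2 n)]
    apply norm_two_pi_inv_mul_le
    rw [gapMass, ← intervalIntegral.integral_const_mul]
    apply intervalIntegral.norm_integral_le_of_norm_le (by linarith [Real.pi_pos])
    · filter_upwards [ae_sin_sq_ne hs hs1] with θ hθ _
      by_cases hb : θ ∈ bandSet s
      · rw [Set.indicator_of_mem hb, sub_self, norm_zero]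
        exact mul_nonneg hε (gapWeight_nonneg _ _)
      · rw [Set.indicator_of_notMem hb, mul_zero, sub_zero, norm_mul, norm_inv_circleMap_pow, one_mul]
        apply hgap
        rcases lt_or_gt_of_ne hθ with h1 | h1
        · exfalso; apply hb; show s ^ 2 < Real.sin θ ^ 2; linarith
        · linarith
    · exact (intervalIntegrable_gapWeight hr hs h _ _).const_mul _

theorem coef_geometric {ρ : ℝ} (h0 : 0 < ρ) (h1 : ρ < 1) {ζ : ℂ} (hζ : ‖ζ‖ = 1) (n : ℕ) :
    coef ρ n (fun z => (1 - ζ * z)⁻¹) = ζ ^ n := by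
  have hne : ∀ z : ℂ, ‖z‖ < 1 → 1 - ζ * z ≠ 0 := fun z hz h0 => by
    have : ‖ζ * z‖ = 1 := by rw [← sub_eq_zero.1 h0, norm_one]
    rw [norm_mul, hζ, one_mul] at this
    linarith
  have hd : DifferentiableOn ℂ (fun z => (1 - ζ * z)⁻¹) (Metric.ball 0 1) := by
    intro z hz
    have h2 : DifferentiableAt ℂ (fun z => 1 - ζ * z) z := by fun_prop
    exact (h2.inv (hne z (by simpa using hz))).differentiableWithinAt
  induction n with
  | zero => rw [coef_zero h0 h1 hd]; simp
  | succ n ih =>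
    have e : ∀ z : ℂ, ‖z‖ < 1 → (1 - ζ * z)⁻¹ = 1 + z ^ 1 * (ζ * (1 - ζ * z)⁻¹) := fun z hz => by
      have := hne z hz
      field_simp; ring
    rw [coef_congr h0 h1 e, coef_add h0 h1 (by fun_prop) (by fun_prop), coef_const h0,
      zero_add, coef_add_mul h0 1, coef_const_mul, ih]
    ring

/-- The coefficients of a function with two opposite simple poles on the unit circle. -/
theorem coef_pole {ρ : ℝ} (h0 : 0 < ρ) (h1 : ρ < 1) {w₀ : ℂ} (hw : ‖w₀‖ = 1) (m : ℕ) :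
    (∀ n, ‖coef ρ n (fun z => z ^ m * (z ^ 2 - w₀)⁻¹)‖ ≤ 1) ∧
    AlmostQuasiPeriodic fun n => coef ρ n (fun z => z ^ m * (z ^ 2 - w₀)⁻¹) := by
  obtain ⟨ξ, hξ⟩ : ∃ ξ : ℂ, ξ ^ 2 = w₀ := ⟨w₀ ^ (1 / 2 : ℂ), cpow_half_sq w₀⟩
  have hξ1 : ‖ξ‖ = 1 := by
    have := congrArg norm hξ
    rw [norm_pow, hw] at this
    exact (pow_eq_one_iff_of_nonneg (norm_nonneg _) two_ne_zero).1 this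
  have hξ0 : ξ ≠ 0 := by rw [← norm_pos_iff, hξ1]; exact one_pos
  obtain ⟨ζ, hζ⟩ : ∃ ζ : ℂ, ξ * ζ = 1 := ⟨ξ⁻¹, mul_inv_cancel₀ hξ0⟩
  have hζ1 : ‖ζ‖ = 1 := by
    have := congrArg norm hζ
    rwa [norm_mul, hξ1, one_mul, norm_one] at this
  have hζ1' : ‖-ζ‖ = 1 := by rwa [norm_neg]
  have hne : ∀ ζ : ℂ, ‖ζ‖ = 1 → ∀ z : ℂ, ‖z‖ < 1 → 1 - ζ * z ≠ 0 := fun ζ hζ z hz h0 => by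
    have : ‖ζ * z‖ = 1 := by rw [← sub_eq_zero.1 h0, norm_one]
    rw [norm_mul, hζ, one_mul] at this
    linarith
  have hdg : ∀ ζ : ℂ, ‖ζ‖ = 1 → DifferentiableOn ℂ (fun z => (1 - ζ * z)⁻¹) (Metric.ball 0 1) := by
    intro ζ hζ z hz
    have h2 : DifferentiableAt ℂ (fun z => 1 - ζ * z) z := by fun_prop
    exact (h2.inv (hne ζ hζ z (by simpa using hz))).differentiableWithinAt
  have hd1 := hdg ζ hζ1
  have hd2 := hdg (-ζ) hζ1'
  -- Partial fractions of `(z² - w₀)⁻¹` with `ζ² = w₀⁻¹`; its coefficients are two characters with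
  -- weights of modulus `1/2`, whence the bound one.
  set g : ℂ → ℂ := fun z => (-(ζ ^ 2) / 2) * ((1 - ζ * z)⁻¹ + (1 - -ζ * z)⁻¹) with hg
  have hgd : DifferentiableOn ℂ g (Metric.ball 0 1) := (hd1.add hd2).const_mul _
  have hgc : ∀ n, coef ρ n g = (-(ζ ^ 2) / 2) * (ζ ^ n + (-ζ) ^ n) := fun n => by
    rw [hg, coef_const_mul, coef_add h0 h1 hd1 hd2, coef_geometric h0 h1 hζ1,
      coef_geometric h0 h1 hζ1']
  have e : ∀ z : ℂ, ‖z‖ < 1 → z ^ m * (z ^ 2 - w₀)⁻¹ = z ^ m * g z := fun z hz => by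
    have a1 := hne ζ hζ1 z hz
    have a2 := hne (-ζ) hζ1' z hz
    have a3 : z ^ 2 - w₀ = -ξ ^ 2 * ((1 - ζ * z) * (1 - -ζ * z)) := by
      rw [← hξ]; linear_combination (-z ^ 2 * (ξ * ζ + 1)) * hζ
    have a4 : (z ^ 2 - w₀)⁻¹ = -ζ ^ 2 * ((1 - ζ * z)⁻¹ * (1 - -ζ * z)⁻¹) := by
      rw [a3, mul_inv, mul_inv]
      congr 1
      apply inv_eq_of_mul_eq_one_right
      linear_combination (ξ * ζ + 1) * hζ
    have hu := mul_inv_cancel₀ a1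
    have hv := mul_inv_cancel₀ a2
    rw [a4, hg]
    simp only
    linear_combination (-(ζ ^ 2 * z ^ m / 2)) * ((1 - ζ * z)⁻¹ * hv + (1 - -ζ * z)⁻¹ * hu)
  have hval : ∀ n, coef ρ n (fun z => z ^ m * (z ^ 2 - w₀)⁻¹) =
      if m ≤ n then (-(ζ ^ 2) / 2) * (ζ ^ (n - m) + (-ζ) ^ (n - m)) else 0 := fun n => by
    rw [coef_congr h0 h1 e]
    split_ifs with hmn
    · have := coef_add_mul (ρ := ρ) (n := n - m) (F := g) h0 m
      rw [Nat.sub_add_cancel hmn] at this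
      rw [this, hgc]
    · exact coef_mul_of_lt h0 h1 hgd (not_le.1 hmn)
  constructor
  · intro n
    rw [hval]
    split_ifs with hmn
    · have hle : ‖ζ ^ (n - m) + (-ζ) ^ (n - m)‖ ≤ 2 := by
        refine (norm_add_le _ _).trans ?_
        rw [norm_pow, norm_pow, hζ1, hζ1', one_pow]; norm_num
      rw [norm_mul, norm_div, norm_neg, norm_pow, hζ1]
      norm_num
      linarith
    · simp
  · have hq := (AlmostQuasiPeriodic.character ((-(ζ ^ 2) / 2) * ξ ^ m) hζ1).add
      (AlmostQuasiPeriodic.character ((-(ζ ^ 2) / 2) * (-ξ) ^ m) hζ1')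
    -- Coefficients below order `m` vanish, so the characters describe the sequence only from `m`
    -- on.
    refine hq.congr' ?_
    filter_upwards [eventually_ge_atTop m] with n hn
    rw [hval, if_pos hn]
    obtain ⟨k, rfl⟩ := Nat.exists_eq_add_of_le hn
    rw [Nat.add_sub_cancel_left, pow_add, pow_add]
    have e1 : ξ ^ m * ζ ^ m = 1 := by rw [← mul_pow, hζ, one_pow]
    have e2 : (-ξ) ^ m * (-ζ) ^ m = 1 := by rw [← mul_pow, neg_mul_neg, hζ, one_pow]
    linear_combination (-(ζ ^ 2) / 2 * ζ ^ k) * e1 + (-(ζ ^ 2) / 2 * (-ζ) ^ k) * e2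

/-- The pole itself is not small, but its coefficients are bounded by one and it stays away from the
bands, so its band contribution is bounded by the supremum over the bands times the length of the
circle. -/
theorem BandSplit.pole {w₀ : ℂ} (hw : ‖w₀‖ = 1) {K : ℝ} (hK : 0 ≤ K)
    (hb : ∀ θ ∈ bandSet s, ‖(circleMap 0 1 θ ^ 2 - w₀)⁻¹‖ ≤ K) (m : ℕ) :
    BandSplit s (fun n => coef (1 / 2) n (fun z => z ^ m * (z ^ 2 - w₀)⁻¹))
      (fun z => z ^ m * (z ^ 2 - w₀)⁻¹) (1 + K * (2 * Real.pi)) := by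
  have hpi := Real.pi_pos
  obtain ⟨h1, h2⟩ := coef_pole (ρ := 1 / 2) (by norm_num) (by norm_num) hw m
  have hle : ∀ θ, ‖(bandSet s).indicator (fun θ => circleMap 0 1 θ ^ m * (circleMap 0 1 θ ^ 2 - w₀)⁻¹) θ‖ ≤ K := by
    intro θ
    by_cases hθ : θ ∈ bandSet s
    · rw [Set.indicator_of_mem hθ, norm_mul, norm_pow, norm_circleMap_one, one_pow, one_mul]
      exact hb θ hθ
    · rw [Set.indicator_of_notMem hθ, norm_zero]; exact hK
  refine ⟨h2, ?_, fun n => ?_⟩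
  · refine (intervalIntegrable_const (c := K)).mono_fun' ?_ (Eventually.of_forall hle)
    apply Measurable.aestronglyMeasurable
    apply Measurable.indicator _ (measurableSet_bandSet s)
    have : Measurable fun θ : ℝ => circleMap 0 1 θ := (continuous_circleMap 0 1).measurable
    fun_prop
  · refine (norm_sub_le _ _).trans (add_le_add (h1 n) ?_)
    apply norm_two_pi_inv_mul_le
    have := intervalIntegral.norm_integral_le_of_norm_le_const (a := -Real.pi) (b := Real.pi) (C := K)
      (f := fun θ => (circleMap 0 1 θ ^ n)⁻¹ * (bandSet s).indicator
        (fun θ => circleMap 0 1 θ ^ m * (circleMap 0 1 θ ^ 2 - w₀)⁻¹) θ) fun θ _ => by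
          rw [norm_mul, norm_inv_circleMap_pow, one_mul]; exact hle θ
    refine this.trans (le_of_eq ?_)
    rw [sub_neg_eq_add, ← two_mul, abs_of_pos (by positivity)]

end

/-! ### Generating functions without bound states. -/

section
variable {r s : ℝ}

/-- The ratio of consecutive amplitudes, up to the phase `z`. -/
def modeRatio (r s : ℝ) (y : ℂ) : ℂ := r / (1 + s * y)

theorem norm_modeRatio_le_one (hr : 0 < r) (hs : 0 < s) (h : r ^ 2 + s ^ 2 = 1) {w : ℂ} (hw : ‖w‖ ≤ 1) :
    ‖modeRatio r s (schur r s w)‖ ≤ 1 := by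
  have h1 := le_norm_one_add_schur hr hs h hw
  rw [modeRatio, norm_div, Complex.norm_real, Real.norm_of_nonneg hr.le]
  exact div_le_one_of_le₀ h1 (norm_nonneg _)

/-- Puts `norm_one_add_schur_gap` into the form `t² (1 + κ σ) ≤ 1` required by `exists_pow_decay`,
with `σ = |discRoot|` and `κ = 1 - s`. -/
theorem modeRatio_gap (hr : 0 < r) (hs : 0 < s) (h : r ^ 2 + s ^ 2 = 1) {z : ℂ} (hz : ‖z‖ = 1)
    (hgap : z.im ^ 2 < s ^ 2) :
    ‖modeRatio r s (schur r s (z ^ 2))‖ ^ 2 * (1 + (1 - s) * ‖discRoot r s (z ^ 2)‖) ≤ 1 := by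
  have hw : ‖z ^ 2‖ = 1 := by rw [norm_pow, hz, one_pow]
  have h1 := norm_one_add_schur_gap hr hs h hw (norm_schur_gap hs h hz hgap)
  have h2 := le_norm_one_add_schur hr hs h hw.le
  have hs1 : s ≤ 1 := by nlinarith
  have hr1 : r ^ 2 ≤ 1 := by nlinarith
  rw [modeRatio, norm_div, Complex.norm_real, Real.norm_of_nonneg hr.le, div_pow, div_mul_eq_mul_div]
  apply div_le_one_of_le₀ _ (by positivity)
  have : r ^ 2 * ((1 - s) * ‖discRoot r s (z ^ 2)‖) ≤ (1 - s) * ‖discRoot r s (z ^ 2)‖ :=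
    mul_le_of_le_one_left (mul_nonneg (by linarith) (norm_nonneg _)) hr1
  linarith

/-- Since `σ² = 4 |s² - sin² θ|`, the exponent `-7/4` in `σ` is the exponent `-7/8` of the weight.
-/
theorem norm_discRoot_rpow_le (h : r ^ 2 + s ^ 2 = 1) {θ : ℝ}
    (hθ : s ^ 2 - Real.sin θ ^ 2 ≠ 0) :
    ‖discRoot r s (circleMap 0 1 θ ^ 2)‖ ^ (-(7 / 4) : ℝ) ≤ gapWeight s θ := by
  have h1 := norm_discRoot_sq h (norm_circleMap_one θ)
  rw [circleMap_one_im] at h1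
  have hδ : 0 < |s ^ 2 - Real.sin θ ^ 2| := abs_pos.2 hθ
  have h2 : ‖discRoot r s (circleMap 0 1 θ ^ 2)‖ ^ (-(7 / 4) : ℝ) =
      (‖discRoot r s (circleMap 0 1 θ ^ 2)‖ ^ 2) ^ (-(7 / 8) : ℝ) := by
    rw [← Real.rpow_natCast, ← Real.rpow_mul (norm_nonneg _)]; norm_num
  rw [h2, h1, gapWeight]
  exact Real.rpow_le_rpow_of_nonpos hδ (by linarith) (by norm_num)

theorem exists_bound_comp_schur (h : r ^ 2 + s ^ 2 = 1) {f : ℂ → ℂ}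
    (hf : ∀ w, ‖w‖ ≤ 1 → ContinuousAt f (schur r s w)) :
    ∃ K : ℝ, 0 ≤ K ∧ ∀ w, ‖w‖ ≤ 1 → ‖f (schur r s w)‖ ≤ K := by
  have hc : ContinuousOn (fun w => f (schur r s w)) (Metric.closedBall 0 1) := by
    intro w hw
    have hw' : ‖w‖ ≤ 1 := by simpa using hw
    exact (ContinuousAt.comp (hf w hw') (continuousAt_schur h hw')).continuousWithinAt
  obtain ⟨K, hK⟩ := (isCompact_closedBall (0 : ℂ) 1).exists_bound_of_continuousOn hc
  exact ⟨K, (norm_nonneg _).trans (hK 0 (by simp)), fun w hw => hK w (by simpa using hw)⟩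

theorem continuousAt_schur_sq (h : r ^ 2 + s ^ 2 = 1) {z : ℂ} (hz : ‖z‖ = 1) :
    ContinuousAt (fun z => schur r s (z ^ 2)) z :=
  ContinuousAt.comp (g := schur r s) (f := fun z => z ^ 2)
    (continuousAt_schur h (by rw [norm_pow, hz, one_pow])) (by fun_prop)

theorem norm_pow_le_one_of {z : ℂ} (hz : ‖z‖ ≤ 1) (m : ℕ) : ‖z ^ m‖ ≤ 1 := by
  rw [norm_pow]; exact pow_le_one₀ (norm_nonneg _) hz

/-- Without bound states, the resolvent denominator vanishes at most at the band edges. -/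
theorem exists_discRoot_le_resDen (hr : 0 < r) (hs : 0 < s) (h : r ^ 2 + s ^ 2 = 1) {p : ℝ}
    (hp : |p| < 1) (hsp : s ≤ p) : ∃ K : ℝ, 0 ≤ K ∧ ∀ w, ‖w‖ ≤ 1 →
      ‖(resDen p (schur r s w))⁻¹‖ * ‖discRoot r s w‖ ≤ K := by
  -- For `p = s` the zero at the band edge is cancelled exactly by `discRoot`, through
  -- `discRoot_mul`. For `p > s` there is no zero at all, because an attained value of modulus one
  -- satisfies `Re y ≥ -s > -p`.
  rcases hsp.eq_or_lt with rfl | hlt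
  · obtain ⟨K, hK0, hK⟩ := exists_bound_comp_schur h (f := fun y => (y + s)⁻¹) fun w _ =>
      ContinuousAt.inv₀ (by fun_prop) (schur_add_ne hr hs h w)
    refine ⟨s * K, by positivity, fun w hw => ?_⟩
    have h1 : discRoot r s w = s * resDen s (schur r s w) * (schur r s w + s)⁻¹ := by
      rw [eq_mul_inv_iff_mul_eq₀ (schur_add_ne hr hs h w), discRoot_mul hs h, resDen]
    have h2 := hK w hw
    rw [← norm_mul]
    by_cases h0 : resDen s (schur r s w) = 0
    · rw [h0]; simp only [inv_zero, zero_mul, norm_zero]; positivity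
    · have : (resDen s (schur r s w))⁻¹ * discRoot r s w = s * (schur r s w + s)⁻¹ := by
        rw [h1]; field_simp
      rw [this, norm_mul, Complex.norm_real, Real.norm_of_nonneg hs.le]
      gcongr
  · have hne : ∀ w, ‖w‖ ≤ 1 → resDen p (schur r s w) ≠ 0 := fun w hw => by
      rcases (norm_schur_le_one hr hs h hw).lt_or_eq with h1 | h1
      · exact resDen_ne_zero hp h1
      · have h2 := le_norm_one_add_schur hr hs h hw
        have h3 := norm_one_add_sq_of_norm_one (s := s) h1
        have h4 : 0 ≤ s + (schur r s w).re := by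
          have : r ^ 2 ≤ ‖1 + s * schur r s w‖ ^ 2 := by gcongr
          nlinarith
        rw [← norm_pos_iff, resDen, norm_quad_of_norm_one p h1]
        have : 0 < p + (schur r s w).re := by linarith
        positivity
    obtain ⟨K, hK0, hK⟩ := exists_bound_comp_schur h (f := fun y => (resDen p y)⁻¹) fun w hw => by
      refine ContinuousAt.inv₀ ?_ (hne w hw)
      unfold resDen; fun_prop
    exact ⟨K * 2, by positivity, fun w hw => mul_le_mul (hK w hw) (norm_discRoot_le_two h hw)
      (norm_nonneg _) hK0⟩

/-- The resolvent denominator costs at most one factor `σ⁻¹`, and the second estimate of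
`exists_pow_decay` combines this with the decay of the modes in the gap. -/
theorem bandSplit_amp_of_le (hr : 0 < r) (hs : 0 < s) (h : r ^ 2 + s ^ 2 = 1) {p : ℝ}
    (hp : |p| < 1) (hsp : s ≤ p) (Q : Polynomial ℂ) : ∃ K : ℝ, ∀ m i : ℕ,
      BandSplit s (fun n => coef (1 / 2) n (amp r s p Q m i)) (amp r s p Q m i)
        (K * ((i : ℝ) + 1) ^ (-(3 / 4) : ℝ)) := by
  obtain ⟨K₁, hK₁, hD⟩ := exists_discRoot_le_resDen hr hs h hp hsp
  obtain ⟨K₂, hK₂, hQ⟩ := exists_bound_comp_schur h (f := fun y => Q.eval y)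
    fun w _ => Q.continuous.continuousAt
  have hs1 : s < 1 := by nlinarith
  obtain ⟨K₃, hK₃, hdecay⟩ := exists_pow_decay (κ := 1 - s) (by linarith)
  have hb : ∀ m i z, ‖z‖ ≤ 1 → ‖amp r s p Q m i z‖ * ‖discRoot r s (z ^ 2)‖ ≤
      K₂ * K₁ * ‖modeRatio r s (schur r s (z ^ 2))‖ ^ i := fun m i z hz => by
    have hw : ‖z ^ 2‖ ≤ 1 := norm_pow_le_one_of hz 2
    have h1 := hD _ hw
    have h2 := hQ _ hw
    have h3 := norm_pow_le_one_of hz m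
    rw [amp, norm_mul, norm_mul, norm_pow _ i, ← modeRatio, div_eq_mul_inv, norm_mul]
    have : ∀ a q Qv D S : ℝ, 0 ≤ a → a ≤ 1 → 0 ≤ q → 0 ≤ Qv → Qv ≤ K₂ → 0 ≤ D * S → D * S ≤ K₁ →
        a * (q * (Qv * D)) * S ≤ K₂ * K₁ * q := by
      intro a q Qv D S ha ha1 hq hQ0 hQ1 hD0 hD1
      calc a * (q * (Qv * D)) * S = a * (q * (Qv * (D * S))) := by ring
        _ ≤ 1 * (q * (K₂ * K₁)) := by gcongr
        _ = _ := by ring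
    exact this _ _ _ _ _ (norm_nonneg _) h3 (by positivity) (norm_nonneg _) h2 (by positivity) h1
  refine ⟨K₂ * K₁ * K₃ * gapMass s, fun m i => ?_⟩
  have hnn : 0 ≤ K₂ * K₁ * K₃ * ((i : ℝ) + 1) ^ (-(3 / 4) : ℝ) := by positivity
  have key := BandSplit.of_gap_bound (ε := K₂ * K₁ * K₃ * ((i : ℝ) + 1) ^ (-(3 / 4) : ℝ)) hr hs h
    (differentiableOn_amp hr hs h hp Q m i) (K := K₂ * K₁) ?_ ?_ ?_ hnn
  · exact key.mono (le_of_eq (by ring))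
  · intro z hz hne
    have hw : ‖z ^ 2‖ ≤ 1 := by rw [norm_pow, hz, one_pow]
    have h1 := continuousAt_schur_sq h hz
    have h2 : resDen p (schur r s (z ^ 2)) ≠ 0 := by
      intro h0
      have hbad : ‖discRoot r s (z ^ 2)‖ ≠ 0 := norm_ne_zero_iff.2 hne
      rcases hsp.eq_or_lt with rfl | hlt
      · have := discRoot_mul hs h (z ^ 2)
        rw [show 1 + 2 * s * schur r s (z ^ 2) + schur r s (z ^ 2) ^ 2 = resDen s (schur r s (z ^ 2)) from rfl,
          h0, mul_zero] at this
        exact (mul_ne_zero hne (schur_add_ne hr hs h _)) this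
      · rcases (norm_schur_le_one hr hs h hw).lt_or_eq with h1 | h1
        · exact resDen_ne_zero hp h1 h0
        · have h2 := le_norm_one_add_schur hr hs h hw
          have h3 := norm_one_add_sq_of_norm_one (s := s) h1
          have h4 : 0 ≤ s + (schur r s (z ^ 2)).re := by
            have : r ^ 2 ≤ ‖1 + s * schur r s (z ^ 2)‖ ^ 2 := by gcongr
            nlinarith
          have h5 := norm_quad_of_norm_one p h1
          rw [← resDen, h0, norm_zero, abs_of_pos (by linarith)] at h5
          linarith
    have h3 := one_add_schur_ne hr hs h hw
    have h4 : ContinuousAt (fun z => Q.eval (schur r s (z ^ 2))) z :=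
      ContinuousAt.comp (g := fun y => Q.eval y) Q.continuous.continuousAt h1
    have h5 : ContinuousAt (fun z => resDen p (schur r s (z ^ 2))) z := by unfold resDen; fun_prop
    unfold amp
    exact ContinuousAt.mul (by fun_prop) (((continuousAt_const.div
      (continuousAt_const.add (continuousAt_const.mul h1)) h3).pow i).mul (h4.div h5 h2))
  · intro z hz
    refine (hb m i z hz.le).trans (mul_le_of_le_one_right (by positivity) ?_)
    exact pow_le_one₀ (norm_nonneg _) (norm_modeRatio_le_one hr hs h (norm_pow_le_one_of hz.le 2))
  · intro θ hθ
    have hθ' : s ^ 2 - Real.sin θ ^ 2 ≠ 0 := by linarith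
    have hz := norm_circleMap_one θ
    have hS : 0 < ‖discRoot r s (circleMap 0 1 θ ^ 2)‖ := norm_pos_iff.2 (discRoot_ne_zero h hθ')
    have h1 := hb m i (circleMap 0 1 θ) hz.le
    have h2 := (hdecay _ _ i hS (norm_discRoot_le_two h (norm_pow_le_one_of hz.le 2)) (norm_nonneg _)
      (modeRatio_gap hr hs h hz (by rw [circleMap_one_im]; exact hθ))).2
    have h3 := norm_discRoot_rpow_le h hθ'
    rw [← le_div_iff₀ hS] at h1
    calc _ ≤ _ := h1
      _ = K₂ * K₁ * (‖discRoot r s (circleMap 0 1 θ ^ 2)‖⁻¹ *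
          ‖modeRatio r s (schur r s (circleMap 0 1 θ ^ 2))‖ ^ i) := by ring
      _ ≤ K₂ * K₁ * (K₃ * (((i : ℝ) + 1) ^ (-(3 / 4) : ℝ) * gapWeight s θ)) := by
        refine mul_le_mul_of_nonneg_left (h2.trans ?_) (by positivity)
        gcongr
      _ = _ := by ring

end

/-! ### Bound states: splitting off simple poles. -/

section
variable {r s : ℝ}

theorem continuousAt_dslope {f : ℂ → ℂ} {e y : ℂ} (he : DifferentiableAt ℂ f e)
    (hy : ContinuousAt f y) : ContinuousAt (dslope f e) y := by
  by_cases h : y = e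
  · subst h; exact continuousAt_dslope_same.2 he
  · exact (continuousAt_dslope_of_ne h).2 hy

/-- Reciprocal difference quotient of `z² ↦ y` at a bound state energy. -/
theorem exists_pole_data (hr : 0 < r) (hs : 0 < s) (h : r ^ 2 + s ^ 2 = 1) {e : ℂ} (he : ‖e‖ = 1)
    (hse : 0 < s + e.re) : ∃ w₀ e' : ℂ, ‖w₀‖ = 1 ∧ (∀ w, ‖w‖ ≤ 1 → schur r s w ≠ e') ∧
      ∀ w, (w - w₀) * (schur r s w + s) = s * (schur r s w - e) * (schur r s w - e') := by
  have hs1 : s < 1 := by nlinarith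
  have hne : e + s ≠ 0 := by
    intro h0
    have : e = -(s : ℂ) := by linear_combination h0
    rw [this, norm_neg, Complex.norm_real, Real.norm_of_nonneg hs.le] at he
    linarith
  have hnorm : ‖1 + s * e‖ = ‖e + s‖ := by
    have := norm_add_sq_identity h e
    rw [he] at this
    have h2 : ‖e + s‖ ^ 2 = ‖1 + s * e‖ ^ 2 := by linarith
    exact ((pow_left_inj₀ (norm_nonneg _) (norm_nonneg _) two_ne_zero).1 h2).symm
  have hnorm0 : ‖e + s‖ ≠ 0 := norm_ne_zero_iff.2 hne
  obtain ⟨w₀, hw₀⟩ : ∃ w₀, w₀ * (e + s) = e * (1 + s * e) :=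
    ⟨e * (1 + s * e) / (e + s), div_mul_cancel₀ _ hne⟩
  -- The second root of the quadratic equation at `w₀`, since the two roots have product `-w₀`.
  obtain ⟨e', he'⟩ : ∃ e', e' * (e + s) = -(1 + s * e) :=
    ⟨-(1 + s * e) / (e + s), div_mul_cancel₀ _ hne⟩
  refine ⟨w₀, e', ?_, ?_, ?_⟩
  · have := congrArg norm hw₀
    rw [norm_mul, norm_mul, he, one_mul, hnorm] at this
    exact (mul_eq_right₀ hnorm0).1 this
  · intro w hw h0
    have hn' : ‖e'‖ = 1 := by
      have := congrArg norm he'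
      rw [norm_mul, norm_neg, hnorm] at this
      exact (mul_eq_right₀ hnorm0).1 this
    have h1 := le_norm_one_add_schur hr hs h hw
    rw [h0] at h1
    have h2 := norm_one_add_sq_of_norm_one (s := s) hn'
    have h3 : 0 ≤ s + e'.re := by
      have : r ^ 2 ≤ ‖1 + s * e'‖ ^ 2 := by gcongr
      nlinarith
    have hrs : (r : ℂ) ^ 2 + s ^ 2 = 1 := by exact_mod_cast h
    -- This puts `Re e'` strictly below `-s`, whereas attained values of modulus one have real part
    -- at least `-s`.
    have h4 : (e' + s) * (e + s) = -(r : ℂ) ^ 2 := by linear_combination he' + hrs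
    have h5 : (e' + s) * (Complex.normSq (e + s) : ℂ) = -(r : ℂ) ^ 2 * (starRingEnd ℂ) (e + s) := by
      rw [← Complex.mul_conj, ← h4]; ring
    have h6 := congrArg Complex.re h5
    have hpos : 0 < Complex.normSq (e + s) := Complex.normSq_pos.2 hne
    simp only [← Complex.ofReal_pow, ← Complex.ofReal_neg, Complex.mul_re, Complex.ofReal_re, Complex.ofReal_im, Complex.add_re, Complex.conj_re,
      mul_zero, sub_zero, zero_mul] at h6
    have h7 : 0 < r ^ 2 * (e.re + s) := by apply mul_pos (by positivity); linarith
    nlinarith [mul_nonneg h3 hpos.le]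
  · intro w
    have h1 := schur_mul hs h w
    apply mul_right_cancel₀ hne
    linear_combination (e + s) * h1 - (schur r s w + s) * hw₀ - s * (schur r s w - e) * -he'

/-- A generating function with a single simple pole in `y`. -/
def ampPole (r s : ℝ) (e : ℂ) (Q : Polynomial ℂ) (m i : ℕ) (z : ℂ) : ℂ :=
  z ^ m * (modeRatio r s (schur r s (z ^ 2)) ^ i *
    (Q.eval (schur r s (z ^ 2)) * (schur r s (z ^ 2) - e)⁻¹))

/-- The pole is subtracted with its residue at `y = e`. The remainder is a difference quotient of `A
qⁱ`, bounded by `(i + 1) tⁱ` with `t` dominating both `|q(y)|` and `|q(e)|`, so the first estimate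
of `exists_pow_decay` applies. The pole carries the factor `q(e)ⁱ`, which decays because `|1 + s e|
> r`. -/
theorem bandSplit_ampPole (hr : 0 < r) (hs : 0 < s) (h : r ^ 2 + s ^ 2 = 1) {e : ℂ} (he : ‖e‖ = 1)
    (hse : 0 < s + e.re) (Q : Polynomial ℂ) : ∃ K : ℝ, ∀ m i : ℕ,
      BandSplit s (fun n => coef (1 / 2) n (ampPole r s e Q m i)) (ampPole r s e Q m i)
        (K * ((i : ℝ) + 1) ^ (-(3 / 4) : ℝ)) := by
  obtain ⟨w₀, e', hw₀, hne', hfac⟩ := exists_pole_data hr hs h he hse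
  have hs1 : s < 1 := by nlinarith
  have hs0 : (s : ℂ) ≠ 0 := by exact_mod_cast hs.ne'
  have hnes : e + s ≠ 0 := by
    intro h0
    have : e = -(s : ℂ) := by linear_combination h0
    rw [this, norm_neg, Complex.norm_real, Real.norm_of_nonneg hs.le] at he
    linarith
  have hre : r < ‖1 + s * e‖ := by
    have := norm_one_add_sq_of_norm_one (s := s) he
    exact lt_of_pow_lt_pow_left₀ 2 (norm_nonneg _) (by nlinarith)
  have hqe0 : 1 + s * e ≠ 0 := by rw [← norm_pos_iff]; linarith
  -- The functions are arranged so that `A G = Q` and `G (w - w₀) = y - e`. Hence `Q qⁱ / (y - e) =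
  -- A qⁱ / (w - w₀)`, and replacing `A qⁱ` by its value at `e` costs `DT G`, where `DT` is the
  -- difference quotient of `A qⁱ`.
  set A : ℂ → ℂ := fun y => Q.eval y * (s * (y - e') * (y + s)⁻¹) with hA
  set q : ℂ → ℂ := modeRatio r s with hq
  set G : ℂ → ℂ := fun y => (y + s) * (s * (y - e'))⁻¹ with hG
  set DT : ℕ → ℂ → ℂ := fun i y => dslope A e y * q y ^ i +
    A e * (dslope q e y * ∑ k ∈ Finset.range i, q y ^ k * q e ^ (i - 1 - k)) with hDT
  set T : ℕ → ℕ → ℂ → ℂ := fun m i z =>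
    z ^ m * (DT i (schur r s (z ^ 2)) * G (schur r s (z ^ 2))) with hT
  have dA : ∀ y : ℂ, y + s ≠ 0 → DifferentiableAt ℂ A y := fun y hy => by
    have h1 : DifferentiableAt ℂ (fun y => Q.eval y) y := Q.differentiable.differentiableAt
    have h2 : DifferentiableAt ℂ (fun y : ℂ => (y + s)⁻¹) y :=
      (by fun_prop : DifferentiableAt ℂ (fun y : ℂ => y + s) y).inv hy
    exact h1.mul ((by fun_prop : DifferentiableAt ℂ (fun y : ℂ => s * (y - e')) y).mul h2)
  have dq : ∀ y : ℂ, 1 + s * y ≠ 0 → DifferentiableAt ℂ q y := fun y hy =>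
    (differentiableAt_const _).div (by fun_prop) hy
  have dG : ∀ y : ℂ, y ≠ e' → DifferentiableAt ℂ G y := fun y hy =>
    (by fun_prop : DifferentiableAt ℂ (fun y : ℂ => y + s) y).mul
      ((by fun_prop : DifferentiableAt ℂ (fun y : ℂ => s * (y - e')) y).inv
        (mul_ne_zero hs0 (sub_ne_zero.2 hy)))
  have hys := fun w => schur_add_ne hr hs h w
  have hys1 := fun w hw => one_add_schur_ne hr hs h (w := w) hw
  have cDA : ∀ w, ‖w‖ ≤ 1 → ContinuousAt (dslope A e) (schur r s w) := fun w _ =>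
    continuousAt_dslope (dA e hnes) (dA _ (hys w)).continuousAt
  have cDq : ∀ w, ‖w‖ ≤ 1 → ContinuousAt (dslope q e) (schur r s w) := fun w hw =>
    continuousAt_dslope (dq e hqe0) (dq _ (hys1 w hw)).continuousAt
  obtain ⟨KA, hKA0, hKA⟩ := exists_bound_comp_schur h cDA
  obtain ⟨Kq, hKq0, hKq⟩ := exists_bound_comp_schur h cDq
  obtain ⟨KG, hKG0, hKG⟩ := exists_bound_comp_schur h (f := G) fun w hw =>
    (dG _ (hne' w hw)).continuousAt
  -- the decomposition of the generating function
  have hGA : ∀ w, ‖w‖ ≤ 1 → A (schur r s w) * G (schur r s w) = Q.eval (schur r s w) := fun w hw => by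
    have h1 := hys w
    have h2 := sub_ne_zero.2 (hne' w hw)
    simp only [hA, hG]
    field_simp
  have hGW : ∀ w, ‖w‖ ≤ 1 → G (schur r s w) * (w - w₀) = schur r s w - e := fun w hw => by
    have h2 := sub_ne_zero.2 (hne' w hw)
    have h3 := hfac w
    simp only [hG]
    rw [mul_right_comm, mul_comm (schur r s w + s), h3]
    field_simp
  have hDTe : ∀ i y, (y - e) * DT i y = A y * q y ^ i - A e * q e ^ i := fun i y => by
    have h1 := sub_smul_dslope A e y
    have h2 := sub_smul_dslope q e y
    have h3 := (Commute.all (q y) (q e)).mul_geom_sum₂ i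
    rw [smul_eq_mul] at h1 h2
    simp only [hDT]
    linear_combination q y ^ i * h1 + A e * (∑ k ∈ Finset.range i, q y ^ k * q e ^ (i - 1 - k)) * h2
      + A e * h3
  have hdecomp : ∀ m i z, ‖z‖ ≤ 1 → schur r s (z ^ 2) ≠ e → ampPole r s e Q m i z =
      T m i z + A e * q e ^ i * (z ^ m * (z ^ 2 - w₀)⁻¹) := fun m i z hz hye => by
    have hw := norm_pow_le_one_of hz 2
    have h1 := hGA _ hw
    have h2 := hGW _ hw
    have h3 := hDTe i (schur r s (z ^ 2))
    have h4 := sub_ne_zero.2 hye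
    have hW : z ^ 2 - w₀ ≠ 0 := fun h0 => by rw [h0, mul_zero] at h2; exact h4 h2.symm
    have h5 : (z ^ 2 - w₀)⁻¹ = G (schur r s (z ^ 2)) * (schur r s (z ^ 2) - e)⁻¹ := by
      rw [eq_mul_inv_iff_mul_eq₀ h4, ← h2]; field_simp
    have h6 : DT i (schur r s (z ^ 2)) = (A (schur r s (z ^ 2)) * q (schur r s (z ^ 2)) ^ i - A e * q e ^ i) *
        (schur r s (z ^ 2) - e)⁻¹ := by
      rw [eq_mul_inv_iff_mul_eq₀ h4, ← h3]; ring
    rw [ampPole, ← h1, hT, h5]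
    simp only
    rw [h6]
    ring
  -- bounds
  obtain ⟨tq, htq⟩ : ∃ tq, ‖q e‖ = tq := ⟨_, rfl⟩
  have htq0 : 0 < tq := by
    rw [← htq, norm_pos_iff]; simp only [hq, modeRatio]
    exact div_ne_zero (by exact_mod_cast hr.ne') hqe0
  have htq1 : tq < 1 := by
    rw [← htq]; simp only [hq, modeRatio, norm_div, Complex.norm_real, Real.norm_of_nonneg hr.le]
    rw [div_lt_one (by linarith)]; exact hre
  -- Small enough that both the mode ratio in the gap and its value at the pole satisfy `t² (1 + κ
  -- σ) ≤ 1`, the latter for all `σ ≤ 2`.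
  set κ : ℝ := min (1 - s) (((tq ^ 2)⁻¹ - 1) / 2) with hκ
  have hinv : 1 < (tq ^ 2)⁻¹ := (one_lt_inv₀ (by positivity)).2 (by nlinarith)
  have hκ0 : 0 < κ := lt_min (by linarith) (by linarith)
  have hκq : ∀ σ, 0 ≤ σ → σ ≤ 2 → tq ^ 2 * (1 + κ * σ) ≤ 1 := fun σ h0 h2 => by
    have h1 : κ * σ ≤ (tq ^ 2)⁻¹ - 1 := by
      have := min_le_right (1 - s) (((tq ^ 2)⁻¹ - 1) / 2)
      rw [← hκ] at this
      nlinarith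
    calc tq ^ 2 * (1 + κ * σ) ≤ tq ^ 2 * (tq ^ 2)⁻¹ := by gcongr; linarith
      _ = 1 := mul_inv_cancel₀ (by positivity)
  obtain ⟨Kd, hKd0, hdecay⟩ := exists_pow_decay hκ0
  have hDTb : ∀ i w t, ‖w‖ ≤ 1 → ‖q (schur r s w)‖ ≤ t → tq ≤ t →
      ‖DT i (schur r s w)‖ ≤ (KA + ‖A e‖ * Kq * tq⁻¹) * ((i + 1) * t ^ i) := fun i w t hw h1 h2 => by
    have ht0 : 0 ≤ t := htq0.le.trans h2
    have hgeom : ‖∑ k ∈ Finset.range i, q (schur r s w) ^ k * q e ^ (i - 1 - k)‖ ≤ tq⁻¹ * (i * t ^ i) := by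
      have e1 : ∀ k ∈ Finset.range i, ‖q (schur r s w) ^ k * q e ^ (i - 1 - k)‖ ≤ tq⁻¹ * t ^ i := by
        intro k hk
        have hk' := Finset.mem_range.1 hk
        rw [norm_mul, norm_pow, norm_pow, htq]
        have e2 : t ^ i = t ^ k * (t ^ (i - 1 - k) * t) := by
          rw [← pow_succ, ← pow_add]; congr 1; omega
        rw [e2]
        calc _ ≤ t ^ k * t ^ (i - 1 - k) := by gcongr
          _ = tq⁻¹ * (t ^ k * (t ^ (i - 1 - k) * tq)) := by field_simp
          _ ≤ _ := by gcongr
      refine (norm_sum_le_of_le _ e1).trans (le_of_eq ?_)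
      rw [Finset.sum_const, Finset.card_range, nsmul_eq_mul]; ring
    have hti : 0 ≤ t ^ i := by positivity
    calc ‖DT i (schur r s w)‖ ≤ KA * t ^ i + ‖A e‖ * (Kq * (tq⁻¹ * (i * t ^ i))) := by
          refine (norm_add_le _ _).trans ?_
          simp only [norm_mul, norm_pow]
          gcongr
          · exact hKA w hw
          · exact hKq w hw
      _ ≤ _ := by
          have h3 : 0 ≤ (i : ℝ) * (KA * t ^ i) := by positivity
          have h4 : 0 ≤ ‖A e‖ * Kq * tq⁻¹ * t ^ i := by positivity
          nlinarith
  have hKT0 : 0 ≤ KA + ‖A e‖ * Kq * tq⁻¹ := by positivity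
  have hTb : ∀ m i z t, ‖z‖ ≤ 1 → ‖q (schur r s (z ^ 2))‖ ≤ t → tq ≤ t →
      ‖T m i z‖ ≤ KG * (KA + ‖A e‖ * Kq * tq⁻¹) * ((i + 1) * t ^ i) := fun m i z t hz h1 h2 => by
    have hw := norm_pow_le_one_of hz 2
    have h3 := hDTb i _ t hw h1 h2
    have ht0 : 0 ≤ t := htq0.le.trans h2
    simp only [hT]
    rw [norm_mul, norm_mul]
    calc _ ≤ 1 * (‖DT i (schur r s (z ^ 2))‖ * ‖G (schur r s (z ^ 2))‖) := by
          gcongr; exact norm_pow_le_one_of hz m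
      _ ≤ 1 * ((KA + ‖A e‖ * Kq * tq⁻¹) * ((i + 1) * t ^ i) * KG) := by
          gcongr; exact hKG _ hw
      _ = _ := by ring
  -- the regular part
  have hTdiff : ∀ m i, DifferentiableOn ℂ (T m i) (Metric.ball 0 1) := fun m i z hz => by
    have hz' : ‖z‖ < 1 := by simpa using hz
    have hw := norm_sq_lt_one hz'
    have h1 := differentiableAt_schur_sq (r := r) (s := s) h hz'
    have hye : schur r s (z ^ 2) ≠ e := fun h0 => by
      have := norm_schur_lt_one hr hs h hw
      rw [h0, he] at this
      exact lt_irrefl _ this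
    have d1 : DifferentiableAt ℂ (dslope A e) (schur r s (z ^ 2)) :=
      (differentiableAt_dslope_of_ne hye).2 (dA _ (hys _))
    have d2 : DifferentiableAt ℂ (dslope q e) (schur r s (z ^ 2)) :=
      (differentiableAt_dslope_of_ne hye).2 (dq _ (hys1 _ hw.le))
    have d3 := dq _ (hys1 _ hw.le)
    have d4 := dG _ (hne' _ hw.le)
    have d5 : DifferentiableAt ℂ (fun y => DT i y * G y) (schur r s (z ^ 2)) := by
      simp only [hDT]; fun_prop
    exact (DifferentiableAt.mul (by fun_prop)
      (DifferentiableAt.comp (g := fun y => DT i y * G y) z d5 h1)).differentiableWithinAt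
  have hTcont : ∀ m i z, ‖z‖ = 1 → ContinuousAt (T m i) z := fun m i z hz => by
    have hw : ‖z ^ 2‖ ≤ 1 := norm_pow_le_one_of hz.le 2
    have h1 := continuousAt_schur_sq (r := r) (s := s) h hz
    have d1 := cDA _ hw
    have d2 := cDq _ hw
    have d3 := (dq _ (hys1 _ hw)).continuousAt
    have d4 := (dG _ (hne' _ hw)).continuousAt
    have d5 : ContinuousAt (fun y => DT i y * G y) (schur r s (z ^ 2)) := by
      simp only [hDT]; fun_prop
    exact ContinuousAt.mul (by fun_prop) (ContinuousAt.comp (g := fun y => DT i y * G y) d5 h1)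
  set KT : ℝ := KG * (KA + ‖A e‖ * Kq * tq⁻¹) with hKT
  have hKT00 : 0 ≤ KT := by positivity
  have hTsplit : ∀ m i, BandSplit s (fun n => coef (1 / 2) n (T m i)) (T m i)
      (KT * (Kd * ((i : ℝ) + 1) ^ (-(3 / 4) : ℝ)) * gapMass s) := fun m i => by
    refine BandSplit.of_gap_bound (K := KT * ((i + 1) * 1 ^ i) * 2) hr hs h (hTdiff m i)
      (fun z hz _ => hTcont m i z hz) ?_ ?_ (by positivity)
    · intro z hz
      have hw := norm_pow_le_one_of hz.le 2
      exact mul_le_mul (hTb m i z 1 hz.le (norm_modeRatio_le_one hr hs h hw) htq1.le)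
        (norm_discRoot_le_two h hw) (norm_nonneg _) (by positivity)
    · intro θ hθ
      have hθ' : s ^ 2 - Real.sin θ ^ 2 ≠ 0 := by linarith
      have hz := norm_circleMap_one θ
      have hw := norm_pow_le_one_of hz.le 2
      have hS : 0 < ‖discRoot r s (circleMap 0 1 θ ^ 2)‖ := norm_pos_iff.2 (discRoot_ne_zero h hθ')
      have hS2 := norm_discRoot_le_two h hw
      have hg := modeRatio_gap hr hs h hz (by rw [circleMap_one_im]; exact hθ)
      set σ := ‖discRoot r s (circleMap 0 1 θ ^ 2)‖ with hσ
      have hmax : max ‖q (schur r s (circleMap 0 1 θ ^ 2))‖ tq ^ 2 * (1 + κ * σ) ≤ 1 := by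
        rcases max_choice ‖q (schur r s (circleMap 0 1 θ ^ 2))‖ tq with hm | hm <;> rw [hm]
        · refine le_trans ?_ hg
          gcongr
          exact min_le_left _ _
        · exact hκq σ hS.le hS2
      have h1 := hTb m i _ _ hz.le (le_max_left _ tq) (le_max_right _ tq)
      have h2 := (hdecay σ _ i hS hS2 (le_max_of_le_right htq0.le) hmax).1
      have h3 := norm_discRoot_rpow_le h hθ'
      rw [← hσ] at h3
      calc _ ≤ _ := h1
        _ ≤ KT * (Kd * (((i : ℝ) + 1) ^ (-(3 / 4) : ℝ) * σ ^ (-(7 / 4) : ℝ))) := by gcongr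
        _ ≤ KT * (Kd * (((i : ℝ) + 1) ^ (-(3 / 4) : ℝ) * gapWeight s θ)) := by gcongr
        _ = _ := by ring
  -- the pole
  obtain ⟨KW, hKW0, hKW⟩ : ∃ KW : ℝ, 0 ≤ KW ∧ ∀ θ ∈ bandSet s, ‖(circleMap 0 1 θ ^ 2 - w₀)⁻¹‖ ≤ KW := by
    set S : Set ℂ := {w | w ∈ Metric.closedBall (0 : ℂ) 1 ∧ ‖1 + s * schur r s w‖ ∈ Set.Iic r} with hS
    have hcs : ContinuousOn (fun w => ‖1 + s * schur r s w‖) (Metric.closedBall 0 1) := by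
      intro w hw
      have := continuousAt_schur h (w := w) (by simpa using hw)
      exact ContinuousAt.continuousWithinAt (by fun_prop)
    have hcomp : IsCompact S := by
      have := hcs.preimage_isClosed_of_isClosed Metric.isClosed_closedBall (isClosed_Iic (a := r))
      exact (isCompact_closedBall (0 : ℂ) 1).of_isClosed_subset this fun w hw => hw.1
    have hcont : ContinuousOn (fun w => (w - w₀)⁻¹) S := by
      refine ContinuousOn.inv₀ (by fun_prop) fun w hw h0 => ?_
      have hw1 : ‖w‖ ≤ 1 := by simpa using hw.1
      have h1 := hGW w hw1
      rw [h0, mul_zero] at h1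
      have h2 : schur r s w = e := by linear_combination -h1
      have h3 : ‖1 + s * schur r s w‖ ≤ r := hw.2
      rw [h2] at h3
      linarith
    obtain ⟨K, hK⟩ := hcomp.exists_bound_of_continuousOn hcont
    refine ⟨max K 0, le_max_right _ _, fun θ hθ => (hK _ ⟨?_, ?_⟩).trans (le_max_left _ _)⟩
    · simp
    · exact (schur_band hr hs h (norm_circleMap_one θ) (by rw [circleMap_one_im]; exact hθ)).2.le
  have hP := fun m => BandSplit.pole hw₀ hKW0 hKW m
  -- The geometric decay of the residue is weakened to the common rate by using `hdecay` at `σ = 2`.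
  obtain ⟨Kp, hKp0, hKp⟩ : ∃ Kp : ℝ, 0 ≤ Kp ∧ ∀ i : ℕ, tq ^ i ≤ Kp * ((i : ℝ) + 1) ^ (-(3 / 4) : ℝ) := by
    refine ⟨2 * Kd * (2 : ℝ) ^ (-(7 / 4) : ℝ), by positivity, fun i => ?_⟩
    have := (hdecay 2 tq i two_pos le_rfl htq0.le (hκq 2 two_pos.le le_rfl)).2
    have h2 : tq ^ i = 2 * (2⁻¹ * tq ^ i) := by ring
    rw [h2]
    calc _ ≤ 2 * _ := mul_le_mul_of_nonneg_left this two_pos.le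
      _ = _ := by ring
  refine ⟨KT * Kd * gapMass s + ‖A e‖ * Kp * (1 + KW * (2 * Real.pi)), fun m i => ?_⟩
  have hsum := (hTsplit m i).add ((hP m).const_mul (A e * q e ^ i))
  have hpi := Real.pi_pos
  refine (hsum.mono ?_).congr ?_ ?_
  · rw [norm_mul, norm_pow, htq]
    have := hKp i
    calc _ ≤ KT * (Kd * ((i : ℝ) + 1) ^ (-(3 / 4) : ℝ)) * gapMass s +
          ‖A e‖ * (Kp * ((i : ℝ) + 1) ^ (-(3 / 4) : ℝ)) * (1 + KW * (2 * Real.pi)) := by gcongr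
      _ = _ := by ring
  · intro n
    have hpd : DifferentiableOn ℂ (fun z : ℂ => z ^ m * (z ^ 2 - w₀)⁻¹) (Metric.ball 0 1) := by
      intro z hz
      have hz' : ‖z‖ < 1 := by simpa using hz
      have hne : z ^ 2 - w₀ ≠ 0 := fun h0 => by
        have := norm_sq_lt_one hz'
        rw [sub_eq_zero.1 h0, hw₀] at this
        exact lt_irrefl _ this
      exact (DifferentiableAt.mul (by fun_prop)
        ((by fun_prop : DifferentiableAt ℂ (fun z : ℂ => z ^ 2 - w₀) z).inv hne)).differentiableWithinAt
    rw [← coef_const_mul, ← coef_add (by norm_num) (by norm_num) (hTdiff m i) (hpd.const_mul _)]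
    refine coef_congr (by norm_num) (by norm_num) fun z hz => (hdecomp m i z hz.le fun h0 => ?_).symm
    have := norm_schur_lt_one hr hs h (norm_sq_lt_one hz)
    rw [h0, he] at this
    exact lt_irrefl _ this
  · intro θ hθ
    have hz := norm_circleMap_one θ
    refine (hdecomp m i _ hz.le fun h0 => ?_).symm
    have := (schur_band hr hs h hz (by rw [circleMap_one_im]; exact hθ)).1
    rw [h0, he] at this
    exact lt_irrefl _ this

end

section
variable {r s p : ℝ}

/-- The generating functions split into quasi-periodic, gap and band contributions. -/
theorem bandSplit_amp (hr : 0 < r) (hs : 0 < s) (h : r ^ 2 + s ^ 2 = 1) (hp : |p| < 1)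
    (Q : Polynomial ℂ) : ∃ K : ℝ, ∀ m i : ℕ,
      BandSplit s (fun n => coef (1 / 2) n (amp r s p Q m i)) (amp r s p Q m i)
        (K * ((i : ℝ) + 1) ^ (-(3 / 4) : ℝ)) := by
  rcases le_or_gt s p with hsp | hsp
  · exact bandSplit_amp_of_le hr hs h hp hsp Q
  have hp2 : 0 < 1 - p ^ 2 := by nlinarith [abs_lt.1 hp]
  set c : ℝ := √(1 - p ^ 2) with hc
  have hc0 : 0 < c := Real.sqrt_pos.2 hp2
  have hc2 : c ^ 2 = 1 - p ^ 2 := Real.sq_sqrt hp2.le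
  -- The two roots of `resDen p`. Their real part `-p` exceeds `-s`, so each is a bound state
  -- covered by `bandSplit_ampPole`, and partial fractions separate them.
  set e₁ : ℂ := (-p : ℝ) + c * Complex.I with he₁
  set e₂ : ℂ := (-p : ℝ) + (-c : ℝ) * Complex.I with he₂
  have hn : ∀ c : ℝ, c ^ 2 = 1 - p ^ 2 → ‖((-p : ℝ) : ℂ) + c * Complex.I‖ = 1 := fun c hc => by
    have : ‖((-p : ℝ) : ℂ) + c * Complex.I‖ ^ 2 = 1 := by
      rw [← Complex.normSq_eq_norm_sq, Complex.normSq_add_mul_I, hc]; ring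
    exact (pow_eq_one_iff_of_nonneg (norm_nonneg _) two_ne_zero).1 this
  have hn₁ : ‖e₁‖ = 1 := hn c hc2
  have hn₂ : ‖e₂‖ = 1 := hn (-c) (by rw [neg_sq, hc2])
  have hr₁ : 0 < s + e₁.re := by simp [he₁]; linarith
  have hr₂ : 0 < s + e₂.re := by simp [he₂]; linarith
  obtain ⟨K₁, hK₁⟩ := bandSplit_ampPole hr hs h hn₁ hr₁ Q
  obtain ⟨K₂, hK₂⟩ := bandSplit_ampPole hr hs h hn₂ hr₂ Q
  have hne : e₁ - e₂ ≠ 0 := by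
    have : e₁ - e₂ = 2 * c * Complex.I := by rw [he₁, he₂]; push_cast; ring
    rw [this]
    exact mul_ne_zero (mul_ne_zero two_ne_zero (by exact_mod_cast hc0.ne')) Complex.I_ne_zero
  set a : ℂ := (e₁ - e₂)⁻¹ with ha
  have hamp : ∀ m i z, ‖schur r s (z ^ 2)‖ < 1 → amp r s p Q m i z =
      a * ampPole r s e₁ Q m i z + -a * ampPole r s e₂ Q m i z := fun m i z hy => by
    have h1 : schur r s (z ^ 2) - e₁ ≠ 0 := fun h0 => by
      rw [sub_eq_zero.1 h0, hn₁] at hy; exact lt_irrefl _ hy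
    have h2 : schur r s (z ^ 2) - e₂ ≠ 0 := fun h0 => by
      rw [sub_eq_zero.1 h0, hn₂] at hy; exact lt_irrefl _ hy
    have h3 : resDen p (schur r s (z ^ 2)) = (schur r s (z ^ 2) - e₁) * (schur r s (z ^ 2) - e₂) := by
      have hc2' : (c : ℂ) ^ 2 = 1 - p ^ 2 := by exact_mod_cast hc2
      rw [resDen, he₁, he₂]; push_cast
      linear_combination (-c ^ 2) * Complex.I_sq * (-1) - hc2'
    have h4 : (resDen p (schur r s (z ^ 2)))⁻¹ =
        a * ((schur r s (z ^ 2) - e₁)⁻¹ - (schur r s (z ^ 2) - e₂)⁻¹) := by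
      rw [h3, ha]
      field_simp
      ring
    rw [amp, ampPole, ampPole, ← modeRatio, div_eq_mul_inv, h4]
    ring
  refine ⟨‖a‖ * K₁ + ‖-a‖ * K₂, fun m i => ?_⟩
  have hd : ∀ e : ℂ, ‖e‖ = 1 → DifferentiableOn ℂ (ampPole r s e Q m i) (Metric.ball 0 1) := by
    intro e he z hz
    have hz' : ‖z‖ < 1 := by simpa using hz
    have hw := norm_sq_lt_one hz'
    have h1 := differentiableAt_schur_sq (r := r) (s := s) h hz'
    have h2 := one_add_schur_ne hr hs h hw.le
    have h3 : schur r s (z ^ 2) - e ≠ 0 := fun h0 => by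
      have := norm_schur_lt_one hr hs h hw
      rw [sub_eq_zero.1 h0, he] at this; exact lt_irrefl _ this
    have h4 : DifferentiableAt ℂ (fun z => Q.eval (schur r s (z ^ 2))) z :=
      DifferentiableAt.comp (g := fun y => Q.eval y) z Q.differentiable.differentiableAt h1
    have h6 : DifferentiableAt ℂ (fun z => modeRatio r s (schur r s (z ^ 2))) z :=
      DifferentiableAt.div (by fun_prop) (by fun_prop) h2
    have h7 : DifferentiableAt ℂ (fun z => (schur r s (z ^ 2) - e)⁻¹) z := (h1.sub_const e).inv h3
    exact (DifferentiableAt.mul (by fun_prop) ((h6.pow i).mul (h4.mul h7))).differentiableWithinAt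
  refine ((((hK₁ m i).const_mul a).add ((hK₂ m i).const_mul (-a))).mono (le_of_eq ?_)).congr ?_ ?_
  · ring
  · intro n
    rw [← coef_const_mul, ← coef_const_mul, ← coef_add (by norm_num) (by norm_num)
      ((hd _ hn₁).const_mul _) ((hd _ hn₂).const_mul _)]
    exact coef_congr (by norm_num) (by norm_num) fun z hz =>
      (hamp m i z (norm_schur_lt_one hr hs h (norm_sq_lt_one hz))).symm
  · intro θ hθ
    exact (hamp m i _ (schur_band hr hs h (norm_circleMap_one θ)
      (by rw [circleMap_one_im]; exact hθ)).1).symm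

end

/-! ### Dispersion relation and the change from quasi-energy to momentum. -/

/-- The momenta off the band edges. -/
def momenta : Set ℝ := Set.Ioo (-Real.pi) 0 ∪ Set.Ioo 0 Real.pi

theorem isOpen_momenta : IsOpen momenta := isOpen_Ioo.union isOpen_Ioo

theorem ae_mem_momenta : ∀ᵐ k : ℝ, k ∈ Set.Ioc (-Real.pi) Real.pi → k ∈ momenta := by
  have : ({0, Real.pi} : Set ℝ).Countable := Set.Countable.insert _ (Set.countable_singleton _)
  filter_upwards [this.ae_notMem volume] with k hk h
  simp only [Set.mem_insert_iff, Set.mem_singleton_iff, not_or] at hk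
  rcases lt_or_gt_of_ne hk.1 with h1 | h1
  · exact Or.inl ⟨h.1, h1⟩
  · exact Or.inr ⟨h1, lt_of_le_of_ne h.2 hk.2⟩

/-- The dispersion relation `cos ϑ = r cos k`. -/
def phase (r k : ℝ) : ℝ := if 0 < k then Real.arccos (r * Real.cos k) else -Real.arccos (r * Real.cos k)

/-- The group velocity. -/
def velocity (r k : ℝ) : ℝ := r * |Real.sin k| / √(1 - (r * Real.cos k) ^ 2)

section
variable {r s : ℝ}

theorem mul_cos_sq_lt (hs : 0 < s) (h : r ^ 2 + s ^ 2 = 1) (k : ℝ) : (r * Real.cos k) ^ 2 < 1 := by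
  rw [mul_pow]
  nlinarith [Real.cos_sq_le_one k, sq_nonneg r, sq_nonneg (Real.cos k)]

theorem abs_mul_cos_lt (hs : 0 < s) (h : r ^ 2 + s ^ 2 = 1) (k : ℝ) : |r * Real.cos k| < 1 :=
  (sq_lt_one_iff_abs_lt_one _).1 (mul_cos_sq_lt hs h k)

theorem cos_phase (hs : 0 < s) (h : r ^ 2 + s ^ 2 = 1) (k : ℝ) :
    Real.cos (phase r k) = r * Real.cos k := by
  have := abs_lt.1 (abs_mul_cos_lt hs h k)
  unfold phase
  split_ifs
  · exact Real.cos_arccos this.1.le this.2.le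
  · rw [Real.cos_neg]; exact Real.cos_arccos this.1.le this.2.le

theorem phase_of_pos {k : ℝ} (hk : 0 < k) : phase r k = Real.arccos (r * Real.cos k) := if_pos hk

theorem phase_of_neg {k : ℝ} (hk : k < 0) : phase r k = -Real.arccos (r * Real.cos k) :=
  if_neg hk.not_gt

theorem phase_neg {k : ℝ} (hk : k ≠ 0) : phase r (-k) = -phase r k := by
  rcases lt_or_gt_of_ne hk with h | h
  · rw [phase_of_neg h, phase_of_pos (by linarith), Real.cos_neg, neg_neg]
  · rw [phase_of_pos h, phase_of_neg (by linarith), Real.cos_neg]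

theorem arccos_mem (hs : 0 < s) (h : r ^ 2 + s ^ 2 = 1) (k : ℝ) :
    Real.arccos (r * Real.cos k) ∈ Set.Ioo 0 Real.pi := by
  have := abs_lt.1 (abs_mul_cos_lt hs h k)
  refine ⟨Real.arccos_pos.2 this.2, lt_of_le_of_ne (Real.arccos_le_pi _) fun h0 => ?_⟩
  have := Real.arccos_eq_pi.1 h0
  linarith

/-- The sign built into `phase` cancels the sign of `sin k`, so the group velocity is nonnegative on
both halves of the momentum interval. -/
theorem hasDerivAt_phase (hs : 0 < s) (h : r ^ 2 + s ^ 2 = 1) {k : ℝ} (hk : k ∈ momenta) :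
    HasDerivAt (phase r) (velocity r k) k := by
  have hlt := abs_lt.1 (abs_mul_cos_lt hs h k)
  have h1 : HasDerivAt (fun k => Real.arccos (r * Real.cos k))
      (-(1 / √(1 - (r * Real.cos k) ^ 2)) * (r * -Real.sin k)) k :=
    (Real.hasDerivAt_arccos (by linarith) (by linarith)).comp k ((Real.hasDerivAt_cos k).const_mul r)
  rcases hk with hk | hk
  · have h2 : HasDerivAt (phase r) (-(-(1 / √(1 - (r * Real.cos k) ^ 2)) * (r * -Real.sin k))) k := by
      refine h1.neg.congr_of_eventuallyEq ?_
      filter_upwards [Iio_mem_nhds hk.2] with x hx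
      exact phase_of_neg hx
    convert h2 using 1
    rw [velocity, abs_of_neg (Real.sin_neg_of_neg_of_neg_pi_lt hk.2 hk.1)]
    ring
  · have h2 : HasDerivAt (phase r) (-(1 / √(1 - (r * Real.cos k) ^ 2)) * (r * -Real.sin k)) k := by
      refine h1.congr_of_eventuallyEq ?_
      filter_upwards [Ioi_mem_nhds hk.1] with x hx
      exact phase_of_pos hx
    convert h2 using 1
    rw [velocity, abs_of_pos (Real.sin_pos_of_pos_of_lt_pi hk.1 hk.2)]
    ring

theorem velocity_nonneg (hr : 0 < r) (k : ℝ) : 0 ≤ velocity r k := by unfold velocity; positivity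

theorem sin_ne_zero_of_mem_momenta {k : ℝ} (hk : k ∈ momenta) : Real.sin k ≠ 0 := by
  rcases hk with hk | hk
  · exact (Real.sin_neg_of_neg_of_neg_pi_lt hk.2 hk.1).ne
  · exact (Real.sin_pos_of_pos_of_lt_pi hk.1 hk.2).ne'

theorem velocity_pos (hr : 0 < r) (hs : 0 < s) (h : r ^ 2 + s ^ 2 = 1) {k : ℝ} (hk : k ∈ momenta) : 0 < velocity r k := by
  have := mul_cos_sq_lt hs h k
  exact div_pos (mul_pos hr (abs_pos.2 (sin_ne_zero_of_mem_momenta hk)))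
    (Real.sqrt_pos.2 (by linarith))

theorem velocity_lt_one (hs : 0 < s) (h : r ^ 2 + s ^ 2 = 1) (k : ℝ) : velocity r k < 1 := by
  have := mul_cos_sq_lt hs h k
  rw [velocity, div_lt_one (Real.sqrt_pos.2 (by linarith))]
  apply Real.lt_sqrt_of_sq_lt
  rw [mul_pow, sq_abs, mul_pow]
  nlinarith [Real.sin_sq_add_cos_sq k, mul_pos hs hs]

theorem sin_phase_mul (hs : 0 < s) (h : r ^ 2 + s ^ 2 = 1) {k : ℝ} (hk : k ∈ momenta) :
    Real.sin (phase r k) * velocity r k = r * Real.sin k := by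
  have hlt := mul_cos_sq_lt hs h k
  have h0 : √(1 - (r * Real.cos k) ^ 2) ≠ 0 := (Real.sqrt_pos.2 (by linarith)).ne'
  rcases hk with hk | hk
  · rw [phase_of_neg hk.2, Real.sin_neg, Real.sin_arccos, velocity,
      abs_of_neg (Real.sin_neg_of_neg_of_neg_pi_lt hk.2 hk.1), neg_mul, mul_div_cancel₀ _ h0]
    ring
  · rw [phase_of_pos hk.1, Real.sin_arccos, velocity, abs_of_pos (Real.sin_pos_of_pos_of_lt_pi hk.1 hk.2),
      mul_div_cancel₀ _ h0]

theorem phase_injOn (hr : 0 < r) (hs : 0 < s) (h : r ^ 2 + s ^ 2 = 1) : Set.InjOn (phase r) momenta := by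
  intro k hk l hl hkl
  have h1 : Real.cos k = Real.cos l := by
    have := congrArg Real.cos hkl
    rw [cos_phase hs h, cos_phase hs h] at this
    exact mul_left_cancel₀ hr.ne' this
  have hk' := arccos_mem hs h k
  have hl' := arccos_mem hs h l
  rcases hk with hk | hk <;> rcases hl with hl | hl
  · have := Real.injOn_cos (show -k ∈ Set.Icc 0 Real.pi from ⟨by linarith [hk.2], by linarith [hk.1]⟩)
      (show -l ∈ Set.Icc 0 Real.pi from ⟨by linarith [hl.2], by linarith [hl.1]⟩)
      (by rwa [Real.cos_neg, Real.cos_neg])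
    linarith
  · rw [phase_of_neg hk.2, phase_of_pos hl.1] at hkl
    linarith [hk'.1, hl'.1]
  · rw [phase_of_pos hk.1, phase_of_neg hl.2] at hkl
    linarith [hk'.1, hl'.1]
  · exact Real.injOn_cos ⟨hk.1.le, hk.2.le⟩ ⟨hl.1.le, hl.2.le⟩ h1

theorem mem_bandSet_iff (hr : 0 < r) (h : r ^ 2 + s ^ 2 = 1) {θ : ℝ} :
    θ ∈ bandSet s ↔ |Real.cos θ| < r := by
  rw [← abs_of_pos hr, ← sq_lt_sq]
  show s ^ 2 < Real.sin θ ^ 2 ↔ _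
  rw [Real.sin_sq]
  constructor <;> intro h1 <;> linarith

/-- In a band `cos θ / r` lies in `(-1, 1)` and is the cosine of a unique momentum of the same sign
as `θ`; the omitted momenta correspond to band edges. -/
theorem phase_image (hr : 0 < r) (hs : 0 < s) (h : r ^ 2 + s ^ 2 = 1) :
    phase r '' momenta = bandSet s ∩ Set.Ioo (-Real.pi) Real.pi := by
  have hpi := Real.pi_pos
  have hr1 : r < 1 := by nlinarith
  ext θ
  constructor
  · rintro ⟨k, hk, rfl⟩
    refine ⟨?_, ?_⟩
    · rw [mem_bandSet_iff hr h, cos_phase hs h, abs_mul, abs_of_pos hr]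
      have h1 : |Real.cos k| < 1 := by
        rw [← sq_lt_one_iff_abs_lt_one]
        have := Real.sin_sq_add_cos_sq k
        have := pow_pos (abs_pos.2 (sin_ne_zero_of_mem_momenta hk)) 2
        rw [sq_abs] at this
        linarith
      nlinarith
    · have := arccos_mem hs h k
      rcases hk with hk | hk
      · rw [phase_of_neg hk.2]; exact ⟨by linarith [this.2], by linarith [this.1]⟩
      · rw [phase_of_pos hk.1]; exact ⟨by linarith [this.1], by linarith [this.2]⟩
  · rintro ⟨h1, h2⟩
    rw [mem_bandSet_iff hr h] at h1
    have h3 := abs_lt.1 h1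
    have h4 : -1 < Real.cos θ / r := by rw [lt_div_iff₀ hr]; linarith
    have h5 : Real.cos θ / r < 1 := by rw [div_lt_iff₀ hr]; linarith
    have h6 : Real.arccos (Real.cos θ / r) ∈ Set.Ioo 0 Real.pi := by
      refine ⟨Real.arccos_pos.2 h5, lt_of_le_of_ne (Real.arccos_le_pi _) fun h0 => ?_⟩
      have := Real.arccos_eq_pi.1 h0
      linarith
    have h7 : r * Real.cos (Real.arccos (Real.cos θ / r)) = Real.cos θ := by
      rw [Real.cos_arccos h4.le h5.le]; field_simp
    rcases lt_trichotomy θ 0 with h8 | h8 | h8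
    · refine ⟨-Real.arccos (Real.cos θ / r), Or.inl ⟨by linarith [h6.2], by linarith [h6.1]⟩, ?_⟩
      rw [phase_of_neg (by linarith [h6.1]), Real.cos_neg, h7, ← Real.cos_neg θ,
        Real.arccos_cos (by linarith) (by linarith [h2.1])]
      ring
    · rw [h8, Real.cos_zero, abs_one] at h1; linarith
    · refine ⟨Real.arccos (Real.cos θ / r), Or.inr h6, ?_⟩
      rw [phase_of_pos h6.1, h7, Real.arccos_cos h8.le h2.2.le]

theorem integral_momenta (f : ℝ → ℂ) :
    ∫ k in momenta, f k = ∫ k in -Real.pi..Real.pi, f k := by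
  have hpi := Real.pi_pos
  rw [intervalIntegral.integral_of_le (by linarith)]
  apply setIntegral_congr_set
  filter_upwards [ae_mem_momenta] with k hk
  apply propext
  constructor
  · rintro (h | h)
    · exact ⟨h.1, by linarith [h.2]⟩
    · exact ⟨by linarith [h.1], h.2.le⟩
  · exact fun h => hk h

/-- The change of variables from quasi-energy to momentum. -/
theorem integral_band (hr : 0 < r) (hs : 0 < s) (h : r ^ 2 + s ^ 2 = 1) (f : ℝ → ℂ) :
    ∫ θ in -Real.pi..Real.pi, (bandSet s).indicator f θ =
      ∫ k in -Real.pi..Real.pi, velocity r k * f (phase r k) := by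
  have hpi := Real.pi_pos
  have h1 := integral_image_eq_integral_abs_deriv_smul isOpen_momenta.measurableSet
    (fun k hk => (hasDerivAt_phase hs h hk).hasDerivWithinAt) (phase_injOn hr hs h) f
  rw [phase_image hr hs h] at h1
  rw [intervalIntegral.integral_of_le (by linarith), setIntegral_indicator (measurableSet_bandSet s),
    Set.inter_comm, ← integral_momenta]
  have h2 : ∫ θ in bandSet s ∩ Set.Ioc (-Real.pi) Real.pi, f θ =
      ∫ θ in bandSet s ∩ Set.Ioo (-Real.pi) Real.pi, f θ :=
    setIntegral_congr_set ((ae_eq_refl _).inter Ioo_ae_eq_Ioc.symm)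
  rw [h2, h1]
  apply setIntegral_congr_fun isOpen_momenta.measurableSet
  intro k _
  simp only [abs_of_nonneg (velocity_nonneg hr k), Complex.real_smul]

end

/-! ### The band contribution as a wave packet. -/

section
variable {r s p : ℝ}

/-- The root of the quadratic equation of `schur` in terms of the momentum. -/
def bandRoot (r s k : ℝ) : ℂ := (r * (circleMap 0 1 (phase r k) * (circleMap 0 1 k)⁻¹) - 1) / s

/-- The amplitude of the wave packet of momentum `k` emitted by the defect. -/
def packetAmp (r s p : ℝ) (Q : Polynomial ℂ) (e : ℕ) (k : ℝ) : ℂ :=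
  velocity r k * ((circleMap 0 1 (phase r k) * (circleMap 0 1 k)⁻¹) ^ e *
    (Q.eval (bandRoot r s k) / resDen p (bandRoot r s k)))

theorem circleMap_one_mul_inv (x y : ℝ) :
    circleMap 0 1 x * (circleMap 0 1 y)⁻¹ = circleMap 0 1 (x - y) := by
  simp only [circleMap, zero_add, Complex.ofReal_one, one_mul]
  rw [← Complex.exp_neg, ← Complex.exp_add]
  congr 1; push_cast; ring

theorem bandRoot_eq (k : ℝ) :
    bandRoot r s k = (r * circleMap 0 1 (phase r k - k) - 1) / s := by
  rw [bandRoot, circleMap_one_mul_inv]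

theorem sin_phase_sq (hs : 0 < s) (h : r ^ 2 + s ^ 2 = 1) {k : ℝ} (hk : k ∈ momenta) :
    Real.sin (phase r k) ^ 2 * (1 - velocity r k ^ 2) = s ^ 2 := by
  have h1 := sin_phase_mul hs h hk
  have h2 := cos_phase (r := r) hs h k
  have h3 := Real.sin_sq_add_cos_sq (phase r k)
  have h4 := Real.sin_sq_add_cos_sq k
  rw [h2] at h3
  linear_combination h3 - (Real.sin (phase r k) * velocity r k + r * Real.sin k) * h1 - r ^ 2 * h4 - h

/-- Here the momentum enters only through the velocity. It follows that `Re y = -s / (1 + v)` and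
`|y|² = (1 - v) / (1 + v)`, which makes the limit weight rational in `v`. -/
theorem mul_cos_phase_sub (hr : 0 < r) (hs : 0 < s) (h : r ^ 2 + s ^ 2 = 1) {k : ℝ} (hk : k ∈ momenta) :
    r * Real.cos (phase r k - k) = 1 - s ^ 2 / (1 + velocity r k) := by
  have hv := velocity_nonneg hr k
  have h1 := sin_phase_mul hs h hk
  have h2 := cos_phase (r := r) hs h k
  have h3 := Real.sin_sq_add_cos_sq (phase r k)
  rw [← sin_phase_sq hs h hk, Real.cos_sub]
  have h5 : Real.sin (phase r k) ^ 2 * (1 - velocity r k ^ 2) / (1 + velocity r k) =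
      Real.sin (phase r k) ^ 2 * (1 - velocity r k) := by
    field_simp
    ring
  rw [h5]
  linear_combination -Real.sin (phase r k) * h1 - Real.cos (phase r k) * h2 + h3

theorem bandRoot_re (hr : 0 < r) (hs : 0 < s) (h : r ^ 2 + s ^ 2 = 1) {k : ℝ} (hk : k ∈ momenta) :
    (bandRoot r s k).re = -s / (1 + velocity r k) := by
  have hv := velocity_nonneg hr k
  rw [bandRoot_eq, Complex.div_ofReal_re, Complex.sub_re, Complex.re_ofReal_mul, circleMap_one_re,
    mul_cos_phase_sub hr hs h hk, Complex.one_re]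
  field_simp
  ring

theorem norm_bandRoot_sq (hr : 0 < r) (hs : 0 < s) (h : r ^ 2 + s ^ 2 = 1) {k : ℝ} (hk : k ∈ momenta) :
    ‖bandRoot r s k‖ ^ 2 = (1 - velocity r k) / (1 + velocity r k) := by
  have hv := velocity_nonneg hr k
  have h1 : ‖(r : ℂ) * circleMap 0 1 (phase r k - k) - 1‖ ^ 2 =
      r ^ 2 + 1 - 2 * (r * Real.cos (phase r k - k)) := by
    rw [← Complex.normSq_eq_norm_sq, Complex.normSq_apply, Complex.sub_re, Complex.sub_im,
      Complex.re_ofReal_mul, Complex.im_ofReal_mul, circleMap_one_re, circleMap_one_im,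
      Complex.one_re, Complex.one_im]
    linear_combination r ^ 2 * Real.sin_sq_add_cos_sq (phase r k - k)
  rw [bandRoot_eq, norm_div, div_pow, h1, mul_cos_phase_sub hr hs h hk, Complex.norm_real,
    Real.norm_of_nonneg hs.le]
  have : r ^ 2 = 1 - s ^ 2 := by linarith
  rw [this]
  field_simp
  ring

theorem norm_bandRoot_lt_one (hr : 0 < r) (hs : 0 < s) (h : r ^ 2 + s ^ 2 = 1) {k : ℝ}
    (hk : k ∈ momenta) : ‖bandRoot r s k‖ < 1 := by
  have hv := velocity_pos hr hs h hk
  have h1 := norm_bandRoot_sq hr hs h hk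
  have h2 : ‖bandRoot r s k‖ ^ 2 < 1 := by
    rw [h1, div_lt_one (by linarith)]; linarith
  exact (sq_lt_one_iff₀ (norm_nonneg _)).1 h2

/-- `bandRoot` solves the quadratic equation by virtue of the dispersion relation and has modulus
below one, which singles out the Schur root. -/
theorem schur_phase (hr : 0 < r) (hs : 0 < s) (h : r ^ 2 + s ^ 2 = 1) {k : ℝ} (hk : k ∈ momenta) :
    schur r s (circleMap 0 1 (phase r k) ^ 2) = bandRoot r s k := by
  refine eq_schur_of_quad hr hs h (by rw [norm_pow, norm_circleMap_one, one_pow]) ?_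
    (norm_bandRoot_lt_one hr hs h hk)
  have hω : circleMap 0 1 (phase r k) ≠ 0 := circleMap_ne_center one_ne_zero
  have hκ : circleMap 0 1 k ≠ 0 := circleMap_ne_center one_ne_zero
  have hc : ∀ x : ℝ, circleMap 0 1 x + (circleMap 0 1 x)⁻¹ = 2 * Real.cos x := fun x => by
    simp only [circleMap, zero_add, Complex.ofReal_one, one_mul]
    rw [← Complex.exp_neg, Complex.ofReal_cos, Complex.two_cos, neg_mul]
  have h1 : circleMap 0 1 (phase r k) + (circleMap 0 1 (phase r k))⁻¹ =
      r * (circleMap 0 1 k + (circleMap 0 1 k)⁻¹) := by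
    rw [hc, hc, cos_phase hs h]; push_cast; ring
  have hs' : (s : ℂ) ≠ 0 := by exact_mod_cast hs.ne'
  have h' : (r : ℂ) ^ 2 + s ^ 2 = 1 := by exact_mod_cast h
  rw [bandRoot]
  generalize circleMap 0 1 (phase r k) = ω at *
  generalize circleMap 0 1 k = κ at *
  have h2 : ω ^ 2 * κ + κ = r * ω * (κ ^ 2 + 1) := by
    field_simp at h1
    linear_combination h1
  field_simp
  linear_combination (-r * ω) * h2 + (-κ ^ 2 * ω ^ 2) * h'

/-- Hence `(z q)ⁱ` becomes the plane wave `exp(i k x)` at `x = i`. -/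
theorem modeRatio_phase (hr : 0 < r) (hs : 0 < s) (k : ℝ) :
    modeRatio r s (bandRoot r s k) = circleMap 0 1 k * (circleMap 0 1 (phase r k))⁻¹ := by
  have hω : circleMap 0 1 (phase r k) ≠ 0 := circleMap_ne_center one_ne_zero
  have hκ : circleMap 0 1 k ≠ 0 := circleMap_ne_center one_ne_zero
  have hs' : (s : ℂ) ≠ 0 := by exact_mod_cast hs.ne'
  have hr' : (r : ℂ) ≠ 0 := by exact_mod_cast hr.ne'
  rw [modeRatio, bandRoot]
  have : (1 : ℂ) + s * ((r * (circleMap 0 1 (phase r k) * (circleMap 0 1 k)⁻¹) - 1) / s) =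
    r * (circleMap 0 1 (phase r k) * (circleMap 0 1 k)⁻¹) := by field_simp; ring
  rw [this]
  field_simp

/-- The wave packet with momentum profile `F`. -/
def packet (r : ℝ) (F : ℝ → ℂ) (n : ℕ) (m : ℤ) : ℂ :=
  (2 * Real.pi : ℂ)⁻¹ * ∫ k in -Real.pi..Real.pi,
    circleMap 0 1 k ^ m * ((circleMap 0 1 (phase r k) ^ n)⁻¹ * F k)

/-- After the substitution `z^(i + e) qⁱ` is the plane wave at the site `i + e` times `e` spare
phases `exp(i (ϑ - k))`, which `packetAmp` absorbs together with the Jacobian `v`. -/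
theorem bandPart_amp (hr : 0 < r) (hs : 0 < s) (h : r ^ 2 + s ^ 2 = 1) (Q : Polynomial ℂ)
    (n i e : ℕ) :
    bandPart s (amp r s p Q (i + e) i) n = packet r (packetAmp r s p Q e) n ((i + e : ℕ) : ℤ) := by
  rw [bandPart, packet]
  have h1 : ∀ θ, (circleMap 0 1 θ ^ n)⁻¹ * (bandSet s).indicator
      (fun θ => amp r s p Q (i + e) i (circleMap 0 1 θ)) θ = (bandSet s).indicator
      (fun θ => (circleMap 0 1 θ ^ n)⁻¹ * amp r s p Q (i + e) i (circleMap 0 1 θ)) θ := by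
    intro θ
    by_cases hθ : θ ∈ bandSet s <;> simp [hθ]
  simp_rw [h1]
  rw [integral_band hr hs h, ← integral_momenta, ← integral_momenta]
  congr 1
  apply setIntegral_congr_fun isOpen_momenta.measurableSet
  intro k hk
  have hω : circleMap 0 1 (phase r k) ≠ 0 := circleMap_ne_center one_ne_zero
  have hκ : circleMap 0 1 k ≠ 0 := circleMap_ne_center one_ne_zero
  simp only [amp, packetAmp]
  rw [schur_phase hr hs h hk, ← modeRatio, modeRatio_phase hr hs, zpow_natCast, mul_pow, mul_pow,
    pow_add, pow_add, inv_pow, inv_pow]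
  generalize Polynomial.eval (bandRoot r s k) Q / resDen p (bandRoot r s k) = X
  field_simp

theorem norm_resDen_sq (y : ℂ) : ‖resDen p y‖ ^ 2 =
    (1 - ‖y‖ ^ 2) ^ 2 + 4 * y.re ^ 2 + 4 * p * y.re * (1 + ‖y‖ ^ 2) + 4 * p ^ 2 * ‖y‖ ^ 2 := by
  rw [resDen, ← Complex.normSq_eq_norm_sq, ← Complex.normSq_eq_norm_sq, Complex.normSq_apply,
    Complex.normSq_apply]
  simp [pow_two]
  ring

/-- The source of the denominator of the limit weight. -/
theorem norm_resDen_bandRoot_sq (hr : 0 < r) (hs : 0 < s) (h : r ^ 2 + s ^ 2 = 1) {k : ℝ}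
    (hk : k ∈ momenta) : ‖resDen p (bandRoot r s k)‖ ^ 2 =
      4 * ((s - p) ^ 2 + velocity r k ^ 2 * (1 - p ^ 2)) / (1 + velocity r k) ^ 2 := by
  have hv := velocity_nonneg hr k
  rw [norm_resDen_sq, norm_bandRoot_sq hr hs h hk, bandRoot_re hr hs h hk]
  field_simp
  ring

theorem measurable_phase (r : ℝ) : Measurable (phase r) := by
  have h1 : Measurable fun k => Real.arccos (r * Real.cos k) :=
    Real.continuous_arccos.measurable.comp (by fun_prop)
  exact Measurable.ite measurableSet_Ioi h1 h1.neg

theorem measurable_velocity (r : ℝ) : Measurable (velocity r) := by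
  unfold velocity
  exact Measurable.div (by fun_prop) (by fun_prop)

theorem continuous_circleMap_one : Continuous (circleMap 0 1) := continuous_circleMap 0 1

theorem measurable_bandRoot (r s : ℝ) : Measurable (bandRoot r s) := by
  simp_rw [funext fun k => bandRoot_eq (r := r) (s := s) k]
  have : Measurable fun k => circleMap 0 1 (phase r k - k) :=
    continuous_circleMap_one.measurable.comp ((measurable_phase r).sub measurable_id)
  exact ((this.const_mul _).sub_const _).div_const _

theorem measurable_packetAmp (r s p : ℝ) (Q : Polynomial ℂ) (e : ℕ) :
    Measurable (packetAmp r s p Q e) := by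
  unfold packetAmp
  simp_rw [circleMap_one_mul_inv]
  have h1 : Measurable fun k => circleMap 0 1 (phase r k - k) :=
    continuous_circleMap_one.measurable.comp ((measurable_phase r).sub measurable_id)
  have h2 := measurable_bandRoot r s
  have h3 : Measurable fun k => Q.eval (bandRoot r s k) := Q.continuous.measurable.comp h2
  have h4 : Measurable fun k => resDen p (bandRoot r s k) := by
    unfold resDen
    fun_prop
  exact (Complex.measurable_ofReal.comp (measurable_velocity r)).mul ((h1.pow_const e).mul (h3.div h4))

theorem continuousAt_velocity (hs : 0 < s) (h : r ^ 2 + s ^ 2 = 1) (k : ℝ) :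
    ContinuousAt (velocity r) k := by
  have := mul_cos_sq_lt hs h k
  unfold velocity
  exact ContinuousAt.div (by fun_prop) (by fun_prop) (Real.sqrt_pos.2 (by linarith)).ne'

theorem continuousAt_bandRoot (hs : 0 < s) (h : r ^ 2 + s ^ 2 = 1) {k : ℝ} (hk : k ∈ momenta) :
    ContinuousAt (bandRoot r s) k := by
  rw [show bandRoot r s = _ from funext fun k => bandRoot_eq (r := r) (s := s) k]
  have h1 : ContinuousAt (fun k => circleMap 0 1 (phase r k - k)) k :=
    continuous_circleMap_one.continuousAt.comp ((hasDerivAt_phase hs h hk).continuousAt.sub continuousAt_id)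
  exact ((continuousAt_const.mul h1).sub continuousAt_const).div_const _

theorem resDen_bandRoot_ne_zero (hr : 0 < r) (hs : 0 < s) (h : r ^ 2 + s ^ 2 = 1) (hp : |p| < 1) {k : ℝ}
    (hk : k ∈ momenta) : resDen p (bandRoot r s k) ≠ 0 :=
  resDen_ne_zero hp (norm_bandRoot_lt_one hr hs h hk)

theorem continuousAt_packetAmp (hr : 0 < r) (hs : 0 < s) (h : r ^ 2 + s ^ 2 = 1) (hp : |p| < 1)
    (Q : Polynomial ℂ) (e : ℕ) {k : ℝ} (hk : k ∈ momenta) :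
    ContinuousAt (packetAmp r s p Q e) k := by
  unfold packetAmp
  simp_rw [circleMap_one_mul_inv]
  have h1 : ContinuousAt (fun k => circleMap 0 1 (phase r k - k)) k :=
    continuous_circleMap_one.continuousAt.comp ((hasDerivAt_phase hs h hk).continuousAt.sub continuousAt_id)
  have h2 := continuousAt_bandRoot hs h hk
  have h3 : ContinuousAt (fun k => Q.eval (bandRoot r s k)) k :=
    Q.continuous.continuousAt.comp h2
  have h4 : ContinuousAt (fun k => resDen p (bandRoot r s k)) k := by
    unfold resDen
    fun_prop
  exact (Complex.continuous_ofReal.continuousAt.comp (continuousAt_velocity hs h k)).mul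
    ((h1.pow e).mul (h3.div h4 (resDen_bandRoot_ne_zero hr hs h hp hk)))

theorem norm_packetAmp_sq (hr : 0 < r) (hs : 0 < s) (h : r ^ 2 + s ^ 2 = 1)
    (Q : Polynomial ℂ) (e : ℕ) {k : ℝ} (hk : k ∈ momenta) :
    ‖packetAmp r s p Q e k‖ ^ 2 = velocity r k ^ 2 * (1 + velocity r k) ^ 2 *
      ‖Q.eval (bandRoot r s k)‖ ^ 2 / (4 * ((s - p) ^ 2 + velocity r k ^ 2 * (1 - p ^ 2))) := by
  have hv := velocity_nonneg hr k
  rw [packetAmp, norm_mul, norm_mul, norm_pow, norm_mul, norm_inv, norm_circleMap_one,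
    norm_circleMap_one, norm_div, mul_pow, mul_pow, div_pow, norm_resDen_bandRoot_sq hr hs h hk,
    Complex.norm_real, Real.norm_of_nonneg hv]
  simp only [inv_one, mul_one, one_pow, one_mul]
  rw [div_div_eq_mul_div]
  ring

/-- The Jacobian contributes `v²`, which cancels the possible zero of the denominator at `v = 0`,
even when `p = s`. -/
theorem exists_norm_packetAmp_le (hr : 0 < r) (hs : 0 < s) (h : r ^ 2 + s ^ 2 = 1) (hp : |p| < 1)
    (Q : Polynomial ℂ) (e : ℕ) : ∃ K : ℝ, ∀ k ∈ momenta, ‖packetAmp r s p Q e k‖ ≤ K := by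
  have hp2 : 0 < 1 - p ^ 2 := by nlinarith [abs_lt.1 hp]
  obtain ⟨M, hM⟩ := (isCompact_closedBall (0 : ℂ) 1).exists_bound_of_continuousOn
    Q.continuous.continuousOn
  refine ⟨√(M ^ 2 / (1 - p ^ 2)), fun k hk => Real.le_sqrt_of_sq_le ?_⟩
  have hv := velocity_pos hr hs h hk
  have hv1 := velocity_lt_one hs h k
  have hQ := hM (bandRoot r s k) (by simpa using (norm_bandRoot_lt_one hr hs h hk).le)
  have hQ2 : ‖Q.eval (bandRoot r s k)‖ ^ 2 ≤ M ^ 2 := by gcongr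
  rw [norm_packetAmp_sq hr hs h Q e hk]
  set v := velocity r k
  rw [div_le_div_iff₀ (by positivity) hp2]
  have h1 : (1 + v) ^ 2 ≤ 4 := by nlinarith
  calc v ^ 2 * (1 + v) ^ 2 * ‖Q.eval (bandRoot r s k)‖ ^ 2 * (1 - p ^ 2)
      ≤ v ^ 2 * 4 * M ^ 2 * (1 - p ^ 2) := by gcongr
    _ = M ^ 2 * (4 * (v ^ 2 * (1 - p ^ 2))) := by ring
    _ ≤ M ^ 2 * (4 * ((s - p) ^ 2 + v ^ 2 * (1 - p ^ 2))) := by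
        gcongr; nlinarith [sq_nonneg (s - p)]

end

/-! ### Parseval's identity and the characteristic functions of packets. -/

section
local instance : Fact (0 < 2 * Real.pi) := ⟨Real.two_pi_pos⟩

open AddCircle in
theorem fourier_two_pi (m : ℤ) (k : ℝ) : fourier m (k : AddCircle (2 * Real.pi)) = circleMap 0 1 k ^ m := by
  have hpi : (Real.pi : ℂ) ≠ 0 := by exact_mod_cast Real.pi_ne_zero
  rw [fourier_coe_apply]
  simp only [circleMap, zero_add, Complex.ofReal_one, one_mul]
  rw [← Complex.exp_int_mul]
  congr 1
  push_cast
  field_simp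

/-- The extension of a function on `(-π, π]` to the circle. -/
def circleLift (G : ℝ → ℂ) : AddCircle (2 * Real.pi) → ℂ := AddCircle.liftIoc (2 * Real.pi) (-Real.pi) G

theorem circleLift_coe (G : ℝ → ℂ) {k : ℝ} (hk : k ∈ Set.Ioc (-Real.pi) Real.pi) :
    circleLift G k = G k :=
  AddCircle.liftIoc_coe_apply ⟨hk.1, by linarith [hk.2]⟩

theorem measurable_circleLift {G : ℝ → ℂ} (hG : Measurable G) : Measurable (circleLift G) :=
  (hG.comp measurable_subtype_coe).comp
    (AddCircle.measurableEquivIoc (2 * Real.pi) (-Real.pi)).measurable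

theorem norm_circleLift_le {G : ℝ → ℂ} {K : ℝ} (hK : ∀ k ∈ Set.Ioc (-Real.pi) Real.pi, ‖G k‖ ≤ K)
    (t : AddCircle (2 * Real.pi)) : ‖circleLift G t‖ ≤ K := by
  refine hK _ ?_
  have := (AddCircle.equivIoc (2 * Real.pi) (-Real.pi) t).2
  exact ⟨this.1, by linarith [this.2]⟩

theorem integral_haar_two_pi (f : AddCircle (2 * Real.pi) → ℂ) :
    ∫ t, f t ∂AddCircle.haarAddCircle =
      (2 * Real.pi : ℂ)⁻¹ * ∫ k in -Real.pi..Real.pi, f (k : AddCircle (2 * Real.pi)) := by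
  rw [AddCircle.integral_haarAddCircle, ← AddCircle.intervalIntegral_preimage _ (-Real.pi)]
  rw [show -Real.pi + 2 * Real.pi = Real.pi by ring, Complex.real_smul]
  push_cast
  rfl

theorem fourierCoeff_two_pi (f : AddCircle (2 * Real.pi) → ℂ) (m : ℤ) :
    fourierCoeff f (-m) = (2 * Real.pi : ℂ)⁻¹ * ∫ k in -Real.pi..Real.pi,
      circleMap 0 1 k ^ m * f (k : AddCircle (2 * Real.pi)) := by
  rw [fourierCoeff, integral_haar_two_pi]
  simp_rw [neg_neg, fourier_two_pi, smul_eq_mul]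

theorem fourierCoeff_sub (f : AddCircle (2 * Real.pi) → ℂ) (τ : ℝ) (m : ℤ) :
    fourierCoeff (fun t => f (t - (τ : AddCircle (2 * Real.pi)))) (-m) =
      circleMap 0 1 τ ^ m * fourierCoeff f (-m) := by
  rw [fourierCoeff, fourierCoeff, ← fourier_two_pi, ← integral_const_mul,
    ← integral_add_right_eq_self _ (τ : AddCircle (2 * Real.pi))]
  congr 1
  ext t
  rw [add_sub_cancel_right, neg_neg, smul_eq_mul, smul_eq_mul, ← mul_assoc]
  congr 1
  rw [fourier_apply, fourier_apply, fourier_apply, smul_add, AddCircle.toCircle_add, Circle.coe_mul,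
    mul_comm]

theorem inner_fourierBasis_toLp {u : AddCircle (2 * Real.pi) → ℂ}
    (hu : MemLp u 2 AddCircle.haarAddCircle) (i : ℤ) :
    inner ℂ (fourierBasis i) hu.toLp = fourierCoeff u i := by
  have h1 := fourierBasis_repr hu.toLp i
  rw [HilbertBasis.repr_apply_apply] at h1
  rw [h1]
  exact congrFun (fourierCoeff_congr_ae hu.coeFn_toLp) i

open ComplexConjugate in
theorem inner_toLp_two_pi {g f : AddCircle (2 * Real.pi) → ℂ}
    (hg : MemLp g 2 AddCircle.haarAddCircle) (hf : MemLp f 2 AddCircle.haarAddCircle) :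
    inner ℂ hg.toLp hf.toLp = (2 * Real.pi : ℂ)⁻¹ * ∫ k in -Real.pi..Real.pi,
      conj (g (k : AddCircle (2 * Real.pi))) * f (k : AddCircle (2 * Real.pi)) := by
  rw [L2.inner_def, ← integral_haar_two_pi (fun t => conj (g t) * f t)]
  apply integral_congr_ae
  filter_upwards [hg.coeFn_toLp, hf.coeFn_toLp] with t h4 h5
  rw [h4, h5, RCLike.inner_apply, mul_comm]

open ComplexConjugate in
/-- Parseval's identity for a function and its translate. -/
theorem hasSum_translate {G : ℝ → ℂ} {K : ℝ} (hG : Measurable G)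
    (hK : ∀ k ∈ Set.Ioc (-Real.pi) Real.pi, ‖G k‖ ≤ K) (τ : ℝ) :
    HasSum (fun m : ℤ => circleMap 0 1 τ ^ m * ((‖(2 * Real.pi : ℂ)⁻¹ *
        ∫ k in -Real.pi..Real.pi, circleMap 0 1 k ^ m * G k‖ ^ 2 : ℝ) : ℂ))
      ((2 * Real.pi : ℂ)⁻¹ * ∫ k in -Real.pi..Real.pi,
        conj (G k) * circleLift G ((k - τ : ℝ) : AddCircle (2 * Real.pi))) := by
  set g := circleLift G
  set f : AddCircle (2 * Real.pi) → ℂ := fun t => g (t - (τ : AddCircle (2 * Real.pi)))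
  have hgm : Measurable g := measurable_circleLift hG
  have hfm : Measurable f := hgm.comp (measurable_id.sub_const _)
  have hg : MemLp g 2 AddCircle.haarAddCircle :=
    MemLp.of_bound hgm.aestronglyMeasurable K (ae_of_all _ (norm_circleLift_le hK))
  have hf : MemLp f 2 AddCircle.haarAddCircle :=
    MemLp.of_bound hfm.aestronglyMeasurable K (ae_of_all _ fun t => norm_circleLift_le hK _)
  have h1 := HilbertBasis.hasSum_inner_mul_inner fourierBasis hg.toLp hf.toLp
  have h3 : inner ℂ hg.toLp hf.toLp = (2 * Real.pi : ℂ)⁻¹ * ∫ k in -Real.pi..Real.pi,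
        conj (G k) * circleLift G ((k - τ : ℝ) : AddCircle (2 * Real.pi)) := by
    rw [inner_toLp_two_pi hg hf]
    congr 1
    have hpi := Real.pi_pos
    rw [intervalIntegral.integral_of_le (by linarith), intervalIntegral.integral_of_le (by linarith)]
    apply setIntegral_congr_fun measurableSet_Ioc
    intro k hk
    simp only [g, f, circleLift_coe G hk]
    rw [AddCircle.coe_sub]
  rw [h3] at h1
  -- Fourier coefficients use `exp(-i k m)` and packets use `exp(i k m)`.
  have h4 := (Equiv.neg ℤ).hasSum_iff.2 h1
  refine h4.congr_fun fun m => ?_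
  simp only [Function.comp_apply, Equiv.neg_apply]
  rw [inner_fourierBasis_toLp, ← inner_conj_symm, inner_fourierBasis_toLp, fourierCoeff_sub, mul_left_comm]
  have h5 : fourierCoeff g (-m) = (2 * Real.pi : ℂ)⁻¹ *
        ∫ k in -Real.pi..Real.pi, circleMap 0 1 k ^ m * G k := by
    rw [fourierCoeff_two_pi]
    congr 1
    have hpi := Real.pi_pos
    rw [intervalIntegral.integral_of_le (by linarith), intervalIntegral.integral_of_le (by linarith)]
    apply setIntegral_congr_fun measurableSet_Ioc
    intro k hk
    simp only [g, circleLift_coe G hk]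
  rw [h5, mul_comm (conj _), Complex.mul_conj, Complex.normSq_eq_norm_sq]

/-- A momentum profile: bounded, measurable and continuous at the interior momenta. -/
structure IsProfile (F : ℝ → ℂ) (K : ℝ) : Prop where
  meas : Measurable F
  bound : ∀ k ∈ Set.Ioc (-Real.pi) Real.pi, ‖F k‖ ≤ K
  cont : ∀ k ∈ momenta, ContinuousAt F k

variable {r s K : ℝ} {F : ℝ → ℂ}

theorem circleMap_zpow (x : ℝ) (m : ℤ) : circleMap 0 1 x ^ m = circleMap 0 1 (m * x) := by
  simp only [circleMap, zero_add, Complex.ofReal_one, one_mul]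
  rw [← Complex.exp_int_mul]
  congr 1; push_cast; ring

theorem circleMap_pow_inv (x : ℝ) (n : ℕ) : (circleMap 0 1 x ^ n)⁻¹ = circleMap 0 1 (-(n * x)) := by
  rw [← zpow_natCast, ← zpow_neg, circleMap_zpow]
  push_cast; congr 1; ring

open ComplexConjugate in
theorem conj_circleMap_one (x : ℝ) : conj (circleMap 0 1 x) = circleMap 0 1 (-x) := by
  simp only [circleMap, zero_add, Complex.ofReal_one, one_mul]
  rw [← Complex.exp_conj]
  simp

theorem circleMap_one_mul (x y : ℝ) :
    circleMap 0 1 x * circleMap 0 1 y = circleMap 0 1 (x + y) := by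
  simp only [circleMap, zero_add, Complex.ofReal_one, one_mul]
  rw [← Complex.exp_add]
  congr 1; push_cast; ring

theorem mem_Ioc_of_mem_momenta {k : ℝ} (h : k ∈ momenta) : k ∈ Set.Ioc (-Real.pi) Real.pi := by
  have hpi := Real.pi_pos
  rcases h with h | h
  · exact ⟨h.1, by linarith [h.2]⟩
  · exact ⟨by linarith [h.1], h.2.le⟩

open ComplexConjugate in
/-- The characteristic functions of the rescaled wave packet converge. -/
theorem packet_charFun (hs : 0 < s) (h : r ^ 2 + s ^ 2 = 1) (hF : IsProfile F K) (ξ : ℝ) :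
    Tendsto (fun n : ℕ => ∑' m : ℤ, circleMap 0 1 (ξ * (m / n)) * ((‖packet r F n m‖ ^ 2 : ℝ) : ℂ))
      atTop (𝓝 ((2 * Real.pi : ℂ)⁻¹ * ∫ k in -Real.pi..Real.pi,
        circleMap 0 1 (ξ * velocity r k) * ((‖F k‖ ^ 2 : ℝ) : ℂ))) := by
  have hpi := Real.pi_pos
  set G : ℕ → ℝ → ℂ := fun n k => (circleMap 0 1 (phase r k) ^ n)⁻¹ * F k
  have hGm : ∀ n, Measurable (G n) := fun n =>
    ((continuous_circleMap_one.measurable.comp (measurable_phase r)).pow_const n).inv.mul hF.meas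
  have hGK : ∀ n, ∀ k ∈ Set.Ioc (-Real.pi) Real.pi, ‖G n k‖ ≤ K := fun n k hk => by
    simp only [G]
    rw [norm_mul, norm_inv, norm_pow, norm_circleMap_one, one_pow, inv_one, one_mul]
    exact hF.bound k hk
  -- The factor `exp(i ξ m / n)` in position space is a translation by `ξ / n` in momentum space, so
  -- Parseval pairs the profile with its own translate.
  have h1 : ∀ n : ℕ, ∑' m : ℤ, circleMap 0 1 (ξ * (m / n)) * ((‖packet r F n m‖ ^ 2 : ℝ) : ℂ) =
      (2 * Real.pi : ℂ)⁻¹ * ∫ k in -Real.pi..Real.pi,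
        conj (G n k) * circleLift (G n) ((k - ξ / n : ℝ) : AddCircle (2 * Real.pi)) := fun n => by
    rw [← (hasSum_translate (hGm n) (hGK n) (ξ / n)).tsum_eq]
    congr 1
    ext m
    rw [circleMap_zpow]
    congr 2
    ring
  simp_rw [h1]
  refine Tendsto.const_mul _ ?_
  refine intervalIntegral.tendsto_integral_filter_of_dominated_convergence (fun _ => K * K) ?_ ?_ ?_ ?_
  · refine Eventually.of_forall fun n => Measurable.aestronglyMeasurable ?_
    refine Measurable.mul (Complex.continuous_conj.measurable.comp (hGm n)) ?_
    exact (measurable_circleLift (hGm n)).comp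
      (AddCircle.measurable_mk'.comp (measurable_id.sub_const _))
  · refine Eventually.of_forall fun n => ae_of_all _ fun k hk => ?_
    rw [Set.uIoc_of_le (by linarith)] at hk
    rw [norm_mul, RCLike.norm_conj]
    have := hGK n k hk
    have h0 : 0 ≤ K := (norm_nonneg _).trans this
    exact mul_le_mul this (norm_circleLift_le (hGK n) _) (norm_nonneg _) h0
  · exact intervalIntegrable_const
  · filter_upwards [ae_mem_momenta] with k hk hk'
    rw [Set.uIoc_of_le (by linarith)] at hk'
    replace hk := hk hk'
    have h2 : Tendsto (fun n : ℕ => k - ξ / n) atTop (𝓝 k) := by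
      have := (tendsto_const_div_atTop_nhds_zero_nat ξ).const_sub k
      rwa [sub_zero] at this
    have h3 : Tendsto (fun n : ℕ => F (k - ξ / n)) atTop (𝓝 (F k)) := (hF.cont k hk).tendsto.comp h2
    -- The phases accumulated over `n` steps at two momenta `ξ / n` apart differ in the limit by `ξ`
    -- times the group velocity.
    have h4 : Tendsto (fun n : ℕ => (n : ℝ) * (phase r k - phase r (k - ξ / n))) atTop
        (𝓝 (ξ * velocity r k)) := by
      have hd := hasDerivAt_phase hs h hk
      have := hd.tendsto_slope_zero
      rcases eq_or_ne ξ 0 with rfl | hξ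
      · simp
      have h5 : Tendsto (fun n : ℕ => -ξ / (n : ℝ)) atTop (𝓝[≠] 0) := by
        refine tendsto_nhdsWithin_iff.2 ⟨tendsto_const_div_atTop_nhds_zero_nat _, ?_⟩
        filter_upwards [eventually_gt_atTop 0] with n hn
        exact div_ne_zero (neg_ne_zero.2 hξ) (by positivity)
      refine ((this.comp h5).const_mul ξ).congr' ?_
      filter_upwards [eventually_gt_atTop 0] with n hn
      have hn' : (n : ℝ) ≠ 0 := by positivity
      simp only [Function.comp_apply, smul_eq_mul]
      rw [show k + -ξ / n = k - ξ / n by ring]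
      field_simp
      ring
    have h5 : Tendsto (fun n : ℕ => circleMap 0 1 ((n : ℝ) * (phase r k - phase r (k - ξ / n))) *
        (conj (F k) * F (k - ξ / n))) atTop
        (𝓝 (circleMap 0 1 (ξ * velocity r k) * (conj (F k) * F k))) :=
      ((continuous_circleMap_one.tendsto _).comp h4).mul (h3.const_mul _)
    have h6 : conj (F k) * F k = ((‖F k‖ ^ 2 : ℝ) : ℂ) := by
      rw [mul_comm, Complex.mul_conj, Complex.normSq_eq_norm_sq]
    rw [← h6]
    refine h5.congr' ?_
    filter_upwards [h2.eventually (isOpen_momenta.mem_nhds hk)] with n hn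
    rw [circleLift_coe _ (mem_Ioc_of_mem_momenta hn)]
    simp only [G]
    rw [circleMap_pow_inv, circleMap_pow_inv, map_mul, conj_circleMap_one, neg_neg, mul_mul_mul_comm,
      circleMap_one_mul]
    congr 2
    ring

end

/-! ### Weak convergence of rescaled packets. -/

/-- Lévy's convergence theorem for finite measures of equal mass. -/
theorem tendsto_integral_of_tendsto_charFun {μ : ℕ → Measure ℝ} {ν : Measure ℝ} {M : ENNReal}
    (hM : M ≠ ⊤) (hμ : ∀ n, μ n Set.univ = M) (hν : ν Set.univ = M)
    (h : ∀ t, Tendsto (fun n => charFun (μ n) t) atTop (𝓝 (charFun ν t)))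
    (g : BoundedContinuousFunction ℝ ℝ) :
    Tendsto (fun n => ∫ x, g x ∂μ n) atTop (𝓝 (∫ x, g x ∂ν)) := by
  have hM1 : 1 + M ≠ 0 := by simp
  have hM2 : 1 + M ≠ ⊤ := by simp [hM]
  -- Adding a unit point mass before normalizing also covers `M = 0`, which occurs when a packet
  -- vanishes.
  have hprob : ∀ ρ : Measure ℝ, ρ Set.univ = M →
      IsProbabilityMeasure ((1 + M)⁻¹ • (Measure.dirac 0 + ρ)) := fun ρ hρ => ⟨by
    rw [Measure.smul_apply, Measure.add_apply, measure_univ, hρ, smul_eq_mul,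
      ENNReal.inv_mul_cancel hM1 hM2]⟩
  have hfin : ∀ ρ : Measure ℝ, ρ Set.univ = M → IsFiniteMeasure ρ := fun ρ hρ =>
    ⟨by rw [hρ]; exact hM.lt_top⟩
  have hint : ∀ (E : Type) [NormedAddCommGroup E] [NormedSpace ℝ E] [CompleteSpace E]
      (ρ : Measure ℝ) (_ : ρ Set.univ = M) (f : BoundedContinuousFunction ℝ ℝ) (G : ℝ → E),
      Continuous G → (∀ x, ‖G x‖ ≤ 1 + ‖f‖) →
      ∫ x, G x ∂((1 + M)⁻¹ • (Measure.dirac 0 + ρ)) =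
        ((1 + M)⁻¹).toReal • (G 0 + ∫ x, G x ∂ρ) := by
    intro E _ _ _ ρ hρ f G hG hb
    have := hfin ρ hρ
    rw [integral_smul_measure, integral_add_measure, integral_dirac]
    · exact Integrable.of_bound hG.aestronglyMeasurable _ (ae_of_all _ hb)
    · exact Integrable.of_bound hG.aestronglyMeasurable _ (ae_of_all _ hb)
  set P : ℕ → ProbabilityMeasure ℝ := fun n => ⟨_, hprob (μ n) (hμ n)⟩
  set P' : ProbabilityMeasure ℝ := ⟨_, hprob ν hν⟩
  have hchar : ∀ (ρ : Measure ℝ) (_ : ρ Set.univ = M) (t : ℝ),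
      charFun ((1 + M)⁻¹ • (Measure.dirac 0 + ρ)) t =
        ((1 + M)⁻¹).toReal • (1 + charFun ρ t) := by
    intro ρ hρ t
    rw [charFun_apply_real, charFun_apply_real, hint ℂ ρ hρ 0 _ (by fun_prop)]
    · simp
    · intro x
      rw [← Complex.ofReal_mul, Complex.norm_exp_ofReal_mul_I]; simp
  have h1 : Tendsto P atTop (𝓝 P') := by
    refine ProbabilityMeasure.tendsto_of_tendsto_charFun fun t => ?_
    simp only [P, P', ProbabilityMeasure.coe_mk]
    rw [hchar ν hν]
    simp_rw [fun n => hchar (μ n) (hμ n) t]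
    exact ((h t).const_add _).const_smul _
  have h2 := ProbabilityMeasure.tendsto_iff_forall_integral_tendsto.1 h1 g
  have hg : ∀ x, ‖g x‖ ≤ 1 + ‖g‖ := fun x => by linarith [g.norm_coe_le_norm x]
  simp only [P, P', ProbabilityMeasure.coe_mk] at h2
  rw [hint ℝ ν hν g g g.continuous hg] at h2
  simp_rw [fun n => hint ℝ (μ n) (hμ n) g g g.continuous hg] at h2
  have h3 : ((1 + M)⁻¹).toReal ≠ 0 := by
    rw [Ne, ENNReal.toReal_eq_zero_iff]
    simp [hM]
  have h4 := (h2.const_smul ((1 + M)⁻¹).toReal⁻¹).sub_const (g 0)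
  simpa only [smul_smul, inv_mul_cancel₀ h3, one_smul, add_sub_cancel_left] using h4

/-- The measure with mass `w m` at `u m`. -/
def latticeMeasure (w : ℤ → ℝ) (u : ℤ → ℝ) : Measure ℝ :=
  Measure.sum fun m => ENNReal.ofReal (w m) • Measure.dirac (u m)

theorem latticeMeasure_univ {w : ℤ → ℝ} (hw : ∀ m, 0 ≤ w m) {W : ℝ} (hW : HasSum w W) (u : ℤ → ℝ) :
    latticeMeasure w u Set.univ = ENNReal.ofReal W := by
  rw [latticeMeasure, Measure.sum_apply _ MeasurableSet.univ]
  simp only [Measure.smul_apply, measure_univ, smul_eq_mul, mul_one]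
  rw [← ENNReal.ofReal_tsum_of_nonneg hw hW.summable, hW.tsum_eq]

theorem integral_latticeMeasure {E : Type*} [NormedAddCommGroup E] [NormedSpace ℝ E] [CompleteSpace E]
    {w : ℤ → ℝ} (hw : ∀ m, 0 ≤ w m) {W : ℝ} (hW : HasSum w W) (u : ℤ → ℝ) {f : ℝ → E}
    (hf : Continuous f) {K : ℝ} (hK : ∀ x, ‖f x‖ ≤ K) :
    ∫ x, f x ∂latticeMeasure w u = ∑' m, w m • f (u m) := by
  have : IsFiniteMeasure (latticeMeasure w u) :=
    ⟨by rw [latticeMeasure_univ hw hW]; exact ENNReal.ofReal_lt_top⟩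
  have hi : Integrable f (latticeMeasure w u) :=
    Integrable.of_bound hf.aestronglyMeasurable K (ae_of_all _ hK)
  rw [latticeMeasure, integral_sum_measure hi]
  congr 1
  ext m
  rw [integral_smul_measure, integral_dirac, ENNReal.toReal_ofReal (hw m)]

section
variable {r s K : ℝ} {F : ℝ → ℂ}

/-- The law of the velocity of a wave packet with momentum profile `F`. -/
def velocityLaw (r : ℝ) (F : ℝ → ℂ) : Measure ℝ :=
  ((volume.restrict (Set.Ioc (-Real.pi) Real.pi)).withDensity
    fun k => ENNReal.ofReal ((2 * Real.pi)⁻¹ * ‖F k‖ ^ 2)).map (velocity r)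

theorem integral_velocityLaw {E : Type*} [NormedAddCommGroup E] [NormedSpace ℝ E]
    [CompleteSpace E] (hF : IsProfile F K) {f : ℝ → E} (hf : Continuous f) :
    ∫ x, f x ∂velocityLaw r F =
      (2 * Real.pi)⁻¹ • ∫ k in -Real.pi..Real.pi, ‖F k‖ ^ 2 • f (velocity r k) := by
  have hm : Measurable fun k => ((2 * Real.pi)⁻¹ * ‖F k‖ ^ 2).toNNReal :=
    ((hF.meas.norm.pow_const 2).const_mul _).real_toNNReal
  have hpi := Real.pi_pos
  rw [velocityLaw, integral_map (measurable_velocity r).aemeasurable hf.aestronglyMeasurable]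
  simp only [ENNReal.ofReal]
  rw [integral_withDensity_eq_integral_smul hm, intervalIntegral.integral_of_le (by linarith),
    ← integral_smul]
  congr 1
  ext k
  rw [NNReal.smul_def, Real.coe_toNNReal _ (by positivity), smul_smul]

theorem IsProfile.intervalIntegrable (hF : IsProfile F K) :
    IntervalIntegrable (fun k => ‖F k‖ ^ 2) volume (-Real.pi) Real.pi := by
  have hpi := Real.pi_pos
  refine (intervalIntegrable_const (c := K ^ 2)).mono_fun'
    (hF.meas.norm.pow_const 2).aestronglyMeasurable ?_
  rw [Set.uIoc_of_le (by linarith)]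
  filter_upwards [ae_restrict_mem measurableSet_Ioc] with k hk
  rw [norm_pow, norm_norm]
  have := hF.bound k hk
  gcongr

/-- The total weight of a wave packet with momentum profile `F`. -/
def packetMass (F : ℝ → ℂ) : ℝ := (2 * Real.pi)⁻¹ * ∫ k in -Real.pi..Real.pi, ‖F k‖ ^ 2

theorem velocityLaw_univ (hF : IsProfile F K) :
    velocityLaw r F Set.univ = ENNReal.ofReal (packetMass F) := by
  have hpi := Real.pi_pos
  rw [velocityLaw, Measure.map_apply (measurable_velocity r) MeasurableSet.univ, Set.preimage_univ,
    withDensity_apply _ MeasurableSet.univ, Measure.restrict_univ, packetMass,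
    intervalIntegral.integral_of_le (by linarith), ← integral_const_mul,
    ofReal_integral_eq_lintegral_ofReal]
  · exact ((intervalIntegrable_iff_integrableOn_Ioc_of_le (by linarith)).1
      hF.intervalIntegrable).const_mul _
  · exact ae_of_all _ fun k => by positivity

theorem hasSum_packet (hF : IsProfile F K) (n : ℕ) :
    HasSum (fun m : ℤ => ‖packet r F n m‖ ^ 2) (packetMass F) := by
  have hGm : Measurable fun k => (circleMap 0 1 (phase r k) ^ n)⁻¹ * F k :=
    ((continuous_circleMap_one.measurable.comp (measurable_phase r)).pow_const n).inv.mul hF.meas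
  have hn : ∀ k, ‖(circleMap 0 1 (phase r k) ^ n)⁻¹ * F k‖ = ‖F k‖ := fun k => by
    rw [norm_mul, norm_inv, norm_pow, norm_circleMap_one, one_pow, inv_one, one_mul]
  have h1 := hasSum_translate hGm (fun k hk => by rw [hn]; exact hF.bound k hk) 0
  have hpi := Real.pi_pos
  rw [← Complex.hasSum_ofReal]
  have h2 : ((2 * Real.pi : ℂ)⁻¹ * ∫ k in -Real.pi..Real.pi,
      (starRingEnd ℂ) ((circleMap 0 1 (phase r k) ^ n)⁻¹ * F k) *
        circleLift (fun k => (circleMap 0 1 (phase r k) ^ n)⁻¹ * F k)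
          ((k - 0 : ℝ) : AddCircle (2 * Real.pi))) = (packetMass F : ℂ) := by
    rw [packetMass]
    push_cast
    rw [← intervalIntegral.integral_ofReal]
    congr 1
    rw [intervalIntegral.integral_of_le (by linarith), intervalIntegral.integral_of_le (by linarith)]
    apply setIntegral_congr_fun measurableSet_Ioc
    intro k hk
    simp only [sub_zero]
    rw [circleLift_coe _ hk, mul_comm, Complex.mul_conj, Complex.normSq_eq_norm_sq, hn]
  rw [h2] at h1
  refine h1.congr_fun fun m => ?_
  rw [circleMap_zpow, mul_zero, show circleMap 0 1 0 = 1 by simp [circleMap], one_mul]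
  rfl

theorem norm_circleMap_mul_le (x y : ℝ) : ‖circleMap 0 1 (x * y)‖ ≤ 1 := (norm_circleMap_one _).le

theorem continuous_circleMap_mul (t : ℝ) : Continuous fun x => circleMap 0 1 (t * x) :=
  continuous_circleMap_one.comp (continuous_const.mul continuous_id)

/-- The rescaled position of a wave packet converges weakly to its velocity. -/
theorem tendsto_tsum_packet (hs : 0 < s) (h : r ^ 2 + s ^ 2 = 1) (hF : IsProfile F K)
    (g : BoundedContinuousFunction ℝ ℝ) :
    Tendsto (fun n : ℕ => ∑' m : ℤ, ‖packet r F n m‖ ^ 2 * g (m / n)) atTop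
      (𝓝 ((2 * Real.pi)⁻¹ * ∫ k in -Real.pi..Real.pi, ‖F k‖ ^ 2 * g (velocity r k))) := by
  have hw : ∀ n (m : ℤ), 0 ≤ ‖packet r F n m‖ ^ 2 := fun n m => by positivity
  have h1 := tendsto_integral_of_tendsto_charFun
    (μ := fun n : ℕ => latticeMeasure (fun m : ℤ => ‖packet r F n m‖ ^ 2) fun m => m / n)
    (ν := velocityLaw r F) ENNReal.ofReal_ne_top
    (fun n => latticeMeasure_univ (hw n) (hasSum_packet hF n) _) (velocityLaw_univ hF) ?_ g
  · rw [integral_velocityLaw hF g.continuous] at h1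
    simp_rw [fun n : ℕ => integral_latticeMeasure (hw n) (hasSum_packet (r := r) hF n)
      (fun m : ℤ => (m : ℝ) / n) g.continuous g.norm_coe_le_norm] at h1
    exact h1
  · intro t
    have h2 : ∀ x : ℝ, Complex.exp (t * x * Complex.I) = circleMap 0 1 (t * x) := fun x => by
      simp [circleMap]
    simp_rw [charFun_apply_real, h2]
    rw [integral_velocityLaw hF (continuous_circleMap_mul t)]
    simp_rw [fun n : ℕ => integral_latticeMeasure (hw n) (hasSum_packet (r := r) hF n)
      (fun m : ℤ => (m : ℝ) / n) (continuous_circleMap_mul t) (norm_circleMap_mul_le t)]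
    have h3 := packet_charFun hs h hF t
    simp_rw [Complex.real_smul, mul_comm _ (circleMap 0 1 _)]
    convert h3 using 3
    push_cast
    rfl

/-- A continuous cutoff of the negative half-line. -/
def leftCutoff (δ : ℝ) : BoundedContinuousFunction ℝ ℝ :=
  BoundedContinuousFunction.ofNormedAddCommGroup (fun x => max 0 (min 1 (1 - x / δ))) (by fun_prop) 1
    fun x => by
      rw [Real.norm_of_nonneg (le_max_left _ _)]
      exact max_le zero_le_one (min_le_left _ _)

theorem leftCutoff_nonneg (δ x : ℝ) : 0 ≤ leftCutoff δ x := le_max_left _ _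

theorem leftCutoff_le_one (δ x : ℝ) : leftCutoff δ x ≤ 1 := max_le zero_le_one (min_le_left _ _)

theorem leftCutoff_of_nonpos {δ x : ℝ} (hδ : 0 < δ) (hx : x ≤ 0) : leftCutoff δ x = 1 := by
  have : x / δ ≤ 0 := div_nonpos_of_nonpos_of_nonneg hx hδ.le
  show max 0 (min 1 (1 - x / δ)) = 1
  rw [min_eq_left (by linarith), max_eq_right zero_le_one]

theorem leftCutoff_of_le {δ x : ℝ} (hδ : 0 < δ) (hx : δ ≤ x) : leftCutoff δ x = 0 := by
  have : 1 ≤ x / δ := (one_le_div hδ).2 hx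
  exact max_eq_left ((min_le_right _ _).trans (by linarith))

theorem summable_packet_mul (hF : IsProfile F K) (n : ℕ) {c : ℤ → ℝ} {M : ℝ} (hc : ∀ m, |c m| ≤ M) :
    Summable fun m : ℤ => ‖packet r F n m‖ ^ 2 * c m := by
  refine Summable.of_norm_bounded (g := fun m => ‖packet r F n m‖ ^ 2 * M)
    ((hasSum_packet hF n).summable.mul_right M) fun m => ?_
  rw [norm_mul, Real.norm_of_nonneg (by positivity : (0 : ℝ) ≤ ‖packet r F n m‖ ^ 2), Real.norm_eq_abs]
  gcongr
  exact hc m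

/-- Asymptotically no weight of a wave packet is on the negative half-line. -/
theorem tendsto_tsum_packet_nonpos (hr : 0 < r) (hs : 0 < s) (h : r ^ 2 + s ^ 2 = 1)
    (hF : IsProfile F K) :
    Tendsto (fun n : ℕ => ∑' m : ℤ, ‖packet r F n m‖ ^ 2 * (if m ≤ 0 then 1 else 0)) atTop (𝓝 0) := by
  have hpi := Real.pi_pos
  -- The velocity is positive for almost every momentum, so the limit law has little mass near and
  -- below zero; a continuous cutoff transfers this to finite `n`.
  have h1 : Tendsto (fun j : ℕ => (2 * Real.pi)⁻¹ * ∫ k in -Real.pi..Real.pi,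
      ‖F k‖ ^ 2 * leftCutoff (1 / (j + 1)) (velocity r k)) atTop (𝓝 ((2 * Real.pi)⁻¹ *
        ∫ k in -Real.pi..Real.pi, 0)) := by
    refine Tendsto.const_mul _ ?_
    refine intervalIntegral.tendsto_integral_filter_of_dominated_convergence (fun k => ‖F k‖ ^ 2)
      ?_ ?_ hF.intervalIntegrable ?_
    · exact Eventually.of_forall fun j => ((hF.meas.norm.pow_const 2).mul
        ((leftCutoff _).continuous.measurable.comp (measurable_velocity r))).aestronglyMeasurable
    · refine Eventually.of_forall fun j => ae_of_all _ fun k _ => ?_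
      rw [norm_mul, norm_pow, norm_norm, Real.norm_of_nonneg (leftCutoff_nonneg _ _)]
      exact mul_le_of_le_one_right (by positivity) (leftCutoff_le_one _ _)
    · filter_upwards [ae_mem_momenta] with k hk hk'
      rw [Set.uIoc_of_le (by linarith)] at hk'
      have hv := velocity_pos hr hs h (hk hk')
      refine tendsto_const_nhds.congr' ?_
      filter_upwards [(tendsto_one_div_add_atTop_nhds_zero_nat (𝕜 := ℝ)).eventually_lt_const hv]
        with j hj
      rw [leftCutoff_of_le (by positivity) hj.le, mul_zero]
  rw [intervalIntegral.integral_zero, mul_zero] at h1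
  rw [Metric.tendsto_atTop]
  intro ε hε
  obtain ⟨j, hj⟩ := (h1.eventually_lt_const hε).exists
  have h2 := tendsto_tsum_packet hs h hF (leftCutoff (1 / (j + 1)))
  obtain ⟨N, hN⟩ := eventually_atTop.1 (h2.eventually_lt_const hj)
  refine ⟨N, fun n hn => ?_⟩
  have h3 : 0 ≤ ∑' m : ℤ, ‖packet r F n m‖ ^ 2 * (if m ≤ 0 then (1 : ℝ) else 0) :=
    tsum_nonneg fun m => by split_ifs <;> positivity
  rw [Real.dist_eq, sub_zero, abs_of_nonneg h3]
  refine lt_of_le_of_lt ?_ (hN n hn)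
  refine Summable.tsum_le_tsum (fun m => ?_)
    (summable_packet_mul hF n (M := 1) fun m => by split_ifs <;> simp)
    (summable_packet_mul hF n (M := 1) fun m => by
      rw [abs_of_nonneg (leftCutoff_nonneg _ _)]; exact leftCutoff_le_one _ _)
  split_ifs with hm
  · rw [leftCutoff_of_nonpos (by positivity)
      (div_nonpos_of_nonpos_of_nonneg (by exact_mod_cast hm) (by positivity))]
  · rw [mul_zero]
    exact mul_nonneg (by positivity) (leftCutoff_nonneg _ _)

/-- The rescaled position of the right-moving part of a wave packet. -/
theorem tendsto_tsum_packet_succ (hr : 0 < r) (hs : 0 < s) (h : r ^ 2 + s ^ 2 = 1)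
    (hF : IsProfile F K) (g : BoundedContinuousFunction ℝ ℝ) :
    Tendsto (fun n : ℕ => ∑' k : ℕ, ‖packet r F n ((k + 1 : ℕ) : ℤ)‖ ^ 2 * g (((k + 1 : ℕ) : ℝ) / n))
      atTop (𝓝 ((2 * Real.pi)⁻¹ * ∫ k in -Real.pi..Real.pi, ‖F k‖ ^ 2 * g (velocity r k))) := by
  have hg : ∀ x, |g x| ≤ ‖g‖ := g.norm_coe_le_norm
  have h1 : Tendsto (fun n : ℕ => ∑' m : ℤ, ‖packet r F n m‖ ^ 2 * (if m ≤ 0 then g (m / n) else 0))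
      atTop (𝓝 0) := by
    have h0 := (tendsto_tsum_packet_nonpos hr hs h hF).mul_const ‖g‖
    rw [zero_mul] at h0
    refine squeeze_zero_norm (fun n => ?_) h0
    rw [← tsum_mul_right]
    refine tsum_of_norm_bounded
      ((summable_packet_mul hF n (M := 1) fun m => by split_ifs <;> simp).mul_right ‖g‖).hasSum
      fun m => ?_
    split_ifs
    · rw [norm_mul, norm_pow, norm_norm, mul_one, Real.norm_eq_abs]
      gcongr
      exact hg _
    · simp
  have h2 := (tendsto_tsum_packet hs h hF g).sub h1
  rw [sub_zero] at h2
  refine h2.congr fun n => ?_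
  rw [← Summable.tsum_sub (summable_packet_mul hF n fun m => hg _)
    (summable_packet_mul hF n (M := ‖g‖) fun m => by
      split_ifs
      · exact hg _
      · simp)]
  have hinj : Function.Injective fun k : ℕ => ((k + 1 : ℕ) : ℤ) := fun a b hab => by
    have : (a + 1 : ℕ) = b + 1 := Nat.cast_injective hab
    omega
  rw [← hinj.tsum_eq]
  · refine tsum_congr fun k => ?_
    rw [if_neg (by push_cast; omega), mul_zero, sub_zero]
    simp
  · intro m hm
    by_contra hm'
    apply hm
    have : m ≤ 0 := by
      by_contra h0
      exact hm' ⟨(m - 1).toNat, by push_cast; omega⟩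
    simp only [if_pos this, sub_self]

end

/-! ### Ballistic weights plus a localized part. -/

/-- Distributions `p n` on `ℤ` that differ from ballistic weights `q n` by a localized part. -/
structure BallisticSplit (p q : ℕ → ℤ → ℝ) (e : ℤ → ℝ) (M : ℝ) : Prop where
  hasSum : ∀ n, HasSum (p n) 1
  nonneg : ∀ n x, 0 ≤ q n x
  summable : ∀ n, Summable (q n)
  tsum_le : ∀ n, ∑' x, q n x ≤ M
  err_nonneg : ∀ x, 0 ≤ e x
  err_summable : Summable e
  close : ∀ η : ℝ, 0 < η → ∀ n x, |p n x - q n x| ≤ η * q n x + (1 + η⁻¹) * e x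

namespace BallisticSplit

variable {p q : ℕ → ℤ → ℝ} {e : ℤ → ℝ} {M : ℝ}

theorem bound_nonneg (hS : BallisticSplit p q e M) : 0 ≤ M :=
  (tsum_nonneg (hS.nonneg 0)).trans (hS.tsum_le 0)

/-- The discrepancy is dominated by a summable function up to a small multiple of `q`, and `g (x /
n) → g 0` at each fixed site, so a test function sees it only through `g 0`. -/
theorem tendsto_tsum_sub (hS : BallisticSplit p q e M) (g : BoundedContinuousFunction ℝ ℝ) :
    Tendsto (fun n : ℕ => ∑' x : ℤ, (g (x / n) - g 0) * (p n x - q n x)) atTop (𝓝 0) := by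
  have hM := hS.bound_nonneg
  have hg : ∀ x, |g x - g 0| ≤ 2 * ‖g‖ := fun x => by
    have h1 := g.norm_coe_le_norm x
    have h2 := g.norm_coe_le_norm 0
    have := norm_sub_le (g x) (g 0)
    rw [Real.norm_eq_abs] at this
    linarith
  have hD : Tendsto (fun n : ℕ => ∑' x : ℤ, |g (x / n) - g 0| * e x) atTop (𝓝 0) := by
    have := tendsto_tsum_of_dominated_convergence (𝓕 := atTop)
      (f := fun (n : ℕ) (x : ℤ) => |g (x / n) - g 0| * e x) (g := fun _ : ℤ => (0 : ℝ))
      (bound := fun x => 2 * ‖g‖ * e x) (hS.err_summable.mul_left _) (fun x => ?_)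
      (Eventually.of_forall fun n x => ?_)
    · simpa using this
    · have h1 : Tendsto (fun n : ℕ => g ((x : ℝ) / n)) atTop (𝓝 (g 0)) :=
        (g.continuous.tendsto 0).comp (tendsto_const_div_atTop_nhds_zero_nat _)
      have h2 := ((h1.sub_const (g 0)).abs).mul_const (e x)
      simpa using h2
    · rw [norm_mul, Real.norm_of_nonneg (abs_nonneg _), Real.norm_of_nonneg (hS.err_nonneg x)]
      exact mul_le_mul_of_nonneg_right (hg _) (hS.err_nonneg x)
  have hsD : ∀ n : ℕ, Summable fun x : ℤ => |g (x / n) - g 0| * e x := fun n =>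
    Summable.of_nonneg_of_le (fun x => mul_nonneg (abs_nonneg _) (hS.err_nonneg x))
      (fun x => mul_le_mul_of_nonneg_right (hg _) (hS.err_nonneg x)) (hS.err_summable.mul_left _)
  have key : ∀ η : ℝ, 0 < η → ∀ n : ℕ, ‖∑' x : ℤ, (g (x / n) - g 0) * (p n x - q n x)‖ ≤
      2 * ‖g‖ * η * M + (1 + η⁻¹) * ∑' x : ℤ, |g (x / n) - g 0| * e x := by
    intro η hη n
    refine (tsum_of_norm_bounded (((hS.summable n).mul_left (2 * ‖g‖ * η)).hasSum.add
      ((hsD n).mul_left (1 + η⁻¹)).hasSum) fun x => ?_).trans ?_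
    · rw [norm_mul, Real.norm_eq_abs, Real.norm_eq_abs]
      have h1 := hS.close η hη n x
      have h2 := mul_le_mul_of_nonneg_left h1 (abs_nonneg (g (x / n) - g 0))
      have h3 := mul_le_mul_of_nonneg_right (hg (x / n)) (mul_nonneg hη.le (hS.nonneg n x))
      linarith
    · rw [tsum_mul_left, tsum_mul_left]
      have := hS.tsum_le n
      gcongr
  rw [Metric.tendsto_atTop]
  intro ε hε
  set η : ℝ := ε / (4 * (‖g‖ + 1) * (M + 1)) with hη'
  have hη : 0 < η := by positivity
  have h1 : 2 * ‖g‖ * η * M ≤ ε / 2 := by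
    have h2 : η * (4 * (‖g‖ + 1) * (M + 1)) = ε := by rw [hη']; field_simp
    have h3 : 0 ≤ η * ‖g‖ := by positivity
    nlinarith [mul_nonneg hη.le hM]
  have h2 := hD.const_mul (1 + η⁻¹)
  rw [mul_zero] at h2
  obtain ⟨N, hN⟩ := eventually_atTop.1 (h2.eventually_lt_const (half_pos hε))
  refine ⟨N, fun n hn => ?_⟩
  rw [dist_zero_right]
  linarith [key η hη n, hN n hn]

/-- The weak limit of the rescaled distributions. -/
theorem tendsto_tsum_mul (hS : BallisticSplit p q e M) (g : BoundedContinuousFunction ℝ ℝ) {I J : ℝ}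
    (hI : Tendsto (fun n => ∑' x, q n x) atTop (𝓝 I))
    (hJ : Tendsto (fun n : ℕ => ∑' x : ℤ, q n x * g (x / n)) atTop (𝓝 J)) :
    Tendsto (fun n : ℕ => ∑' x : ℤ, p n x * g (x / n)) atTop (𝓝 ((1 - I) * g 0 + J)) := by
  have h1 := ((hS.tendsto_tsum_sub g).add ((hI.const_sub 1).mul_const (g 0))).add hJ
  rw [zero_add] at h1
  refine h1.congr fun n => ?_
  have hb : ∀ (f : ℤ → ℝ), Summable f → Summable fun x : ℤ => f x * g (x / n) := fun f hf => by
    refine Summable.of_norm_bounded (g := fun x => ‖f x‖ * ‖g‖) (hf.norm.mul_right _) fun x => ?_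
    rw [norm_mul]
    gcongr
    exact g.norm_coe_le_norm _
  have sp := (hS.hasSum n).summable
  have sq := hS.summable n
  -- The surviving term is `g 0` times the total of `p - q`, and this total tends to `1 - I`.
  have e1 : ∀ x : ℤ, (g (x / n) - g 0) * (p n x - q n x) =
      (p n x * g (x / n) - q n x * g (x / n)) - (p n x * g 0 - q n x * g 0) := fun x => by ring
  simp_rw [e1]
  rw [((hb _ sp).sub (hb _ sq)).tsum_sub ((sp.mul_right _).sub (sq.mul_right _)),
    (hb _ sp).tsum_sub (hb _ sq), (sp.mul_right _).tsum_sub (sq.mul_right _), tsum_mul_right,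
    tsum_mul_right, (hS.hasSum n).tsum_eq]
  ring

/-- The total mass of the time-averaged limit. -/
theorem hasSum_of_cesaro (hS : BallisticSplit p q e M) {I : ℝ}
    (hI : Tendsto (fun n => ∑' x, q n x) atTop (𝓝 I)) (hq : ∀ x, Tendsto (fun n => q n x) atTop (𝓝 0))
    {μ : ℤ → ℝ} (hμ : ∀ x, Tendsto (fun T : ℕ => (T : ℝ)⁻¹ * ∑ n ∈ Finset.range T, p n x) atTop
      (𝓝 (μ x))) : HasSum μ (1 - I) := by
  have hM := hS.bound_nonneg
  have key : ∀ η : ℝ, 0 < η → ∀ S : Finset ℤ, |∑ x ∈ S, μ x - (1 - I)| ≤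
      η * M + (1 + η⁻¹) * ∑' x : {x // x ∉ S}, e x := by
    intro η hη S
    have h1 : ∀ n, |∑ x ∈ S, p n x - (1 - ∑' x, q n x + ∑ x ∈ S, q n x)| ≤
        η * M + (1 + η⁻¹) * ∑' x : {x // x ∉ S}, e x := by
      intro n
      have sp := (hS.hasSum n).summable
      have sq := hS.summable n
      have h2 := (sp.sub sq).sum_add_tsum_subtype_compl S
      rw [sp.tsum_sub sq, (hS.hasSum n).tsum_eq, Finset.sum_sub_distrib] at h2
      -- The mass missing from `S` is the tail of `p - q`, which is controlled uniformly in `n` and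
      -- therefore survives averaging over time.
      have h3 : ∑ x ∈ S, p n x - (1 - ∑' x, q n x + ∑ x ∈ S, q n x) =
          -∑' x : {x // x ∉ S}, (p n x - q n x) := by linarith
      rw [h3, abs_neg]
      have s1 : Summable fun x : {x // x ∉ S} => q n x := sq.subtype _
      have s2 : Summable fun x : {x // x ∉ S} => e x := hS.err_summable.subtype _
      refine (tsum_of_norm_bounded (f := fun x : {x // x ∉ S} => p n x - q n x) ((s1.mul_left η).hasSum.add (s2.mul_left (1 + η⁻¹)).hasSum)
        fun x => hS.close η hη n x).trans ?_
      rw [tsum_mul_left, tsum_mul_left]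
      have h4 : ∑' x : {x // x ∉ S}, q n x ≤ M := by
        have h5 := sq.sum_add_tsum_subtype_compl S
        have := Finset.sum_nonneg fun x (_ : x ∈ S) => hS.nonneg n x
        linarith [hS.tsum_le n]
      gcongr
    have h2 : Tendsto (fun n => 1 - ∑' x, q n x + ∑ x ∈ S, q n x) atTop (𝓝 (1 - I + ∑ x ∈ S, 0)) :=
      (hI.const_sub 1).add (tendsto_finsetSum _ fun x _ => hq x)
    rw [Finset.sum_const_zero, add_zero] at h2
    have h3 := (tendsto_finsetSum S fun x _ => hμ x).sub h2.cesaro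
    refine le_of_tendsto h3.abs ?_
    filter_upwards [eventually_gt_atTop 0] with T hT
    have hT' : (0 : ℝ) < T := by exact_mod_cast hT
    rw [← Finset.mul_sum, Finset.sum_comm, ← mul_sub, ← Finset.sum_sub_distrib, abs_mul,
      abs_of_pos (inv_pos.2 hT'), inv_mul_le_iff₀ hT']
    refine (Finset.abs_sum_le_sum_abs _ _).trans ((Finset.sum_le_sum fun n _ => h1 n).trans ?_)
    rw [Finset.sum_const, Finset.card_range, nsmul_eq_mul]
  refine Metric.tendsto_nhds.2 fun ε hε => ?_
  set η : ℝ := ε / (2 * (M + 1)) with hη'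
  have hη : 0 < η := by positivity
  have h1 : η * M ≤ ε / 2 := by
    have h2 : η * (2 * (M + 1)) = ε := by rw [hη']; field_simp
    nlinarith
  have h2 := (tendsto_tsum_compl_atTop_zero e).const_mul (1 + η⁻¹)
  rw [mul_zero] at h2
  have h3 := h2.eventually_lt_const (half_pos hε)
  simp only [SummationFilter.unconditional_filter]
  filter_upwards [h3] with S hS'
  rw [Real.dist_eq]
  linarith [key η hη S]

end BallisticSplit

/-- Young's inequality on the cross term. The free parameter `η` makes the part proportional to
`|v|²` as small as desired, while the rest stays a constant multiple of `ε²`. -/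
theorem abs_norm_sq_sub_le {u v : ℂ} {ε : ℝ} (h : ‖u - v‖ ≤ ε) {η : ℝ} (hη : 0 < η) :
    |‖u‖ ^ 2 - ‖v‖ ^ 2| ≤ η * ‖v‖ ^ 2 + (1 + η⁻¹) * ε ^ 2 := by
  have h0 : 0 ≤ ε := (norm_nonneg _).trans h
  have h1 : |‖u‖ - ‖v‖| ≤ ε := (abs_norm_sub_norm_le u v).trans h
  have h2 : 2 * ε * ‖v‖ ≤ η * ‖v‖ ^ 2 + η⁻¹ * ε ^ 2 := by
    have h3 : 0 ≤ η * (‖v‖ - η⁻¹ * ε) ^ 2 := by positivity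
    have h4 : η * (‖v‖ - η⁻¹ * ε) ^ 2 = η * ‖v‖ ^ 2 - 2 * ε * ‖v‖ + η⁻¹ * ε ^ 2 := by
      field_simp
      ring
    linarith
  have h3 : ‖u‖ ^ 2 - ‖v‖ ^ 2 = (‖u‖ - ‖v‖) ^ 2 + 2 * (‖u‖ - ‖v‖) * ‖v‖ := by ring
  have h4 : |(‖u‖ - ‖v‖) ^ 2 + 2 * (‖u‖ - ‖v‖) * ‖v‖| ≤ ε ^ 2 + 2 * ε * ‖v‖ := by
    refine (abs_add_le _ _).trans ?_
    rw [abs_mul, abs_mul, abs_of_nonneg (norm_nonneg v), abs_pow, abs_two]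
    gcongr
  rw [h3]
  linarith

/-- The function on `ℤ` with values `u` on the positive and `v` on the negative integers. -/
def twoSided (c : ℝ) (u v : ℕ → ℝ) : ℤ → ℝ
  | Int.ofNat 0 => c
  | Int.ofNat (k + 1) => u k
  | Int.negSucc k => v k

theorem hasSum_twoSided {c : ℝ} {u v : ℕ → ℝ} {a b : ℝ} (hu : HasSum u a) (hv : HasSum v b) :
    HasSum (twoSided c u v) (a + c + b) := by
  refine HasSum.of_add_one_of_neg_add_one (f := twoSided c u v) hu ?_
  refine hv.congr_fun fun k => ?_
  rw [← Int.negSucc_eq]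
  rfl

theorem twoSided_mul (u v : ℕ → ℝ) (f : ℤ → ℝ) (x : ℤ) : twoSided 0 u v x * f x =
    twoSided 0 (fun k => u k * f ((k + 1 : ℕ) : ℤ)) (fun k => v k * f (-((k + 1 : ℕ) : ℤ))) x := by
  match x with
  | Int.ofNat 0 => exact zero_mul _
  | Int.ofNat (k + 1) => rfl
  | Int.negSucc k => rfl

/-! ### The limit theorem for normalized coins. -/

section
variable {r s p : ℝ}

theorem packetAmp_eq_zero {k : ℝ} (hk : Real.sin k = 0) (Q : Polynomial ℂ) (e : ℕ) :
    packetAmp r s p Q e k = 0 := by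
  simp [packetAmp, velocity, hk]

/-- The only momenta of `(-π, π]` outside `momenta` are `0` and `π`; there the velocity, hence the
amplitude, is zero. -/
theorem isProfile_packetAmp (hr : 0 < r) (hs : 0 < s) (h : r ^ 2 + s ^ 2 = 1) (hp : |p| < 1)
    (Q : Polynomial ℂ) (e : ℕ) : ∃ K, IsProfile (packetAmp r s p Q e) K := by
  obtain ⟨K, hK⟩ := exists_norm_packetAmp_le hr hs h hp Q e
  refine ⟨|K|, measurable_packetAmp r s p Q e, fun k hk => ?_,
    fun k hk => continuousAt_packetAmp hr hs h hp Q e hk⟩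
  by_cases h0 : k ∈ momenta
  · exact (hK k h0).trans (le_abs_self K)
  · have : Real.sin k = 0 := by
      rcases lt_trichotomy k 0 with h1 | h1 | h1
      · exact absurd (Or.inl ⟨hk.1, h1⟩) h0
      · rw [h1, Real.sin_zero]
      · rcases hk.2.lt_or_eq with h2 | h2
        · exact absurd (Or.inr ⟨h1, h2⟩) h0
        · rw [h2, Real.sin_pi]
    rw [packetAmp_eq_zero this, norm_zero]
    exact abs_nonneg K

/-- The emitted amplitudes are wave packets up to localized parts. -/
theorem exists_packet_bound (hr : 0 < r) (hs : 0 < s) (h : r ^ 2 + s ^ 2 = 1) (hp : |p| < 1)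
    (Q : Polynomial ℂ) : ∃ K : ℝ, 0 ≤ K ∧ ∀ k i e : ℕ, i + e = k + 1 → k ≤ i →
      AlmostQuasiPeriodic (fun n => coef (1 / 2) n (amp r s p Q (k + 1) i)) ∧
      (∀ n, ‖coef (1 / 2) n (amp r s p Q (k + 1) i) -
        packet r (packetAmp r s p Q e) n ((k + 1 : ℕ) : ℤ)‖ ≤ K * ((k : ℝ) + 1) ^ (-(3 / 4) : ℝ)) ∧
      Tendsto (fun n => packet r (packetAmp r s p Q e) n ((k + 1 : ℕ) : ℤ)) atTop (𝓝 0) := by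
  obtain ⟨K, hK⟩ := bandSplit_amp hr hs h hp Q
  refine ⟨|K|, abs_nonneg K, fun k i e hie hki => ?_⟩
  have h1 : ∀ n, packet r (packetAmp r s p Q e) n ((k + 1 : ℕ) : ℤ) =
      bandPart s (amp r s p Q (k + 1) i) n := fun n => by
    rw [← hie, bandPart_amp hr hs h]
  have h2 := hK (k + 1) i
  refine ⟨h2.quasi, fun n => ?_, ?_⟩
  · rw [h1]
    refine (h2.bound n).trans ?_
    have h3 : ((i : ℝ) + 1) ^ (-(3 / 4) : ℝ) ≤ ((k : ℝ) + 1) ^ (-(3 / 4) : ℝ) := by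
      refine Real.rpow_le_rpow_of_nonpos (by positivity) ?_ (by norm_num)
      have : (k : ℝ) ≤ i := by exact_mod_cast hki
      linarith
    exact (mul_le_mul_of_nonneg_right (le_abs_self K) (by positivity)).trans
      (mul_le_mul_of_nonneg_left h3 (abs_nonneg K))
  · simp_rw [h1]
    simpa [bandPart] using (tendsto_circle_integral_zero _).const_mul ((2 * Real.pi : ℂ)⁻¹)

/-- Probabilities involve squared amplitudes, and here the exponent `3/4 > 1/2` is needed. -/
theorem summable_sq_rpow (K : ℝ) : Summable fun k : ℕ => (K * ((k : ℝ) + 1) ^ (-(3 / 4) : ℝ)) ^ 2 := by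
  have h1 : Summable fun k : ℕ => ((k : ℝ)) ^ (-(3 / 2) : ℝ) :=
    Real.summable_nat_rpow.2 (by norm_num)
  have h2 := ((summable_nat_add_iff 1).2 h1).mul_left (K ^ 2)
  refine h2.congr fun k => ?_
  rw [mul_pow, ← Real.rpow_mul_natCast (by positivity)]
  push_cast
  norm_num

end

section
variable {r s : ℝ} {a₀ b₀ : ℂ} (α β : ℂ)

/-- The momentum profile of the amplitude emitted to the right, in left chirality. -/
def rightProfile₀ (r s : ℝ) (a₀ b₀ α β : ℂ) : ℝ → ℂ :=
  packetAmp r s b₀.re (Polynomial.X * rightNum a₀ b₀ α β) 0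

/-- The momentum profile of the amplitude emitted to the right, in right chirality. -/
def rightProfile₁ (r s : ℝ) (a₀ b₀ α β : ℂ) : ℝ → ℂ :=
  packetAmp r s b₀.re (rightNum a₀ b₀ α β) 1

/-- The momentum profile of the amplitude emitted to the left, in left chirality. -/
def leftProfile₀ (r s : ℝ) (a₀ b₀ α β : ℂ) : ℝ → ℂ :=
  packetAmp r s b₀.re (leftNum a₀ b₀ α β) 1

/-- The momentum profile of the amplitude emitted to the left, in right chirality. -/
def leftProfile₁ (r s : ℝ) (a₀ b₀ α β : ℂ) : ℝ → ℂ :=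
  packetAmp r s b₀.re (-Polynomial.X * leftNum a₀ b₀ α β) 0

/-- The spectral density of the walk on the right, as a function of the momentum. -/
def rightDensity (r s : ℝ) (a₀ b₀ α β : ℂ) (k : ℝ) : ℝ :=
  ‖rightProfile₀ r s a₀ b₀ α β k‖ ^ 2 + ‖rightProfile₁ r s a₀ b₀ α β k‖ ^ 2

/-- The spectral density of the walk on the left, as a function of the momentum. -/
def leftDensity (r s : ℝ) (a₀ b₀ α β : ℂ) (k : ℝ) : ℝ :=
  ‖leftProfile₀ r s a₀ b₀ α β k‖ ^ 2 + ‖leftProfile₁ r s a₀ b₀ α β k‖ ^ 2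

/-- The ballistic part of the limit law, integrated against `g`. -/
def ballistic (r s : ℝ) (a₀ b₀ α β : ℂ) (g : ℝ → ℝ) : ℝ :=
  (2 * Real.pi)⁻¹ * ∫ k in -Real.pi..Real.pi, (rightDensity r s a₀ b₀ α β k * g (velocity r k) +
    leftDensity r s a₀ b₀ α β k * g (-velocity r k))

theorem IsProfile.intervalIntegrable_mul {F : ℝ → ℂ} {K : ℝ} (hF : IsProfile F K) {f : ℝ → ℝ}
    (hf : Measurable f) {M : ℝ} (hM : ∀ x, |f x| ≤ M) :
    IntervalIntegrable (fun k => ‖F k‖ ^ 2 * f k) volume (-Real.pi) Real.pi := by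
  refine (hF.intervalIntegrable.mul_const M).mono_fun'
    ((hF.meas.norm.pow_const 2).mul hf).aestronglyMeasurable (ae_of_all _ fun k => ?_)
  simp only [norm_mul, norm_pow, norm_norm]
  exact mul_le_mul_of_nonneg_left (hM _) (by positivity)

/-- The limit theorem for the walk with normalized coins. -/
theorem coreStep_limit (hr : 0 < r) (hs : 0 < s) (h : r ^ 2 + s ^ 2 = 1) (hp : |b₀.re| < 1)
    (h₀ : ‖a₀‖ ^ 2 + ‖b₀‖ ^ 2 = 1)
    (hnorm : ∀ n, IsNormalized ((coreStep r s a₀ b₀)^[n] (originState α β))) :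
    (∃ μ : ℤ → ℝ, (∀ x, Tendsto (fun T : ℕ => (T : ℝ)⁻¹ * ∑ n ∈ Finset.range T,
        siteWeight ((coreStep r s a₀ b₀)^[n] (originState α β)) x) atTop (𝓝 (μ x))) ∧
      HasSum μ (1 - ballistic r s a₀ b₀ α β 1)) ∧
    ∀ g : BoundedContinuousFunction ℝ ℝ, Tendsto (fun n : ℕ => ∑' x : ℤ,
        siteWeight ((coreStep r s a₀ b₀)^[n] (originState α β)) x * g (x / n)) atTop
      (𝓝 ((1 - ballistic r s a₀ b₀ α β 1) * g 0 + ballistic r s a₀ b₀ α β g)) := by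
  set Ψ : ℕ → State := fun n => (coreStep r s a₀ b₀)^[n] (originState α β)
  have hΨ : ∀ n, Ψ n = fun x j => coef (1 / 2) n (genFun r s a₀ b₀ α β x j) := fun n =>
    coreStep_iterate_eq_coef α β hr hs h hp h₀ (by norm_num) (by norm_num) n
  obtain ⟨K₀, hK₀0, hK₀⟩ := exists_packet_bound hr hs h hp (Polynomial.X * rightNum a₀ b₀ α β)
  obtain ⟨K₁, hK₁0, hK₁⟩ := exists_packet_bound hr hs h hp (rightNum a₀ b₀ α β)
  obtain ⟨K₂, hK₂0, hK₂⟩ := exists_packet_bound hr hs h hp (leftNum a₀ b₀ α β)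
  obtain ⟨K₃, hK₃0, hK₃⟩ := exists_packet_bound hr hs h hp (-Polynomial.X * leftNum a₀ b₀ α β)
  obtain ⟨M₀, hR₀⟩ := isProfile_packetAmp hr hs h hp (Polynomial.X * rightNum a₀ b₀ α β) 0
  obtain ⟨M₁, hR₁⟩ := isProfile_packetAmp hr hs h hp (rightNum a₀ b₀ α β) 1
  obtain ⟨M₂, hL₀⟩ := isProfile_packetAmp hr hs h hp (leftNum a₀ b₀ α β) 1
  obtain ⟨M₃, hL₁⟩ := isProfile_packetAmp hr hs h hp (-Polynomial.X * leftNum a₀ b₀ α β) 0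
  change IsProfile (rightProfile₀ r s a₀ b₀ α β) M₀ at hR₀
  change IsProfile (rightProfile₁ r s a₀ b₀ α β) M₁ at hR₁
  change IsProfile (leftProfile₀ r s a₀ b₀ α β) M₂ at hL₀
  change IsProfile (leftProfile₁ r s a₀ b₀ α β) M₃ at hL₁
  set R : ℕ → ℕ → ℝ := fun n k => ‖packet r (rightProfile₀ r s a₀ b₀ α β) n ((k + 1 : ℕ) : ℤ)‖ ^ 2 +
    ‖packet r (rightProfile₁ r s a₀ b₀ α β) n ((k + 1 : ℕ) : ℤ)‖ ^ 2 with hR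
  set L : ℕ → ℕ → ℝ := fun n k => ‖packet r (leftProfile₀ r s a₀ b₀ α β) n ((k + 1 : ℕ) : ℤ)‖ ^ 2 +
    ‖packet r (leftProfile₁ r s a₀ b₀ α β) n ((k + 1 : ℕ) : ℤ)‖ ^ 2 with hL
  have hinj : Function.Injective fun k : ℕ => ((k + 1 : ℕ) : ℤ) := fun a b hab => by
    have : (a + 1 : ℕ) = b + 1 := Nat.cast_injective hab
    omega
  have hsum : ∀ {F : ℝ → ℂ} {K : ℝ} (_ : IsProfile F K) (n : ℕ),
      Summable fun k : ℕ => ‖packet r F n ((k + 1 : ℕ) : ℤ)‖ ^ 2 := fun hF n =>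
    (hasSum_packet hF n).summable.comp_injective hinj
  have hsum_le : ∀ {F : ℝ → ℂ} {K : ℝ} (_ : IsProfile F K) (n : ℕ),
      ∑' k : ℕ, ‖packet r F n ((k + 1 : ℕ) : ℤ)‖ ^ 2 ≤ packetMass F := fun hF n => by
    rw [← (hasSum_packet hF n).tsum_eq]
    exact tsum_comp_le_tsum_of_inj (hasSum_packet hF n).summable (fun m => by positivity) hinj
  have hsR : ∀ n, Summable (R n) := fun n => (hsum hR₀ n).add (hsum hR₁ n)
  have hsL : ∀ n, Summable (L n) := fun n => (hsum hL₀ n).add (hsum hL₁ n)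
  set eR : ℕ → ℝ := fun k => (K₀ * ((k : ℝ) + 1) ^ (-(3 / 4) : ℝ)) ^ 2 +
    (K₁ * ((k : ℝ) + 1) ^ (-(3 / 4) : ℝ)) ^ 2
  set eL : ℕ → ℝ := fun k => (K₂ * ((k : ℝ) + 1) ^ (-(3 / 4) : ℝ)) ^ 2 +
    (K₃ * ((k : ℝ) + 1) ^ (-(3 / 4) : ℝ)) ^ 2
  have hseR : Summable eR := (summable_sq_rpow K₀).add (summable_sq_rpow K₁)
  have hseL : Summable eL := (summable_sq_rpow K₂).add (summable_sq_rpow K₃)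
  -- At the origin the ballistic weight is set to `0` and the error to `1`, which suffices because a
  -- site weight never exceeds one.
  have hS : BallisticSplit (fun n => siteWeight (Ψ n)) (fun n => twoSided 0 (R n) (L n))
      (twoSided 1 eR eL) (packetMass (rightProfile₀ r s a₀ b₀ α β) +
        packetMass (rightProfile₁ r s a₀ b₀ α β) + (packetMass (leftProfile₀ r s a₀ b₀ α β) +
        packetMass (leftProfile₁ r s a₀ b₀ α β))) := by
    refine ⟨hnorm, fun n x => ?_, fun n => ?_, fun n => ?_, fun x => ?_, ?_, fun η hη n x => ?_⟩
    · match x with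
      | Int.ofNat 0 => exact le_rfl
      | Int.ofNat (k + 1) => exact add_nonneg (sq_nonneg _) (sq_nonneg _)
      | Int.negSucc k => exact add_nonneg (sq_nonneg _) (sq_nonneg _)
    · exact (hasSum_twoSided (hsR n).hasSum (hsL n).hasSum).summable
    · rw [(hasSum_twoSided (hsR n).hasSum (hsL n).hasSum).tsum_eq, add_zero,
        (hsum hR₀ n).tsum_add (hsum hR₁ n), (hsum hL₀ n).tsum_add (hsum hL₁ n)]
      exact add_le_add (add_le_add (hsum_le hR₀ n) (hsum_le hR₁ n))
        (add_le_add (hsum_le hL₀ n) (hsum_le hL₁ n))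
    · match x with
      | Int.ofNat 0 => exact zero_le_one
      | Int.ofNat (k + 1) => exact add_nonneg (sq_nonneg _) (sq_nonneg _)
      | Int.negSucc k => exact add_nonneg (sq_nonneg _) (sq_nonneg _)
    · exact (hasSum_twoSided hseR.hasSum hseL.hasSum).summable
    · have hcomb : ∀ {u₀ v₀ u₁ v₁ : ℂ} {ε₀ ε₁ : ℝ}, ‖u₀ - v₀‖ ≤ ε₀ → ‖u₁ - v₁‖ ≤ ε₁ →
          |(‖u₀‖ ^ 2 + ‖u₁‖ ^ 2) - (‖v₀‖ ^ 2 + ‖v₁‖ ^ 2)| ≤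
            η * (‖v₀‖ ^ 2 + ‖v₁‖ ^ 2) + (1 + η⁻¹) * (ε₀ ^ 2 + ε₁ ^ 2) := by
        intro u₀ v₀ u₁ v₁ ε₀ ε₁ h0 h1
        have h2 := abs_norm_sq_sub_le h0 hη
        have h3 := abs_norm_sq_sub_le h1 hη
        have h4 := abs_add_le (‖u₀‖ ^ 2 - ‖v₀‖ ^ 2) (‖u₁‖ ^ 2 - ‖v₁‖ ^ 2)
        rw [show (‖u₀‖ ^ 2 + ‖u₁‖ ^ 2) - (‖v₀‖ ^ 2 + ‖v₁‖ ^ 2) =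
          (‖u₀‖ ^ 2 - ‖v₀‖ ^ 2) + (‖u₁‖ ^ 2 - ‖v₁‖ ^ 2) by ring]
        linarith
      match x with
      | Int.ofNat 0 =>
        have h1 : siteWeight (Ψ n) (Int.ofNat 0) ≤ 1 :=
          le_hasSum (hnorm n) _ fun y _ => by unfold siteWeight; positivity
        have h2 : 0 ≤ siteWeight (Ψ n) (Int.ofNat 0) := by unfold siteWeight; positivity
        have h3 : 0 < η⁻¹ := inv_pos.2 hη
        show |siteWeight (Ψ n) (Int.ofNat 0) - 0| ≤ η * 0 + (1 + η⁻¹) * 1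
        rw [sub_zero, abs_of_nonneg h2]
        exact h1.trans (by linarith)
      | Int.ofNat (k + 1) =>
        have h1 := (hK₀ k (k + 1) 0 rfl (by omega)).2.1 n
        have h2 := (hK₁ k k 1 rfl le_rfl).2.1 n
        have := hcomb h1 h2
        simp only [siteWeight, hΨ]
        exact this
      | Int.negSucc k =>
        have h1 := (hK₂ k k 1 rfl le_rfl).2.1 n
        have h2 := (hK₃ k (k + 1) 0 rfl (by omega)).2.1 n
        have := hcomb h1 h2
        simp only [siteWeight, hΨ]
        exact this
  have hqg : ∀ g : BoundedContinuousFunction ℝ ℝ, Tendsto (fun n : ℕ => ∑' x : ℤ,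
      twoSided 0 (R n) (L n) x * g (x / n)) atTop (𝓝 (ballistic r s a₀ b₀ α β g)) := by
    intro g
    have hb : ∀ {F : ℝ → ℂ} {K : ℝ} (_ : IsProfile F K) (g : BoundedContinuousFunction ℝ ℝ) (n : ℕ),
        Summable fun k : ℕ => ‖packet r F n ((k + 1 : ℕ) : ℤ)‖ ^ 2 * g (((k + 1 : ℕ) : ℝ) / n) :=
      fun hF g n => by
        refine Summable.of_norm_bounded ((hsum hF n).mul_right ‖g‖) fun k => ?_
        rw [norm_mul, norm_pow, norm_norm]
        gcongr
        exact g.norm_coe_le_norm _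
    -- Amplitudes at negative sites are packets in the distance from the origin, so the left half is
    -- treated by reflecting the test function.
    set g' : BoundedContinuousFunction ℝ ℝ := g.compContinuous ⟨fun x => -x, continuous_neg⟩
    have h1 : ∀ n : ℕ, ∑' x : ℤ, twoSided 0 (R n) (L n) x * g (x / n) =
        (∑' k : ℕ, ‖packet r (rightProfile₀ r s a₀ b₀ α β) n ((k + 1 : ℕ) : ℤ)‖ ^ 2 *
            g (((k + 1 : ℕ) : ℝ) / n) +
          ∑' k : ℕ, ‖packet r (rightProfile₁ r s a₀ b₀ α β) n ((k + 1 : ℕ) : ℤ)‖ ^ 2 *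
            g (((k + 1 : ℕ) : ℝ) / n)) +
        (∑' k : ℕ, ‖packet r (leftProfile₀ r s a₀ b₀ α β) n ((k + 1 : ℕ) : ℤ)‖ ^ 2 *
            g' (((k + 1 : ℕ) : ℝ) / n) +
          ∑' k : ℕ, ‖packet r (leftProfile₁ r s a₀ b₀ α β) n ((k + 1 : ℕ) : ℤ)‖ ^ 2 *
            g' (((k + 1 : ℕ) : ℝ) / n)) := by
      intro n
      have h2 := hasSum_twoSided (c := 0) ((hb hR₀ g n).hasSum.add (hb hR₁ g n).hasSum)
        ((hb hL₀ g' n).hasSum.add (hb hL₁ g' n).hasSum)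
      rw [add_zero] at h2
      rw [← h2.tsum_eq]
      refine tsum_congr fun x => ?_
      rw [twoSided_mul (R n) (L n) (fun x => g (x / n))]
      congr 1
      · ext k
        simp only [hR, Int.cast_natCast, add_mul]
      · ext k
        have : g (((-((k + 1 : ℕ) : ℤ) : ℤ) : ℝ) / n) = g' (((k + 1 : ℕ) : ℝ) / n) := by
          simp only [g', BoundedContinuousFunction.compContinuous_apply, ContinuousMap.coe_mk]
          congr 1
          push_cast
          ring
        simp only [hL, this, add_mul]
    have h2 := ((tendsto_tsum_packet_succ hr hs h hR₀ g).add
      (tendsto_tsum_packet_succ hr hs h hR₁ g)).add ((tendsto_tsum_packet_succ hr hs h hL₀ g').add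
      (tendsto_tsum_packet_succ hr hs h hL₁ g'))
    simp_rw [h1]
    convert h2 using 2
    have hgm : Measurable fun k => g (velocity r k) := g.continuous.measurable.comp (measurable_velocity r)
    have hgm' : Measurable fun k => g' (velocity r k) := g'.continuous.measurable.comp (measurable_velocity r)
    have hgb : ∀ k, |g (velocity r k)| ≤ ‖g‖ := fun k => g.norm_coe_le_norm _
    have hgb' : ∀ k, |g' (velocity r k)| ≤ ‖g'‖ := fun k => g'.norm_coe_le_norm _
    have i0 := hR₀.intervalIntegrable_mul hgm hgb
    have i1 := hR₁.intervalIntegrable_mul hgm hgb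
    have i2 := hL₀.intervalIntegrable_mul hgm' hgb'
    have i3 := hL₁.intervalIntegrable_mul hgm' hgb'
    rw [← mul_add, ← mul_add, ← mul_add, ← intervalIntegral.integral_add i0 i1,
      ← intervalIntegral.integral_add i2 i3,
      ← intervalIntegral.integral_add (i0.add i1) (i2.add i3), ballistic]
    congr 2
    ext k
    simp only [rightDensity, leftDensity, g', BoundedContinuousFunction.compContinuous_apply,
      ContinuousMap.coe_mk, add_mul]
  have hI : Tendsto (fun n => ∑' x, twoSided 0 (R n) (L n) x) atTop
      (𝓝 (ballistic r s a₀ b₀ α β 1)) := by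
    simpa using hqg 1
  refine ⟨?_, fun g => hS.tendsto_tsum_mul g hI (hqg g)⟩
  have hces : ∀ x, ∃ L : ℝ, Tendsto (fun T : ℕ => (T : ℝ)⁻¹ * ∑ n ∈ Finset.range T,
      siteWeight (Ψ n) x) atTop (𝓝 L) := by
    have hcomb : ∀ c₀ c₁ : ℕ → ℂ, AlmostQuasiPeriodic c₀ → AlmostQuasiPeriodic c₁ →
        ∃ L : ℝ, Tendsto (fun T : ℕ => (T : ℝ)⁻¹ * ∑ n ∈ Finset.range T,
          (‖c₀ n‖ ^ 2 + ‖c₁ n‖ ^ 2)) atTop (𝓝 L) := by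
      intro c₀ c₁ h0 h1
      obtain ⟨L₀, h0⟩ := h0.exists_tendsto_cesaro
      obtain ⟨L₁, h1⟩ := h1.exists_tendsto_cesaro
      refine ⟨L₀ + L₁, (h0.add h1).congr fun T => ?_⟩
      rw [Finset.sum_add_distrib, mul_add]
    intro x
    simp only [siteWeight, hΨ]
    apply hcomb
    all_goals
      match x with
      | Int.ofNat 0 => exact ((bandSplit_amp hr hs h hp _).choose_spec 0 0).quasi
      | Int.ofNat (k + 1) => exact ((bandSplit_amp hr hs h hp _).choose_spec _ _).quasi
      | Int.negSucc k => exact ((bandSplit_amp hr hs h hp _).choose_spec _ _).quasi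
  choose μ hμ using hces
  refine ⟨μ, hμ, hS.hasSum_of_cesaro hI (fun x => ?_) hμ⟩
  have hsq : ∀ {u v : ℕ → ℂ}, Tendsto u atTop (𝓝 0) → Tendsto v atTop (𝓝 0) →
      Tendsto (fun n => ‖u n‖ ^ 2 + ‖v n‖ ^ 2) atTop (𝓝 0) := fun hu hv => by
    simpa using (hu.norm.pow 2).add (hv.norm.pow 2)
  match x with
  | Int.ofNat 0 => exact tendsto_const_nhds
  | Int.ofNat (k + 1) =>
    exact hsq (hK₀ k (k + 1) 0 rfl (by omega)).2.2 (hK₁ k k 1 rfl le_rfl).2.2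
  | Int.negSucc k =>
    exact hsq (hK₂ k k 1 rfl le_rfl).2.2 (hK₃ k (k + 1) 0 rfl (by omega)).2.2

end

/-! ### From momentum to the Konno density. -/

section
variable {r s p : ℝ}

open ComplexConjugate

theorem velocity_neg (k : ℝ) : velocity r (-k) = velocity r k := by
  simp [velocity, Real.sin_neg, abs_neg, Real.cos_neg]

theorem bandRoot_neg {k : ℝ} (hk : k ≠ 0) : bandRoot r s (-k) = conj (bandRoot r s k) := by
  rw [bandRoot_eq, bandRoot_eq, phase_neg hk, map_div₀, map_sub, map_mul, conj_circleMap_one,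
    Complex.conj_ofReal, Complex.conj_ofReal, map_one]
  congr 4
  ring

theorem neg_mem_momenta {k : ℝ} (hk : k ∈ momenta) : -k ∈ momenta := by
  rcases hk with h | h
  · exact Or.inr ⟨by linarith [h.2], by linarith [h.1]⟩
  · exact Or.inl ⟨by linarith [h.2], by linarith [h.1]⟩

theorem ne_zero_of_mem_momenta {k : ℝ} (hk : k ∈ momenta) : k ≠ 0 := by
  rcases hk with h | h
  · exact h.2.ne
  · exact h.1.ne'

/-- The quadratic form that governs the emission of amplitude with velocity `v`. -/
def emission (s : ℝ) (A a : ℂ) (v : ℝ) : ℝ :=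
  (1 + v) * ‖A‖ ^ 2 + (1 - v) * ‖a‖ ^ 2 + 2 * s * (conj a * A).re

/-- Completing the square in `(1 + v) |A| - s |a|` leaves `(1 - v² - s²) |a|²` and a cross term that
is nonnegative by Cauchy-Schwarz. For `0 ≤ v < r` the coefficient is `r² - v² > 0`. -/
theorem mul_emission_le (s : ℝ) (hs : 0 < s) (A a : ℂ) {v : ℝ} (hv : 0 ≤ v) :
    (1 - v ^ 2 - s ^ 2) * ‖a‖ ^ 2 ≤ (1 + v) * emission s A a v := by
  have h1 : -(‖a‖ * ‖A‖) ≤ (conj a * A).re := by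
    have := (abs_le.1 (Complex.abs_re_le_norm (conj a * A))).1
    rwa [norm_mul, RCLike.norm_conj] at this
  have h2 : (1 + v) * emission s A a v = ((1 + v) * ‖A‖ - s * ‖a‖) ^ 2 + (1 - v ^ 2 - s ^ 2) * ‖a‖ ^ 2 +
      2 * (1 + v) * s * ((conj a * A).re + ‖a‖ * ‖A‖) := by rw [emission]; ring
  have h3 : 0 ≤ 2 * (1 + v) * s * ((conj a * A).re + ‖a‖ * ‖A‖) := by
    have : 0 ≤ (conj a * A).re + ‖a‖ * ‖A‖ := by linarith
    positivity
  rw [h2]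
  nlinarith [sq_nonneg ((1 + v) * ‖A‖ - s * ‖a‖)]

theorem lt_one_sub_sq (h : r ^ 2 + s ^ 2 = 1) {v : ℝ} (hv : 0 ≤ v) (hvr : v < r) :
    0 < 1 - v ^ 2 - s ^ 2 := by nlinarith

theorem emission_nonneg (hs : 0 < s) (h : r ^ 2 + s ^ 2 = 1) (A a : ℂ) {v : ℝ} (hv : 0 ≤ v)
    (hvr : v < r) : 0 ≤ emission s A a v := by
  have h1 := mul_emission_le s hs A a hv
  have h2 := mul_nonneg (lt_one_sub_sq h hv hvr).le (sq_nonneg ‖a‖)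
  exact nonneg_of_mul_nonneg_right (h2.trans h1) (by linarith)

theorem emission_pos (hs : 0 < s) (h : r ^ 2 + s ^ 2 = 1) (A : ℂ) {a : ℂ} (ha : a ≠ 0) {v : ℝ}
    (hv : 0 ≤ v) (hvr : v < r) : 0 < emission s A a v := by
  have h1 := mul_emission_le s hs A a hv
  have h2 := mul_pos (lt_one_sub_sq h hv hvr) (pow_pos (norm_pos_iff.2 ha) 2)
  exact pos_of_mul_pos_right (h2.trans_le h1) (by linarith)

/-- The denominator of the weight of the limit density. -/
def weightDen (s p v : ℝ) : ℝ := (s - p) ^ 2 + (1 - p ^ 2) * v ^ 2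

theorem weightDen_pos (hp : |p| < 1) {v : ℝ} (hv : v ≠ 0) : 0 < weightDen s p v := by
  have hp2 : 0 < 1 - p ^ 2 := by nlinarith [abs_lt.1 hp]
  unfold weightDen
  positivity

theorem norm_sub_sq_add (A a y : ℂ) : ‖A - a * y‖ ^ 2 + ‖A - a * conj y‖ ^ 2 =
    2 * ‖A‖ ^ 2 + 2 * ‖a‖ ^ 2 * ‖y‖ ^ 2 - 4 * (conj a * A).re * y.re := by
  simp only [← Complex.normSq_eq_norm_sq, Complex.normSq_apply, Complex.sub_re, Complex.sub_im,
    Complex.mul_re, Complex.mul_im, Complex.conj_re, Complex.conj_im]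
  ring

/-- The spectral density, symmetrized in the momentum. -/
theorem packetAmp_density (hr : 0 < r) (hs : 0 < s) (h : r ^ 2 + s ^ 2 = 1) (hp : |p| < 1)
    {Q Q' : Polynomial ℂ} {A a : ℂ} (hQ : ∀ y, Q.eval y = A - a * y)
    (hQ' : ∀ y, ‖Q'.eval y‖ = ‖y‖ * ‖A - a * y‖) (e e' : ℕ) {k : ℝ} (hk : k ∈ momenta) :
    (‖packetAmp r s p Q' e' k‖ ^ 2 + ‖packetAmp r s p Q e k‖ ^ 2) +
      (‖packetAmp r s p Q' e' (-k)‖ ^ 2 + ‖packetAmp r s p Q e (-k)‖ ^ 2) =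
      velocity r k ^ 2 / weightDen s p (velocity r k) * emission s A a (velocity r k) := by
  have hk' := neg_mem_momenta hk
  have hv := velocity_pos hr hs h hk
  have hd := weightDen_pos (s := s) hp hv.ne'
  -- Reversing the momentum conjugates `y`, so the sum over `±k` involves only `|y|²` and `Re y`,
  -- both functions of `v`.
  have h1 := norm_sub_sq_add A a (bandRoot r s k)
  rw [norm_bandRoot_sq hr hs h hk, bandRoot_re hr hs h hk] at h1
  rw [norm_packetAmp_sq hr hs h Q' e' hk, norm_packetAmp_sq hr hs h Q e hk,
    norm_packetAmp_sq hr hs h Q' e' hk', norm_packetAmp_sq hr hs h Q e hk', hQ', hQ', hQ, hQ,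
    bandRoot_neg (ne_zero_of_mem_momenta hk), velocity_neg, RCLike.norm_conj, mul_pow, mul_pow,
    norm_bandRoot_sq hr hs h hk]
  set v := velocity r k
  have hd' : (s - p) ^ 2 + v ^ 2 * (1 - p ^ 2) = weightDen s p v := by rw [weightDen]; ring
  rw [hd']
  generalize ‖A - a * bandRoot r s k‖ ^ 2 = X at *
  generalize ‖A - a * conj (bandRoot r s k)‖ ^ 2 = Y at *
  have hY : Y = 2 * ‖A‖ ^ 2 + 2 * ‖a‖ ^ 2 * ((1 - v) / (1 + v)) -
    4 * (conj a * A).re * (-s / (1 + v)) - X := by linarith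
  rw [hY, emission]
  generalize weightDen s p v = D at *
  field_simp
  ring

theorem velocity_pi_sub (k : ℝ) : velocity r (Real.pi - k) = velocity r k := by
  simp [velocity, Real.sin_pi_sub, Real.cos_pi_sub]

theorem sqrt_radicand_pos (hs : 0 < s) (h : r ^ 2 + s ^ 2 = 1) (k : ℝ) :
    0 < √(1 - (r * Real.cos k) ^ 2) := Real.sqrt_pos.2 (by linarith [mul_cos_sq_lt hs h k])

theorem hasDerivAt_velocity (hs : 0 < s) (h : r ^ 2 + s ^ 2 = 1) {k : ℝ}
    (hk : k ∈ Set.Ioo 0 (Real.pi / 2)) :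
    HasDerivAt (velocity r) (r * s ^ 2 * Real.cos k / √(1 - (r * Real.cos k) ^ 2) ^ 3) k := by
  have hpi := Real.pi_pos
  have hN := mul_cos_sq_lt hs h k
  have hS := sqrt_radicand_pos hs h k
  have hS2 : √(1 - (r * Real.cos k) ^ 2) ^ 2 = 1 - (r * Real.cos k) ^ 2 := Real.sq_sqrt (by linarith)
  have h1 : HasDerivAt (fun k => 1 - (r * Real.cos k) ^ 2)
      (2 * r ^ 2 * Real.cos k * Real.sin k) k := by
    have := (((Real.hasDerivAt_cos k).const_mul r).pow 2).const_sub 1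
    refine this.congr_deriv ?_
    simp only [Nat.cast_ofNat]
    ring
  have h2 := h1.sqrt (by linarith)
  have h3 := ((Real.hasDerivAt_sin k).const_mul r).div h2 hS.ne'
  have h4 : velocity r =ᶠ[𝓝 k] fun k => r * Real.sin k / √(1 - (r * Real.cos k) ^ 2) := by
    filter_upwards [Ioo_mem_nhds hk.1 (by linarith [hk.2] : k < Real.pi)] with x hx
    rw [velocity, abs_of_pos (Real.sin_pos_of_pos_of_lt_pi hx.1 hx.2)]
  refine (h3.congr_of_eventuallyEq h4).congr_deriv ?_
  generalize √(1 - (r * Real.cos k) ^ 2) = S at *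
  field_simp
  rw [hS2]
  linear_combination (-r) * Real.cos k * (r ^ 2 * Real.sin_sq_add_cos_sq k + h)

theorem velocity_sq (hs : 0 < s) (h : r ^ 2 + s ^ 2 = 1) (k : ℝ) :
    velocity r k ^ 2 * (1 - (r * Real.cos k) ^ 2) = r ^ 2 * Real.sin k ^ 2 := by
  have hN := mul_cos_sq_lt hs h k
  rw [velocity, div_pow, Real.sq_sqrt (by linarith), mul_pow, sq_abs, div_mul_cancel₀]
  linarith

/-- With `S = √(1 - r² cos² k)` one has `1 - v² = (s / S)²` and `r² - v² = (r s cos k / S)²`. The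
density is thus the inverse Jacobian up to a constant. -/
theorem konnoDensity_velocity (hr : 0 < r) (hs : 0 < s) (h : r ^ 2 + s ^ 2 = 1) {k : ℝ}
    (hk : k ∈ Set.Ioo 0 (Real.pi / 2)) :
    r * s ^ 2 * Real.cos k / √(1 - (r * Real.cos k) ^ 2) ^ 3 * konnoDensity (velocity r k) r =
      Real.pi⁻¹ := by
  have hpi := Real.pi_pos
  have hc := Real.cos_pos_of_mem_Ioo (x := k) ⟨by linarith [hk.1], hk.2⟩
  have hN := mul_cos_sq_lt hs h k
  have hS := sqrt_radicand_pos hs h k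
  have hS2 : √(1 - (r * Real.cos k) ^ 2) ^ 2 = 1 - (r * Real.cos k) ^ 2 := Real.sq_sqrt (by linarith)
  have hv2 := velocity_sq hs h k
  rw [← hS2] at hv2
  have hsc := Real.sin_sq_add_cos_sq k
  set S := √(1 - (r * Real.cos k) ^ 2)
  have h1 : 1 - velocity r k ^ 2 = (s / S) ^ 2 := by
    field_simp
    linear_combination -hv2 + hS2 - r ^ 2 * hsc - h
  have h2 : r ^ 2 - velocity r k ^ 2 = (r * s * Real.cos k / S) ^ 2 := by
    field_simp
    linear_combination -hv2 + r ^ 2 * hS2 + r ^ 2 * Real.cos k ^ 2 * (-h) - r ^ 2 * hsc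
  have h3 : 0 < r * s * Real.cos k / S := by positivity
  have hmem : velocity r k ∈ Set.Ioo (-r) r := by
    have : velocity r k ^ 2 < r ^ 2 := by have := pow_pos h3 2; linarith
    exact abs_lt.1 ((sq_lt_sq.1 this).trans_eq (abs_of_pos hr))
  rw [konnoDensity, Set.indicator_of_mem hmem, h1, h2, Real.sqrt_sq h3.le,
    show 1 - r ^ 2 = s ^ 2 by linarith, Real.sqrt_sq hs.le]
  field_simp

theorem velocity_image (hr : 0 < r) (hs : 0 < s) (h : r ^ 2 + s ^ 2 = 1) :
    velocity r '' Set.Ioo 0 (Real.pi / 2) = Set.Ioo 0 r := by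
  have hpi := Real.pi_pos
  have h0 : velocity r 0 = 0 := by simp [velocity]
  have h1 : velocity r (Real.pi / 2) = r := by simp [velocity]
  have hcont : ContinuousOn (velocity r) (Set.Icc 0 (Real.pi / 2)) :=
    fun k _ => (continuousAt_velocity hs h k).continuousWithinAt
  have hmono : StrictMonoOn (velocity r) (Set.Icc 0 (Real.pi / 2)) := by
    refine strictMonoOn_of_deriv_pos (convex_Icc _ _) hcont fun k hk => ?_
    rw [interior_Icc] at hk
    rw [(hasDerivAt_velocity hs h hk).deriv]
    have hc := Real.cos_pos_of_mem_Ioo (x := k) ⟨by linarith [hk.1], hk.2⟩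
    have hS := sqrt_radicand_pos hs h k
    positivity
  ext x
  constructor
  · rintro ⟨k, hk, rfl⟩
    have h2 := hmono ⟨le_rfl, by linarith⟩ ⟨hk.1.le, hk.2.le⟩ hk.1
    have h3 := hmono ⟨hk.1.le, hk.2.le⟩ ⟨by linarith, le_rfl⟩ hk.2
    rw [h0] at h2
    rw [h1] at h3
    exact ⟨h2, h3⟩
  · intro hx
    have := intermediate_value_Ioo (by linarith : (0 : ℝ) ≤ Real.pi / 2) hcont
    rw [h0, h1] at this
    exact this hx

theorem velocity_injOn (hr : 0 < r) (hs : 0 < s) (h : r ^ 2 + s ^ 2 = 1) :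
    Set.InjOn (velocity r) (Set.Ioo 0 (Real.pi / 2)) := by
  have hpi := Real.pi_pos
  have hmono : StrictMonoOn (velocity r) (Set.Ioo 0 (Real.pi / 2)) := by
    refine strictMonoOn_of_deriv_pos (convex_Ioo _ _)
      (fun k _ => (continuousAt_velocity hs h k).continuousWithinAt) fun k hk => ?_
    rw [interior_Ioo] at hk
    rw [(hasDerivAt_velocity hs h hk).deriv]
    have hc := Real.cos_pos_of_mem_Ioo (x := k) ⟨by linarith [hk.1], hk.2⟩
    have hS := sqrt_radicand_pos hs h k
    positivity
  exact hmono.injOn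

/-- The velocity of a uniformly distributed momentum has the Konno density. -/
theorem integral_comp_velocity (hr : 0 < r) (hs : 0 < s) (h : r ^ 2 + s ^ 2 = 1) {H : ℝ → ℝ}
    (hi : IntervalIntegrable (fun k => H (velocity r k)) volume (-Real.pi) Real.pi) :
    IntegrableOn (fun x => H x * konnoDensity x r) (Set.Ioo 0 r) ∧
      (2 * Real.pi)⁻¹ * ∫ k in -Real.pi..Real.pi, H (velocity r k) =
        2 * ∫ x in Set.Ioo 0 r, H x * konnoDensity x r := by
  have hpi := Real.pi_pos
  have hderiv : ∀ k ∈ Set.Ioo 0 (Real.pi / 2), HasDerivWithinAt (velocity r)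
      (r * s ^ 2 * Real.cos k / √(1 - (r * Real.cos k) ^ 2) ^ 3) (Set.Ioo 0 (Real.pi / 2)) k :=
    fun k hk => (hasDerivAt_velocity hs h hk).hasDerivWithinAt
  have heq : ∀ k ∈ Set.Ioo 0 (Real.pi / 2),
      |r * s ^ 2 * Real.cos k / √(1 - (r * Real.cos k) ^ 2) ^ 3| •
        (H (velocity r k) * konnoDensity (velocity r k) r) = Real.pi⁻¹ * H (velocity r k) := by
    intro k hk
    have hc := Real.cos_pos_of_mem_Ioo (x := k) ⟨by linarith [hk.1], hk.2⟩
    have hS := sqrt_radicand_pos hs h k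
    rw [abs_of_pos (by positivity), smul_eq_mul, ← konnoDensity_velocity hr hs h hk]
    ring
  have i1 : IntervalIntegrable (fun k => H (velocity r k)) volume 0 (Real.pi / 2) :=
    hi.mono_set (by
      rw [Set.uIcc_of_le (by linarith), Set.uIcc_of_le (by linarith)]
      exact Set.Icc_subset_Icc (by linarith) (by linarith))
  have i2 : IntervalIntegrable (fun k => H (velocity r k)) volume (Real.pi / 2) Real.pi :=
    hi.mono_set (by
      rw [Set.uIcc_of_le (by linarith), Set.uIcc_of_le (by linarith)]
      exact Set.Icc_subset_Icc (by linarith) (by linarith))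
  have i3 : IntervalIntegrable (fun k => H (velocity r k)) volume (-Real.pi) 0 :=
    hi.mono_set (by
      rw [Set.uIcc_of_le (by linarith), Set.uIcc_of_le (by linarith)]
      exact Set.Icc_subset_Icc (by linarith) (by linarith))
  constructor
  · rw [← velocity_image hr hs h,
      integrableOn_image_iff_integrableOn_abs_deriv_smul measurableSet_Ioo hderiv
        (velocity_injOn hr hs h)]
    refine IntegrableOn.congr_fun ?_ (fun k hk => (heq k hk).symm) measurableSet_Ioo
    exact (((intervalIntegrable_iff_integrableOn_Ioo_of_le (by linarith)).1 i1).const_mul _)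
  · rw [← velocity_image hr hs h,
      integral_image_eq_integral_abs_deriv_smul measurableSet_Ioo hderiv (velocity_injOn hr hs h),
      setIntegral_congr_fun measurableSet_Ioo heq, integral_const_mul,
      ← integral_Ioc_eq_integral_Ioo, ← intervalIntegral.integral_of_le (by linarith),
      ← intervalIntegral.integral_add_adjacent_intervals i3 (i1.trans i2),
      ← intervalIntegral.integral_add_adjacent_intervals i1 i2]
    -- The velocity is even and symmetric about `π / 2`, so the whole circle counts a quarter four
    -- times.
    have e1 : ∫ k in (Real.pi / 2)..Real.pi, H (velocity r k) =
        ∫ k in 0..(Real.pi / 2), H (velocity r k) := by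
      have := intervalIntegral.integral_comp_sub_left (a := 0) (b := Real.pi / 2)
        (fun k => H (velocity r k)) Real.pi
      simp only [velocity_pi_sub] at this
      rw [this]
      congr 1 <;> ring
    have e2 : ∫ k in -Real.pi..0, H (velocity r k) = ∫ k in 0..Real.pi, H (velocity r k) := by
      have := intervalIntegral.integral_comp_neg (a := 0) (b := Real.pi)
        (fun k => H (velocity r k))
      simp only [velocity_neg, neg_zero] at this
      rw [this]
    rw [e2, ← intervalIntegral.integral_add_adjacent_intervals i1 i2, e1]
    field_simp
    ring

/-- Integration of a density whose symmetrization is a function of the velocity. -/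
theorem integral_symm_density (hr : 0 < r) (hs : 0 < s) (h : r ^ 2 + s ^ 2 = 1) {ρ W : ℝ → ℝ}
    (hW : ∀ k ∈ momenta, ρ k + ρ (-k) = W (velocity r k))
    (hi : IntervalIntegrable ρ volume (-Real.pi) Real.pi) :
    IntegrableOn (fun x => W x * konnoDensity x r) (Set.Ioo 0 r) ∧
      (2 * Real.pi)⁻¹ * ∫ k in -Real.pi..Real.pi, ρ k =
        ∫ x in Set.Ioo 0 r, W x * konnoDensity x r := by
  have hpi := Real.pi_pos
  have hi' : IntervalIntegrable (fun k => ρ (-k)) volume (-Real.pi) Real.pi := by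
    have := ((IntervalIntegrable.iff_comp_neg (f := ρ) (a := -Real.pi) (b := Real.pi)).1 hi).symm
    simpa using this
  have hae : ∀ᵐ k : ℝ, k ∈ Set.uIoc (-Real.pi) Real.pi → ρ k + ρ (-k) = W (velocity r k) := by
    rw [Set.uIoc_of_le (by linarith)]
    filter_upwards [ae_mem_momenta] with k hk hk'
    exact hW k (hk hk')
  have h1 : IntervalIntegrable (fun k => W (velocity r k)) volume (-Real.pi) Real.pi :=
    (hi.add hi').congr_ae ((ae_restrict_iff' measurableSet_uIoc).2 hae)
  obtain ⟨h2, h3⟩ := integral_comp_velocity hr hs h h1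
  refine ⟨h2, ?_⟩
  have h4 : ∫ k in -Real.pi..Real.pi, W (velocity r k) = 2 * ∫ k in -Real.pi..Real.pi, ρ k := by
    rw [← intervalIntegral.integral_congr_ae hae, intervalIntegral.integral_add hi hi',
      intervalIntegral.integral_comp_neg, neg_neg]
    ring
  rw [h4] at h3
  linarith

end

/-! ### The limit measure for normalized coins. -/

open ComplexConjugate

/-- The weight of the limit density for normalized coins. -/
def coreWeight (s : ℝ) (a₀ b₀ α β : ℂ) (x : ℝ) : ℝ :=
  x ^ 2 / weightDen s b₀.re x *
    if 0 ≤ x then emission s (-conj b₀ * α + conj a₀ * β) α x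
    else emission s (a₀ * α + b₀ * β) (-β) (-x)

theorem weightDen_neg (s p x : ℝ) : weightDen s p (-x) = weightDen s p x := by
  rw [weightDen, weightDen, neg_sq]

theorem konnoDensity_neg (x r : ℝ) : konnoDensity (-x) r = konnoDensity x r := by
  by_cases hx : x ∈ Set.Ioo (-r) r
  · have hx' : -x ∈ Set.Ioo (-r) r := ⟨by linarith [hx.2], by linarith [hx.1]⟩
    rw [konnoDensity, konnoDensity, Set.indicator_of_mem hx, Set.indicator_of_mem hx', neg_sq]
  · have hx' : -x ∉ Set.Ioo (-r) r := fun h => hx ⟨by linarith [h.2], by linarith [h.1]⟩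
    rw [konnoDensity, konnoDensity, Set.indicator_of_notMem hx, Set.indicator_of_notMem hx']

theorem konnoDensity_eq_zero {x r : ℝ} (hx : x ∉ Set.Ioo (-r) r) : konnoDensity x r = 0 :=
  Set.indicator_of_notMem hx _

theorem konnoDensity_pos {r s : ℝ} (hs : 0 < s) (h : r ^ 2 + s ^ 2 = 1) {x : ℝ}
    (hx : x ∈ Set.Ioo (-r) r) : 0 < konnoDensity x r := by
  have h1 : x ^ 2 < r ^ 2 := sq_lt_sq' hx.1 hx.2
  have h2 : 0 < √(1 - r ^ 2) := Real.sqrt_pos.2 (by nlinarith)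
  have h3 : 0 < √(r ^ 2 - x ^ 2) := Real.sqrt_pos.2 (by linarith)
  have h4 : 0 < 1 - x ^ 2 := by nlinarith
  have := Real.pi_pos
  rw [konnoDensity, Set.indicator_of_mem hx]
  positivity

section
variable {r s : ℝ} {a₀ b₀ : ℂ} (α β : ℂ)

theorem coreWeight_of_pos {x : ℝ} (hx : 0 < x) : coreWeight s a₀ b₀ α β x =
    x ^ 2 / weightDen s b₀.re x * emission s (-conj b₀ * α + conj a₀ * β) α x := by
  rw [coreWeight, if_pos hx.le]

theorem coreWeight_neg_of_pos {x : ℝ} (hx : 0 < x) : coreWeight s a₀ b₀ α β (-x) =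
    x ^ 2 / weightDen s b₀.re x * emission s (a₀ * α + b₀ * β) (-β) x := by
  rw [coreWeight, if_neg (by linarith), weightDen_neg, neg_sq, neg_neg]

theorem coreWeight_nonneg (hs : 0 < s) (h : r ^ 2 + s ^ 2 = 1) (hp : |b₀.re| < 1) {x : ℝ}
    (hx : x ∈ Set.Ioo (-r) r) : 0 ≤ coreWeight s a₀ b₀ α β x := by
  rcases lt_trichotomy x 0 with h0 | h0 | h0
  · have h1 := coreWeight_neg_of_pos (s := s) (a₀ := a₀) (b₀ := b₀) α β (neg_pos.2 h0)
    rw [neg_neg] at h1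
    rw [h1]
    exact mul_nonneg (div_nonneg (sq_nonneg _) (weightDen_pos hp (by linarith)).le)
      (emission_nonneg hs h _ _ (by linarith) (by linarith [hx.1]))
  · simp [h0, coreWeight]
  · rw [coreWeight_of_pos α β h0]
    exact mul_nonneg (div_nonneg (sq_nonneg _) (weightDen_pos hp h0.ne').le)
      (emission_nonneg hs h _ _ h0.le hx.2)

theorem rightDensity_symm (hr : 0 < r) (hs : 0 < s) (h : r ^ 2 + s ^ 2 = 1) (hp : |b₀.re| < 1)
    {k : ℝ} (hk : k ∈ momenta) :
    rightDensity r s a₀ b₀ α β k + rightDensity r s a₀ b₀ α β (-k) =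
      velocity r k ^ 2 / weightDen s b₀.re (velocity r k) *
        emission s (-conj b₀ * α + conj a₀ * β) α (velocity r k) := by
  have hQ : ∀ y, (rightNum a₀ b₀ α β).eval y = (-conj b₀ * α + conj a₀ * β) - α * y := fun y => by
    simp [rightNum]
  exact packetAmp_density hr hs h hp hQ (fun y => by simp [hQ]) 1 0 hk

theorem leftDensity_symm (hr : 0 < r) (hs : 0 < s) (h : r ^ 2 + s ^ 2 = 1) (hp : |b₀.re| < 1)
    {k : ℝ} (hk : k ∈ momenta) :
    leftDensity r s a₀ b₀ α β k + leftDensity r s a₀ b₀ α β (-k) =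
      velocity r k ^ 2 / weightDen s b₀.re (velocity r k) *
        emission s (a₀ * α + b₀ * β) (-β) (velocity r k) := by
  have hQ : ∀ y, (leftNum a₀ b₀ α β).eval y = (a₀ * α + b₀ * β) - -β * y := fun y => by
    simp [leftNum]
  have := packetAmp_density hr hs h hp hQ
    (Q' := -Polynomial.X * leftNum a₀ b₀ α β) (fun y => by simp [hQ]) 1 0 hk
  rw [← this]
  simp only [leftDensity, leftProfile₀, leftProfile₁]
  ring

/-- The ballistic part has the weighted Konno density. -/
theorem ballistic_eq (hr : 0 < r) (hs : 0 < s) (h : r ^ 2 + s ^ 2 = 1) (hp : |b₀.re| < 1)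
    (g : BoundedContinuousFunction ℝ ℝ) :
    IntervalIntegrable (fun x => coreWeight s a₀ b₀ α β x * konnoDensity x r * g x) volume 0 r ∧
    IntervalIntegrable (fun x => coreWeight s a₀ b₀ α β (-x) * konnoDensity x r * g (-x)) volume 0 r ∧
    ballistic r s a₀ b₀ α β g =
      (∫ x in 0..r, coreWeight s a₀ b₀ α β x * konnoDensity x r * g x) +
      ∫ x in 0..r, coreWeight s a₀ b₀ α β (-x) * konnoDensity x r * g (-x) := by
  obtain ⟨M₀, hR₀⟩ := isProfile_packetAmp hr hs h hp (Polynomial.X * rightNum a₀ b₀ α β) 0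
  obtain ⟨M₁, hR₁⟩ := isProfile_packetAmp hr hs h hp (rightNum a₀ b₀ α β) 1
  obtain ⟨M₂, hL₀⟩ := isProfile_packetAmp hr hs h hp (leftNum a₀ b₀ α β) 1
  obtain ⟨M₃, hL₁⟩ := isProfile_packetAmp hr hs h hp (-Polynomial.X * leftNum a₀ b₀ α β) 0
  have hgm : Measurable fun k => g (velocity r k) := g.continuous.measurable.comp (measurable_velocity r)
  have hgm' : Measurable fun k => g (-velocity r k) :=
    g.continuous.measurable.comp (measurable_velocity r).neg
  have hgb : ∀ k, |g (velocity r k)| ≤ ‖g‖ := fun k => g.norm_coe_le_norm _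
  have hgb' : ∀ k, |g (-velocity r k)| ≤ ‖g‖ := fun k => g.norm_coe_le_norm _
  have iR : IntervalIntegrable (fun k => rightDensity r s a₀ b₀ α β k * g (velocity r k)) volume
      (-Real.pi) Real.pi := by
    simp only [rightDensity, add_mul]
    exact (hR₀.intervalIntegrable_mul hgm hgb).add (hR₁.intervalIntegrable_mul hgm hgb)
  have iL : IntervalIntegrable (fun k => leftDensity r s a₀ b₀ α β k * g (-velocity r k)) volume
      (-Real.pi) Real.pi := by
    simp only [leftDensity, add_mul]
    exact (hL₀.intervalIntegrable_mul hgm' hgb').add (hL₁.intervalIntegrable_mul hgm' hgb')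
  obtain ⟨jR, eR⟩ := integral_symm_density hr hs h (W := fun x => x ^ 2 / weightDen s b₀.re x *
    emission s (-conj b₀ * α + conj a₀ * β) α x * g x) (fun k hk => by
      rw [velocity_neg, ← add_mul, rightDensity_symm α β hr hs h hp hk]) iR
  obtain ⟨jL, eL⟩ := integral_symm_density hr hs h (W := fun x => x ^ 2 / weightDen s b₀.re x *
    emission s (a₀ * α + b₀ * β) (-β) x * g (-x)) (fun k hk => by
      rw [velocity_neg, ← add_mul, leftDensity_symm α β hr hs h hp hk]) iL
  have cR : ∀ x ∈ Set.Ioo 0 r, x ^ 2 / weightDen s b₀.re x *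
      emission s (-conj b₀ * α + conj a₀ * β) α x * g x * konnoDensity x r =
        coreWeight s a₀ b₀ α β x * konnoDensity x r * g x := fun x hx => by
    rw [coreWeight_of_pos α β hx.1]; ring
  have cL : ∀ x ∈ Set.Ioo 0 r, x ^ 2 / weightDen s b₀.re x *
      emission s (a₀ * α + b₀ * β) (-β) x * g (-x) * konnoDensity x r =
        coreWeight s a₀ b₀ α β (-x) * konnoDensity x r * g (-x) := fun x hx => by
    rw [coreWeight_neg_of_pos α β hx.1]; ring
  refine ⟨?_, ?_, ?_⟩
  · rw [intervalIntegrable_iff_integrableOn_Ioo_of_le hr.le]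
    exact jR.congr_fun cR measurableSet_Ioo
  · rw [intervalIntegrable_iff_integrableOn_Ioo_of_le hr.le]
    exact jL.congr_fun cL measurableSet_Ioo
  · rw [ballistic, intervalIntegral.integral_add iR iL, mul_add, eR, eL,
      intervalIntegral.integral_of_le hr.le, intervalIntegral.integral_of_le hr.le,
      integral_Ioc_eq_integral_Ioo, integral_Ioc_eq_integral_Ioo,
      setIntegral_congr_fun measurableSet_Ioo cR, setIntegral_congr_fun measurableSet_Ioo cL]

theorem ballistic_eq_integral (hr : 0 < r) (hs : 0 < s) (h : r ^ 2 + s ^ 2 = 1) (hp : |b₀.re| < 1)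
    (g : BoundedContinuousFunction ℝ ℝ) :
    Integrable (fun x => coreWeight s a₀ b₀ α β x * konnoDensity x r * g x) ∧
    ballistic r s a₀ b₀ α β g = ∫ x, coreWeight s a₀ b₀ α β x * konnoDensity x r * g x := by
  obtain ⟨i1, i2, e1⟩ := ballistic_eq α β hr hs h hp g
  set f : ℝ → ℝ := fun x => coreWeight s a₀ b₀ α β x * konnoDensity x r * g x with hf
  have hfneg : (fun x => coreWeight s a₀ b₀ α β (-x) * konnoDensity x r * g (-x)) = fun x => f (-x) := by
    ext x
    rw [hf]
    simp only [konnoDensity_neg]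
  rw [hfneg] at i2 e1
  have i3 : IntervalIntegrable f volume (-r) 0 := by
    have := (IntervalIntegrable.iff_comp_neg (f := fun x => f (-x)) (a := 0) (b := r)).1 i2
    simpa using this.symm
  have hsupp : ∀ x, x ∉ Set.Ioc (-r) r → f x = 0 := fun x hx => by
    simp only [hf, konnoDensity_eq_zero fun h0 => hx ⟨h0.1, h0.2.le⟩, mul_zero, zero_mul]
  have i4 : IntegrableOn f (Set.Ioc (-r) r) :=
    (intervalIntegrable_iff_integrableOn_Ioc_of_le (by linarith)).1 (i3.trans i1)
  refine ⟨(integrableOn_iff_integrable_of_support_subset fun x hx => ?_).1 i4, ?_⟩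
  · by_contra h0
    exact hx (hsupp x h0)
  · rw [e1, intervalIntegral.integral_comp_neg, neg_zero, add_comm,
      intervalIntegral.integral_add_adjacent_intervals i3 i1,
      intervalIntegral.integral_of_le (by linarith)]
    exact setIntegral_eq_integral_of_forall_compl_eq_zero hsupp

/-- The ballistic part is not zero. -/
theorem ballistic_one_pos (hr : 0 < r) (hs : 0 < s) (h : r ^ 2 + s ^ 2 = 1) (hp : |b₀.re| < 1)
    (hαβ : ‖α‖ ^ 2 + ‖β‖ ^ 2 = 1) : 0 < ballistic r s a₀ b₀ α β 1 := by
  obtain ⟨i1, i2, e1⟩ := ballistic_eq (a₀ := a₀) α β hr hs h hp 1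
  simp only [BoundedContinuousFunction.coe_one, Pi.one_apply, mul_one] at i1 i2 e1
  rw [e1, ← intervalIntegral.integral_add i1 i2]
  refine intervalIntegral.intervalIntegral_pos_of_pos_on (i1.add i2) (fun x hx => ?_) hr
  have hx' : x ∈ Set.Ioo (-r) r := ⟨by linarith [hx.1], hx.2⟩
  have h1 := konnoDensity_pos hs h hx'
  have h2 : 0 < x ^ 2 / weightDen s b₀.re x := div_pos (pow_pos hx.1 2) (weightDen_pos hp hx.1.ne')
  have h3 := emission_nonneg hs h (-conj b₀ * α + conj a₀ * β) α hx.1.le hx.2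
  have h4 := emission_nonneg hs h (a₀ * α + b₀ * β) (-β) hx.1.le hx.2
  -- One side may emit nothing, but `α` and `β` are not both zero, so the two sides together emit at
  -- every velocity.
  have h5 : 0 < emission s (-conj b₀ * α + conj a₀ * β) α x + emission s (a₀ * α + b₀ * β) (-β) x := by
    by_cases hα : α = 0
    · have hβ : -β ≠ 0 := by
        rintro h0
        rw [neg_eq_zero] at h0
        simp [hα, h0] at hαβ
      exact add_pos_of_nonneg_of_pos h3 (emission_pos hs h _ hβ hx.1.le hx.2)
    · exact add_pos_of_pos_of_nonneg (emission_pos hs h _ hα hx.1.le hx.2) h4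
  rw [coreWeight_of_pos α β hx.1, coreWeight_neg_of_pos α β hx.1, ← add_mul, ← mul_add]
  positivity

theorem isPiecewiseRational_coreWeight (hp : |b₀.re| < 1) (c : ℝ) :
    IsPiecewiseRational fun x => c * coreWeight s a₀ b₀ α β x := by
  have hp2 : 0 < 1 - b₀.re ^ 2 := by nlinarith [abs_lt.1 hp]
  set q : Polynomial ℝ := Polynomial.C ((s - b₀.re) ^ 2) + Polynomial.C (1 - b₀.re ^ 2) * Polynomial.X ^ 2
  have hq : ∀ x, q.eval x = weightDen s b₀.re x := fun x => by simp [q, weightDen]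
  have hq0 : q ≠ 0 := fun h0 => by
    have := hq 1
    rw [h0, Polynomial.eval_zero] at this
    exact (weightDen_pos (s := s) hp one_ne_zero).ne this
  set E : ℂ → ℂ → ℝ → Polynomial ℝ := fun A a t =>
    (1 + Polynomial.C t * Polynomial.X) * Polynomial.C (‖A‖ ^ 2) +
    (1 - Polynomial.C t * Polynomial.X) * Polynomial.C (‖a‖ ^ 2) +
    Polynomial.C (2 * s * (conj a * A).re) with hE
  have hEe : ∀ A a t x, (E A a t).eval x = emission s A a (t * x) := fun A a t x => by
    simp only [hE, emission, Polynomial.eval_add, Polynomial.eval_mul, Polynomial.eval_sub,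
      Polynomial.eval_C, Polynomial.eval_X, Polynomial.eval_one]
  refine ⟨Polynomial.C c * (Polynomial.X ^ 2 * E (-conj b₀ * α + conj a₀ * β) α 1), q,
    Polynomial.C c * (Polynomial.X ^ 2 * E (a₀ * α + b₀ * β) (-β) (-1)), q, hq0, hq0,
    fun x hx => ?_, fun x hx => ?_⟩
  · show c * coreWeight s a₀ b₀ α β x = _
    rw [coreWeight, if_pos hx, hq, Polynomial.eval_mul, Polynomial.eval_mul, hEe,
      Polynomial.eval_C, Polynomial.eval_pow, Polynomial.eval_X, one_mul]
    ring
  · show c * coreWeight s a₀ b₀ α β x = _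
    rw [coreWeight, if_neg hx.not_ge, hq, Polynomial.eval_mul, Polynomial.eval_mul, hEe,
      Polynomial.eval_C, Polynomial.eval_pow, Polynomial.eval_X, neg_one_mul]
    ring

theorem coreWeight_mul_konnoDensity_nonneg (hs : 0 < s) (h : r ^ 2 + s ^ 2 = 1)
    (hp : |b₀.re| < 1) (x : ℝ) : 0 ≤ coreWeight s a₀ b₀ α β x * konnoDensity x r := by
  by_cases hx : x ∈ Set.Ioo (-r) r
  · exact mul_nonneg (coreWeight_nonneg α β hs h hp hx) (konnoDensity_pos hs h hx).le
  · rw [konnoDensity_eq_zero hx, mul_zero]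

theorem integrable_coreWeight (hr : 0 < r) (hs : 0 < s) (h : r ^ 2 + s ^ 2 = 1) (hp : |b₀.re| < 1) :
    Integrable (fun x => coreWeight s a₀ b₀ α β x * konnoDensity x r) ∧
    ballistic r s a₀ b₀ α β 1 = ∫ x, coreWeight s a₀ b₀ α β x * konnoDensity x r := by
  have := ballistic_eq_integral (a₀ := a₀) α β hr hs h hp 1
  simpa using this

theorem konnoMeasure_coreWeight_univ (hr : 0 < r) (hs : 0 < s) (h : r ^ 2 + s ^ 2 = 1)
    (hp : |b₀.re| < 1) (hC : 0 ≤ 1 - ballistic r s a₀ b₀ α β 1) :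
    konnoMeasure (1 - ballistic r s a₀ b₀ α β 1) r (coreWeight s a₀ b₀ α β) Set.univ = 1 := by
  obtain ⟨i1, e1⟩ := integrable_coreWeight (a₀ := a₀) α β hr hs h hp
  have h0 := coreWeight_mul_konnoDensity_nonneg (a₀ := a₀) α β hs h hp
  have h1 : 0 ≤ ballistic r s a₀ b₀ α β 1 := by
    rw [e1]; exact integral_nonneg h0
  rw [konnoMeasure, Measure.add_apply, Measure.smul_apply, measure_univ, smul_eq_mul, mul_one,
    withDensity_apply _ MeasurableSet.univ, Measure.restrict_univ,
    ← ofReal_integral_eq_lintegral_ofReal i1 (ae_of_all _ h0), ← e1, ← ENNReal.ofReal_add hC h1,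
    sub_add_cancel, ENNReal.ofReal_one]

theorem integral_konnoMeasure_coreWeight (hr : 0 < r) (hs : 0 < s) (h : r ^ 2 + s ^ 2 = 1)
    (hp : |b₀.re| < 1) (hC : 0 ≤ 1 - ballistic r s a₀ b₀ α β 1)
    (g : BoundedContinuousFunction ℝ ℝ) :
    ∫ x, g x ∂konnoMeasure (1 - ballistic r s a₀ b₀ α β 1) r (coreWeight s a₀ b₀ α β) =
      (1 - ballistic r s a₀ b₀ α β 1) * g 0 + ballistic r s a₀ b₀ α β g := by
  have hfin : IsFiniteMeasure
      (konnoMeasure (1 - ballistic r s a₀ b₀ α β 1) r (coreWeight s a₀ b₀ α β)) :=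
    ⟨by rw [konnoMeasure_coreWeight_univ α β hr hs h hp hC]; exact ENNReal.one_lt_top⟩
  have hg := g.integrable (konnoMeasure (1 - ballistic r s a₀ b₀ α β 1) r (coreWeight s a₀ b₀ α β))
  rw [konnoMeasure] at hg ⊢
  obtain ⟨g1, g2⟩ := integrable_add_measure.1 hg
  obtain ⟨i1, -⟩ := integrable_coreWeight (a₀ := a₀) α β hr hs h hp
  have hm : AEMeasurable (fun x => (coreWeight s a₀ b₀ α β x * konnoDensity x r).toNNReal) :=
    i1.aestronglyMeasurable.aemeasurable.real_toNNReal
  rw [integral_add_measure g1 g2, integral_smul_measure, integral_dirac,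
    ENNReal.toReal_ofReal hC, smul_eq_mul, (ballistic_eq_integral α β hr hs h hp g).2]
  congr 1
  simp only [ENNReal.ofReal]
  rw [integral_withDensity_eq_integral_smul₀ hm]
  congr 1
  ext x
  rw [NNReal.smul_def, Real.coe_toNNReal _ (coreWeight_mul_konnoDensity_nonneg α β hs h hp x),
    smul_eq_mul]

end

/-! ### Gauge transformation to normalized coins. -/

open ComplexConjugate

section coin
variable (U : Coin)

theorem coin_norm_row : ‖U.a‖ ^ 2 + ‖U.b‖ ^ 2 = 1 := by
  have h00 := congrFun (congrFun (Matrix.mem_unitaryGroup_iff.1 U.2) 0) 0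
  simp only [Matrix.mul_apply, Fin.sum_univ_two, Matrix.star_apply, Matrix.one_apply,
    RCLike.star_def] at h00
  have : ((‖U.a‖ ^ 2 + ‖U.b‖ ^ 2 : ℝ) : ℂ) = 1 := by
    push_cast
    rw [← Complex.mul_conj', ← Complex.mul_conj']
    simpa [Coin.a, Coin.b] using h00
  exact_mod_cast this

theorem coin_mul_conj : U.a * conj U.a + U.b * conj U.b = 1 := by
  rw [Complex.mul_conj', Complex.mul_conj']
  exact_mod_cast coin_norm_row U

theorem coin_orthogonal : U.c * conj U.a + U.d * conj U.b = 0 := by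
  have h10 := congrFun (congrFun (Matrix.mem_unitaryGroup_iff.1 U.2) 1) 0
  simp only [Matrix.mul_apply, Fin.sum_univ_two, Matrix.star_apply, Matrix.one_apply,
    RCLike.star_def] at h10
  simpa [Coin.a, Coin.b, Coin.c, Coin.d] using h10

theorem coin_det : U.Δ = U.a * U.d - U.b * U.c := Matrix.det_fin_two _

/-- The inverse of a unitary matrix is its adjoint and also its adjugate divided by the determinant;
`coin_c` is the other entry. -/
theorem coin_d : U.d = U.Δ * conj U.a := by
  rw [coin_det]
  linear_combination -U.d * coin_mul_conj U + U.b * coin_orthogonal U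

theorem coin_c : U.c = -(U.Δ * conj U.b) := by
  rw [coin_det]
  linear_combination -U.c * coin_mul_conj U + U.a * coin_orthogonal U

theorem coin_norm_det : ‖U.Δ‖ = 1 := by
  have h1 := coin_norm U 1 0
  have h2 := coin_norm_row U
  have h3 := congrArg norm (coin_c U)
  rw [norm_neg, norm_mul, RCLike.norm_conj] at h3
  have h4 := congrArg norm (coin_d U)
  rw [norm_mul, RCLike.norm_conj] at h4
  have h5 := coin_norm U 0 1
  simp only [mul_one, mul_zero, add_zero, zero_add, norm_one, norm_zero] at h1 h5
  have h6 : ‖U.Δ‖ ^ 2 = 1 := by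
    rw [h3] at h1
    rw [h4] at h5
    nlinarith
  exact (pow_eq_one_iff_of_nonneg (norm_nonneg _) two_ne_zero).1 h6

theorem coin_norm_c : ‖U.c‖ = ‖U.b‖ := by
  rw [coin_c, norm_neg, norm_mul, RCLike.norm_conj, coin_norm_det, one_mul]

end coin

theorem conj_eq_inv_of_norm_one {z : ℂ} (hz : ‖z‖ = 1) : conj z = z⁻¹ := by
  rw [Complex.inv_def, Complex.normSq_eq_norm_sq, hz]; simp

/-- Identifies the emission form with `gammaFun` and the linear term of `weight`; the relation
`|a₀|² + |b₀|² = 1` rewrites the coefficient of `x`. -/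
theorem emission_right {s : ℝ} {a₀ b₀ : ℂ} (h₀ : ‖a₀‖ ^ 2 + ‖b₀‖ ^ 2 = 1) (α β : ℂ) (x : ℝ) :
    emission s (-conj b₀ * α + conj a₀ * β) α x =
      ‖α‖ ^ 2 * (1 - 2 * (s * b₀.re) + ‖b₀‖ ^ 2) + ‖β‖ ^ 2 * ‖a₀‖ ^ 2 +
        2 * (a₀ * α * conj ((s - b₀) * β)).re -
      (‖a₀‖ ^ 2 * (‖α‖ ^ 2 - ‖β‖ ^ 2) + 2 * (a₀ * α * conj (b₀ * β)).re) * x := by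
  rw [emission]
  simp only [← Complex.normSq_eq_norm_sq, Complex.normSq_apply, Complex.sub_re, Complex.sub_im,
    Complex.mul_re, Complex.mul_im, Complex.conj_re, Complex.conj_im, Complex.add_re, Complex.add_im,
    Complex.neg_re, Complex.neg_im, Complex.ofReal_re, Complex.ofReal_im] at h₀ ⊢
  linear_combination x * (α.re * α.re + α.im * α.im) * h₀

theorem emission_left {s : ℝ} {a₀ b₀ : ℂ} (h₀ : ‖a₀‖ ^ 2 + ‖b₀‖ ^ 2 = 1) (α β : ℂ) (x : ℝ) :
    emission s (a₀ * α + b₀ * β) (-β) (-x) =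
      ‖β‖ ^ 2 * (1 - 2 * (s * b₀.re) + ‖b₀‖ ^ 2) + ‖α‖ ^ 2 * ‖a₀‖ ^ 2 -
        2 * (a₀ * α * conj ((s - b₀) * β)).re -
      (‖a₀‖ ^ 2 * (‖α‖ ^ 2 - ‖β‖ ^ 2) + 2 * (a₀ * α * conj (b₀ * β)).re) * x := by
  rw [emission]
  simp only [← Complex.normSq_eq_norm_sq, Complex.normSq_apply, Complex.sub_re, Complex.sub_im,
    Complex.mul_re, Complex.mul_im, Complex.conj_re, Complex.conj_im, Complex.add_re, Complex.add_im,
    Complex.neg_re, Complex.neg_im, Complex.ofReal_re, Complex.ofReal_im] at h₀ ⊢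
  linear_combination -x * (β.re * β.re + β.im * β.im) * h₀

/-- A gauge transformation to normalized coins. -/
structure IsGauge (U : Coin) (δ u κ : ℂ) : Prop where
  sq : δ ^ 2 = U.Δ
  norm_δ : ‖δ‖ = 1
  norm_u : ‖u‖ = 1
  norm_κ : ‖κ‖ = 1
  a_eq : U.a * (u / δ) = ‖U.a‖
  b_eq : U.b * (κ * (u / δ)) = ‖U.c‖

theorem exists_isGauge (U : Coin) (ha : U.a ≠ 0) (hc : U.c ≠ 0) : ∃ δ u κ, IsGauge U δ u κ := by
  obtain ⟨δ, hδ⟩ : ∃ δ : ℂ, δ ^ 2 = U.Δ := IsAlgClosed.exists_pow_nat_eq _ two_pos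
  have hδ1 : ‖δ‖ = 1 := by
    have := congrArg norm hδ
    rw [norm_pow, coin_norm_det] at this
    exact (pow_eq_one_iff_of_nonneg (norm_nonneg _) two_ne_zero).1 this
  have hδ0 : δ ≠ 0 := norm_ne_zero_iff.1 (by rw [hδ1]; exact one_ne_zero)
  have ha' : (‖U.a‖ : ℂ) ≠ 0 := by exact_mod_cast norm_ne_zero_iff.2 ha
  have hc' : (‖U.c‖ : ℂ) ≠ 0 := by exact_mod_cast norm_ne_zero_iff.2 hc
  have hb : U.b ≠ 0 := norm_ne_zero_iff.1 (by rw [← coin_norm_c]; exact norm_ne_zero_iff.2 hc)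
  have hu : ‖δ * (‖U.a‖ / U.a)‖ = 1 := by
    rw [norm_mul, norm_div, Complex.norm_real, norm_norm, div_self (norm_ne_zero_iff.2 ha), hδ1, one_mul]
  -- The ratio `u / δ` removes the phase of `a`, and `κ` then removes what is left of the phase of
  -- `b`.
  refine ⟨δ, δ * (‖U.a‖ / U.a), ‖U.c‖ / U.b * (‖U.a‖ / U.a)⁻¹, hδ, hδ1, hu, ?_, ?_, ?_⟩
  · rw [norm_mul, norm_inv, norm_div, norm_div, Complex.norm_real, Complex.norm_real, norm_norm,
      norm_norm, coin_norm_c, div_self (norm_ne_zero_iff.2 ha), div_self (norm_ne_zero_iff.2 hb)]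
    simp
  · field_simp
  · field_simp

namespace IsGauge
variable {U U₀ : Coin} {δ u κ : ℂ}

theorem norm_ratio (G : IsGauge U δ u κ) : ‖u / δ‖ = 1 := by
  rw [norm_div, G.norm_u, G.norm_δ, div_one]

theorem δ_ne (G : IsGauge U δ u κ) : δ ≠ 0 :=
  norm_ne_zero_iff.1 (by rw [G.norm_δ]; exact one_ne_zero)

theorem u_ne (G : IsGauge U δ u κ) : u ≠ 0 :=
  norm_ne_zero_iff.1 (by rw [G.norm_u]; exact one_ne_zero)

theorem κ_ne (G : IsGauge U δ u κ) : κ ≠ 0 :=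
  norm_ne_zero_iff.1 (by rw [G.norm_κ]; exact one_ne_zero)

/-- The gauge transformation of a coin with the same determinant. -/
theorem coin_entries (G : IsGauge U δ u κ) {V : Coin} (hV : U.Δ = V.Δ) :
    V.a * u = δ * (V.a * (u / δ)) ∧ V.b * κ * u = δ * (V.b * (κ * (u / δ))) ∧
    V.c = δ * u * κ * -conj (V.b * (κ * (u / δ))) ∧ V.d = δ * u * conj (V.a * (u / δ)) := by
  have h1 := G.δ_ne
  have h2 := G.u_ne
  have h3 := G.κ_ne
  refine ⟨by field_simp, by field_simp, ?_, ?_⟩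
  · rw [coin_c, ← hV, ← G.sq, map_mul, map_mul, conj_eq_inv_of_norm_one G.norm_κ,
      conj_eq_inv_of_norm_one G.norm_ratio]
    field_simp
  · rw [coin_d, ← hV, ← G.sq, map_mul, conj_eq_inv_of_norm_one G.norm_ratio]
    field_simp

/-- A phase `δ` per time step, `u` per site and `κ` on the right chirality normalizes the bulk coin.
Since the determinants agree, the same phases bring the defect coin to determinant one. At the
origin only `κ` acts, whence `β / κ`. -/
theorem evolve_eq (G : IsGauge U δ u κ) (hdet : U.Δ = U₀.Δ) (α β : ℂ) (n : ℕ) :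
    evolve (oneDefect U U₀) (originState α β) n = fun x =>
      ![δ ^ n * u ^ x * (coreStep ‖U.a‖ ‖U.c‖ (U₀.a * (u / δ)) (U₀.b * (κ * (u / δ))))^[n]
          (originState α (β / κ)) x 0,
        δ ^ n * u ^ x * (κ * (coreStep ‖U.a‖ ‖U.c‖ (U₀.a * (u / δ)) (U₀.b * (κ * (u / δ))))^[n]
          (originState α (β / κ)) x 1)] := by
  have h1 := G.δ_ne
  have h2 := G.u_ne
  have h3 := G.κ_ne
  induction n with
  | zero =>
    funext x
    by_cases hx : x = 0
    · subst hx
      have : κ * (β / κ) = β := by field_simp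
      simp [evolve, originState, this]
    · ext j
      fin_cases j <;> simp [evolve, originState, hx]
  | succ n ih =>
    rw [evolve, Function.iterate_succ_apply', ← evolve, ih]
    simp only [Function.iterate_succ_apply']
    set Φ := (coreStep ‖U.a‖ ‖U.c‖ (U₀.a * (u / δ)) (U₀.b * (κ * (u / δ))))^[n]
      (originState α (β / κ))
    obtain ⟨e1, e2, e3, e4⟩ := G.coin_entries rfl
    obtain ⟨f1, f2, f3, f4⟩ := G.coin_entries hdet
    rw [G.a_eq] at e1 e4
    rw [G.b_eq] at e2 e3
    rw [Complex.conj_ofReal] at e3 e4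
    generalize U₀.a * (u / δ) = A at *
    generalize U₀.b * (κ * (u / δ)) = B at *
    funext x
    have hp : u ^ (x + 1) = u ^ x * u := zpow_add_one₀ h2 x
    have hm : u ^ x = u ^ (x - 1) * u := by rw [← zpow_add_one₀ h2, sub_add_cancel]
    have hL : (oneDefect U U₀ (x + 1)).a * u = δ * (if x + 1 = 0 then A else ‖U.a‖) ∧
        (oneDefect U U₀ (x + 1)).b * κ * u = δ * (if x + 1 = 0 then B else ‖U.c‖) := by
      by_cases hx : x + 1 = 0
      · simp only [oneDefect, if_pos hx]; exact ⟨f1, f2⟩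
      · simp only [oneDefect, if_neg hx]; exact ⟨e1, e2⟩
    have hR : (oneDefect U U₀ (x - 1)).c = δ * u * κ * (if x - 1 = 0 then -conj B else -‖U.c‖) ∧
        (oneDefect U U₀ (x - 1)).d = δ * u * (if x - 1 = 0 then conj A else ‖U.a‖) := by
      by_cases hx : x - 1 = 0
      · simp only [oneDefect, if_pos hx]; exact ⟨f3, f4⟩
      · simp only [oneDefect, if_neg hx]; exact ⟨e3, e4⟩
    ext j
    fin_cases j
    · simp only [step, coreStep, Fin.zero_eta, Matrix.cons_val_zero, Matrix.cons_val_one]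
      rw [hp]
      linear_combination δ ^ n * u ^ x * Φ (x + 1) 0 * hL.1 + δ ^ n * u ^ x * Φ (x + 1) 1 * hL.2
    · simp only [step, coreStep, Fin.mk_one, Matrix.cons_val_zero, Matrix.cons_val_one]
      rw [hm, hR.1, hR.2]
      ring

theorem prob_eq (G : IsGauge U δ u κ) (hdet : U.Δ = U₀.Δ) (α β : ℂ) (n : ℕ) (x : ℤ) :
    prob (oneDefect U U₀) (originState α β) n x = siteWeight
      ((coreStep ‖U.a‖ ‖U.c‖ (U₀.a * (u / δ)) (U₀.b * (κ * (u / δ))))^[n]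
        (originState α (β / κ))) x := by
  rw [prob, G.evolve_eq hdet]
  simp [siteWeight, G.norm_δ, G.norm_u, G.norm_κ]

/-- The moduli and the cross terms in `weight` are gauge invariant and `m = s Re b₀` for the
transformed `b₀`, so a common factor `s²` cancels from the quotient and `|a₀|²` from the linear
term. -/
theorem weight_eq (G : IsGauge U δ u κ) (hdet : U.Δ = U₀.Δ) (hc : U.c ≠ 0) (ha₀ : U₀.a ≠ 0) (α β : ℂ) :
    weight U U₀ α β =
      coreWeight ‖U.c‖ (U₀.a * (u / δ)) (U₀.b * (κ * (u / δ))) α (β / κ) := by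
  have h1 := G.δ_ne
  have h2 := G.u_ne
  have h3 := G.κ_ne
  have ht := G.norm_ratio
  have ht0 : u / δ ≠ 0 := div_ne_zero h2 h1
  have na : ‖U₀.a * (u / δ)‖ = ‖U₀.a‖ := by rw [norm_mul, ht, mul_one]
  have nb : ‖U₀.b * (κ * (u / δ))‖ = ‖U₀.c‖ := by
    rw [norm_mul, norm_mul, ht, G.norm_κ, mul_one, mul_one, coin_norm_c]
  have nβ : ‖β / κ‖ = ‖β‖ := by rw [norm_div, G.norm_κ, div_one]
  have h₀ : ‖U₀.a * (u / δ)‖ ^ 2 + ‖U₀.b * (κ * (u / δ))‖ ^ 2 = 1 := by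
    rw [na, nb, coin_norm_c, coin_norm_row]
  have hcross : ∀ z : ℂ, U₀.a * (u / δ) * α * conj (z * (κ * (u / δ)) * (β / κ)) =
      U₀.a * α * conj (z * β) := fun z => by
    rw [show z * (κ * (u / δ)) * (β / κ) = z * β * (u / δ) by field_simp, map_mul (starRingEnd ℂ) (z * β),
      conj_eq_inv_of_norm_one ht]
    field_simp
  have hm : defectParam U U₀ = ‖U.c‖ * (U₀.b * (κ * (u / δ))).re := by
    have e1 : conj U.c * U₀.c = U.b * conj U₀.b := by
      rw [coin_c U, coin_c U₀, ← hdet, map_neg, map_mul, Complex.conj_conj]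
      have : conj U.Δ * U.Δ = 1 := by
        rw [mul_comm, Complex.mul_conj', coin_norm_det]; simp
      linear_combination U.b * conj U₀.b * this
    have e2 : U.b * conj U₀.b = ‖U.c‖ * conj (U₀.b * (κ * (u / δ))) := by
      rw [← G.b_eq, map_mul, map_mul, conj_eq_inv_of_norm_one G.norm_κ, conj_eq_inv_of_norm_one ht]
      field_simp
    rw [defectParam, e1, e2, Complex.re_ofReal_mul, Complex.conj_re]
  have hc0 : ‖U.c‖ ≠ 0 := norm_ne_zero_iff.2 hc
  have ha0 : ‖U₀.a‖ ^ 2 ≠ 0 := pow_ne_zero 2 (norm_ne_zero_iff.2 ha₀)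
  have hs : ((‖U.c‖ : ℝ) : ℂ) - U₀.b * (κ * (u / δ)) = (U.b - U₀.b) * (κ * (u / δ)) := by
    rw [← G.b_eq]; ring
  funext x
  rw [weight, coreWeight, gammaFun]
  have hden : ‖U.c‖ ^ 2 * x ^ 2 / ((‖U.c‖ ^ 2 - defectParam U U₀) ^ 2 +
      (‖U.c‖ ^ 2 - defectParam U U₀ ^ 2) * x ^ 2) =
        x ^ 2 / weightDen ‖U.c‖ (U₀.b * (κ * (u / δ))).re x := by
    have : (‖U.c‖ ^ 2 - defectParam U U₀) ^ 2 + (‖U.c‖ ^ 2 - defectParam U U₀ ^ 2) * x ^ 2 =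
        ‖U.c‖ ^ 2 * weightDen ‖U.c‖ (U₀.b * (κ * (u / δ))).re x := by
      rw [hm, weightDen]; ring
    rw [this, mul_div_mul_left _ _ (pow_ne_zero 2 hc0)]
  rw [hden, mul_add (‖U₀.a‖ ^ 2), mul_div_cancel₀ _ ha0]
  congr 1
  split_ifs with hx
  · rw [emission_right h₀, na, nb, nβ, hs, hcross, hcross, ← hm]
  · rw [emission_left h₀, na, nb, nβ, hs, hcross, hcross, ← hm]

end IsGauge

/-! ### The limit theorem for the original walk. -/

theorem integral_rescaledLaw (V : ℤ → Coin) (Ψ₀ : UnitState) (n : ℕ)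
    (g : BoundedContinuousFunction ℝ ℝ) :
    ∫ x, g x ∂(rescaledLaw V Ψ₀ n : Measure ℝ) = ∑' x : ℤ, prob V Ψ₀.1 n x * g (x / n) := by
  have hm : Measurable fun x : ℤ => (x : ℝ) / (n : ℝ) := measurable_of_countable _
  rw [rescaledLaw, ProbabilityMeasure.toMeasure_map, integral_map hm.aemeasurable
    g.continuous.aestronglyMeasurable]
  have hi : Integrable (fun x : ℤ => g ((x : ℝ) / n)) (positionLaw V Ψ₀ n : Measure ℤ) :=
    Integrable.of_bound (measurable_of_countable _).aestronglyMeasurable ‖g‖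
      (ae_of_all _ fun x => g.norm_coe_le_norm _)
  rw [positionLaw, ProbabilityMeasure.coe_mk] at hi ⊢
  rw [integral_sum_measure hi]
  refine tsum_congr fun x => ?_
  rw [integral_smul_measure, integral_dirac, ENNReal.toReal_ofReal, smul_eq_mul]
  unfold prob siteWeight
  positivity

end QuantumWalk

end

open QuantumWalk in
theorem theorem4p1 (U U₀ : Coin) (hdet : U.Δ = U₀.Δ)
    (ha : U.a ≠ 0) (hc : U.c ≠ 0) (ha₀ : U₀.a ≠ 0)
    (α β : ℂ) (hαβ : ‖α‖ ^ 2 + ‖β‖ ^ 2 = 1) :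
    ∃ (μ : ℤ → ℝ) (C : ℝ) (ν : ProbabilityMeasure ℝ),
      IsTimeAveragedLimit (oneDefect U U₀) (originState α β) μ ∧
      HasSum μ C ∧ 0 ≤ C ∧ C < 1 ∧
      (∀ x ∈ Set.Ioo (-‖U.a‖) ‖U.a‖, 0 ≤ weight U U₀ α β x) ∧
      (ν : Measure ℝ) = konnoMeasure C ‖U.a‖ (weight U U₀ α β) ∧
      HasWeakLimit (oneDefect U U₀) ⟨originState α β, originState_isNormalized hαβ⟩ ν ∧
      ν ∈ konnoClass (oneDefect U U₀) := by
  obtain ⟨δ, u, κ, G⟩ := exists_isGauge U ha hc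
  have hr : 0 < ‖U.a‖ := norm_pos_iff.2 ha
  have hs : 0 < ‖U.c‖ := norm_pos_iff.2 hc
  have h : ‖U.a‖ ^ 2 + ‖U.c‖ ^ 2 = 1 := by rw [coin_norm_c, coin_norm_row]
  have hr1 : ‖U.a‖ < 1 := by nlinarith
  have hw := G.weight_eq hdet hc ha₀ α β
  have hprob := G.prob_eq hdet α β
  have na : ‖U₀.a * (u / δ)‖ = ‖U₀.a‖ := by rw [norm_mul, G.norm_ratio, mul_one]
  have nb : ‖U₀.b * (κ * (u / δ))‖ = ‖U₀.b‖ := by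
    rw [norm_mul, norm_mul, G.norm_ratio, G.norm_κ, mul_one, mul_one]
  have h₀ : ‖U₀.a * (u / δ)‖ ^ 2 + ‖U₀.b * (κ * (u / δ))‖ ^ 2 = 1 := by
    rw [na, nb, coin_norm_row]
  -- This is where `a₀ ≠ 0` enters: it forces `|b₀| < 1`.
  have hp : |(U₀.b * (κ * (u / δ))).re| < 1 := by
    refine (Complex.abs_re_le_norm _).trans_lt ?_
    have := norm_pos_iff.2 ha₀
    rw [na] at h₀
    nlinarith [norm_nonneg (U₀.b * (κ * (u / δ)))]
  have hαβ' : ‖α‖ ^ 2 + ‖β / κ‖ ^ 2 = 1 := by rw [norm_div, G.norm_κ, div_one, hαβ]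
  have hn := evolve_isNormalized (U := oneDefect U U₀) (originState_isNormalized hαβ)
  have hsw : ∀ n, siteWeight (evolve (oneDefect U U₀) (originState α β) n) = siteWeight
      ((coreStep ‖U.a‖ ‖U.c‖ (U₀.a * (u / δ)) (U₀.b * (κ * (u / δ))))^[n]
        (originState α (β / κ))) := fun n => funext fun x => hprob n x
  obtain ⟨⟨μ, hμ, hμC⟩, hlim⟩ := coreStep_limit α (β / κ) hr hs h hp h₀ fun n => by
    rw [IsNormalized, ← hsw]
    exact hn n
  simp_rw [← hprob] at hμ hlim
  generalize U₀.a * (u / δ) = a₀ at *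
  generalize U₀.b * (κ * (u / δ)) = b₀ at *
  generalize β / κ = β' at *
  have hC : 0 ≤ 1 - ballistic ‖U.a‖ ‖U.c‖ a₀ b₀ α β' 1 := by
    refine hμC.nonneg fun x => ge_of_tendsto' (hμ x) fun T => ?_
    have : ∀ n, 0 ≤ prob (oneDefect U U₀) (originState α β) n x := fun n => by
      unfold prob siteWeight
      positivity
    exact mul_nonneg (by positivity) (Finset.sum_nonneg fun n _ => this n)
  have hC1 := ballistic_one_pos (a₀ := a₀) α β' hr hs h hp hαβ'
  set ν : ProbabilityMeasure ℝ := ⟨konnoMeasure (1 - ballistic ‖U.a‖ ‖U.c‖ a₀ b₀ α β' 1) ‖U.a‖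
    (coreWeight ‖U.c‖ a₀ b₀ α β'), ⟨konnoMeasure_coreWeight_univ α β' hr hs h hp hC⟩⟩ with hν
  have hweak : HasWeakLimit (oneDefect U U₀) ⟨originState α β, originState_isNormalized hαβ⟩ ν := by
    refine ProbabilityMeasure.tendsto_iff_forall_integral_tendsto.2 fun g => ?_
    simp_rw [integral_rescaledLaw]
    rw [hν, ProbabilityMeasure.coe_mk, integral_konnoMeasure_coreWeight α β' hr hs h hp hC g]
    exact hlim g
  refine ⟨μ, 1 - ballistic ‖U.a‖ ‖U.c‖ a₀ b₀ α β' 1, ν, fun x => ?_, hμC, hC, by linarith,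
    fun x hx => ?_, ?_, hweak, ⟨_, hweak⟩, 1 - ballistic ‖U.a‖ ‖U.c‖ a₀ b₀ α β' 1, ‖U.a‖,
    fun x => (ballistic ‖U.a‖ ‖U.c‖ a₀ b₀ α β' 1)⁻¹ * coreWeight ‖U.c‖ a₀ b₀ α β' x, hC, by linarith,
    hr, hr1, isPiecewiseRational_coreWeight α β' hp _, fun x hx => ?_, ?_⟩
  · simp only [timeAverage, one_div]
    exact hμ x
  · rw [hw]
    exact coreWeight_nonneg α β' hs h hp hx
  · rw [hw]
    rfl
  · exact mul_nonneg (inv_nonneg.2 hC1.le) (coreWeight_nonneg α β' hs h hp hx)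
  -- In the class the weight is normalized by `1 - C`, which is the ballistic mass and positive.
  · have : (fun x => (1 - (1 - ballistic ‖U.a‖ ‖U.c‖ a₀ b₀ α β' 1)) *
        ((ballistic ‖U.a‖ ‖U.c‖ a₀ b₀ α β' 1)⁻¹ * coreWeight ‖U.c‖ a₀ b₀ α β' x)) =
          coreWeight ‖U.c‖ a₀ b₀ α β' := by
      funext x
      rw [sub_sub_cancel, mul_inv_cancel_left₀ hC1.ne']
    rw [this]
    rfl
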